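/- Let $\Gamma$ be a countably infinite connected graph with symmetric edge weights $\mu_{x,y}=\mu_{y,x}>0$ for $x\sim y$ (and $\mu_{x,y}=0$ otherwise) such that $\mu(x)=\sum_{y\sim x}\mu_{x,y}<\infty$ for every $x$. Let $P(x,y)=\mu_{x,y}/\mu(x)$ be the transition probabilities of the associated random walk $(X_n)$, $Pf(x)=\sum_y P(x,y)f(y)$ and $\Delta=P-I$. Let $d$ be the graph distance, $B(x,R)=\{y:d(x,y)<R\}$, $V(x,R)=\sum_{y\in B(x,R)}\mu(y)$, and let $E(x,R)=\mathbb{E}_x\big[\min\{k: X_k\notin B(x,R)\}\big]$ be the mean exit time of the ball. For $0<r<R$ let $$\rho(x,r,R)=\Big(\inf\Big\{\sum_y (-\Delta f)(y)\,f(y)\,\mu(y): f \text{ finitely supported},\ f=1 \text{ on } B(x,r),\ f=0 \text{ on } \Gamma\setminus B(x,R)\Big\}\Big)^{-1}.$$ Consider the following conditions. * $(p_0)$: there is $p_0>0$ with $\mu_{x,y}/\mu(x)\ge p_0$ for all $x\sim y$. * $(H)$ (elliptic Harnack inequality): there is $H>1$ such that for all $x\in\Gamma$, $R>0$, and every function $u$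 which is non-negative on $B(x,2R)$ and its neighbours and satisfies $Pu=u$ on $B(x,2R)$, one has $\max_{B(x,R)}u\le H\min_{B(x,R)}u$. * $(BC)$ (bounded covering): there is an integer $K$ such that for all $x\in\Gamma$, $R>0$ the ball $B(x,2R)$ can be covered by at most $K$ balls of radius $R$. * $(R_2)$ for a constant $C_2>1$: $\rho(x,R,4R)\le C_2\,\rho(x,2R,4R)$ for all $x\in\Gamma$, $R>0$. * $(R_1)$ for a constant $C_1>1$: $\rho(x,R,4R)\le C_1\,\rho(x,R,2R)$ for all $x\in\Gamma$, $R>0$. Assume $(p_0)$ and $(H)$. Then: 1. There are constants $C>0$ and $C_2>1$ such that $(R_2)$ holds with $C_2$ and, with $\gamma_2=\log_2(C_2-1)$, $$V(x,R)\le C\,E(x,R)\,\mu(x)\,R^{\gamma_2}\qquad\text{for all }x\in\Gamma,\ R\ge 1.$$ 2. For every $C_2>1$ for which $(R_2)$ holds there is $C>0$ such that, with $\gamma_2=\log_2(C_2-1)$, $V(x,R)\le C\,E(x,2R)\,\mu(x)\,R^{\gamma_2}$ for all $x\in\Gamma$, $R\ge 1$. 3. There is $c>0$ such that $cR^2\le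 E(x,R)<\infty$ for all $x\in\Gamma$, $R>0$. 4. If in addition $(BC)$ holds, then there is a constant $C_1>1$ for which $(R_1)$ holds, and for every $C_1>1$ for which $(R_1)$ holds there is $c>0$ such that, with $\gamma_1=\log_2(C_1-1)$, $$V(x,2R)\ge c\,\mu(x)\,R^{2-\gamma_1}\qquad\text{for all }x\in\Gamma,\ R\ge 1.$$ -/

import Mathlib

open MeasureTheory ProbabilityTheory
open scoped ENNReal

/-- A connected weighted graph: a symmetric weight function which is positive exactly on the
edges and has finite total weight at every vertex. -/
structure WeightedGraph (Γ : Type*) where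
  graph : SimpleGraph Γ
  connected : graph.Connected
  weight : Γ → Γ → ℝ
  weight_symm : ∀ x y, weight x y = weight y x
  weight_pos : ∀ x y, graph.Adj x y → 0 < weight x y
  weight_eq_zero : ∀ x y, ¬ graph.Adj x y → weight x y = 0
  summable_weight : ∀ x, Summable (weight x)

namespace WeightedGraph

variable {Γ : Type*}

/-! ### The weighted graph: measure, transition probabilities, balls -/

/-- `μ(x)`, the sum of the weights of the edges at `x`. -/
noncomputable def mu (G : WeightedGraph Γ) (x : Γ) : ℝ := ∑' y, G.weight x y

/-- The transition probabilities `P(x,y) = μ_{x,y} / μ(x)`. -/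
noncomputable def P (G : WeightedGraph Γ) (x y : Γ) : ℝ := G.weight x y / G.mu x

/-- The open ball `B(x,R)` of the shortest path metric. -/
def ball (G : WeightedGraph Γ) (x : Γ) (R : ℝ) : Set Γ := {y | (G.graph.dist x y : ℝ) < R}

/-- `V(x,R) = μ(B(x,R))`. -/
noncomputable def vol (G : WeightedGraph Γ) (x : Γ) (R : ℝ) : ℝ≥0∞ :=
  ∑' y : G.ball x R, ENNReal.ofReal (G.mu y)

/-- The condition `(p₀)`: controlled weights. -/
def ControlledWeights (G : WeightedGraph Γ) : Prop :=
  ∃ p₀ : ℝ, 0 < p₀ ∧ ∀ x y, G.graph.Adj x y → p₀ ≤ G.weight x y / G.mu x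

/-- The bounded covering condition `(BC)`. -/
def BoundedCovering (G : WeightedGraph Γ) : Prop :=
  ∃ K : ℕ, ∀ (x : Γ) (R : ℝ), 0 < R →
    ∃ s : Finset Γ, s.card ≤ K ∧ G.ball x (2 * R) ⊆ ⋃ y ∈ s, G.ball y R

/-! ### Markov operator, Laplacian, harmonic functions, Harnack inequality -/

/-- The Markov operator `P f(x) = ∑ P(x,y) f(y)`. -/
noncomputable def markovOp (G : WeightedGraph Γ) (f : Γ → ℝ) (x : Γ) : ℝ :=
  ∑' y, G.P x y * f y

/-- The Laplacian `Δ = P - I`. -/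
noncomputable def laplacian (G : WeightedGraph Γ) (f : Γ → ℝ) (x : Γ) : ℝ :=
  G.markovOp f x - f x

/-- `A` together with all neighbours of points of `A`. -/
def closedNhd (G : WeightedGraph Γ) (A : Set Γ) : Set Γ :=
  A ∪ {y | ∃ x ∈ A, G.graph.Adj x y}

/-- `u` is harmonic on `A`; only the values of `u` on `A` and its neighbours matter. -/
def HarmonicOn (G : WeightedGraph Γ) (u : Γ → ℝ) (A : Set Γ) : Prop :=
  ∀ x ∈ A, G.markovOp u x = u x

/-- The elliptic Harnack inequality `(H)`. -/
def EllipticHarnack (G : WeightedGraph Γ) : Prop :=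
  ∃ H : ℝ, 1 < H ∧ ∀ (x : Γ) (R : ℝ), 0 < R → ∀ u : Γ → ℝ,
    (∀ y ∈ G.closedNhd (G.ball x (2 * R)), 0 ≤ u y) → G.HarmonicOn u (G.ball x (2 * R)) →
      ∀ y ∈ G.ball x R, ∀ z ∈ G.ball x R, u y ≤ H * u z

/-! ### Resistance -/

/-- The inner product `(f,g)_μ`, used for finitely supported functions. -/
noncomputable def innerMu (G : WeightedGraph Γ) (f g : Γ → ℝ) : ℝ :=
  ∑' x, f x * g x * G.mu x

/-- The Dirichlet energy `(-Δ f, f)_μ`. -/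
noncomputable def energy (G : WeightedGraph Γ) (f : Γ → ℝ) : ℝ :=
  G.innerMu (fun x => -G.laplacian f x) f

/-- The resistance `ρ(A,B)`: the inverse of the infimum of the energies of the finitely supported
functions which are `1` on `A` and `0` on `B`. -/
noncomputable def resistance (G : WeightedGraph Γ) (A B : Set Γ) : ℝ≥0∞ :=
  (sInf ((fun f => ENNReal.ofReal (G.energy f)) ''
    {f : Γ → ℝ | f.support.Finite ∧ (∀ x ∈ A, f x = 1) ∧ ∀ x ∈ B, f x = 0}))⁻¹

/-- The resistance `ρ(x,r,R)` of an annulus. -/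
noncomputable def rho (G : WeightedGraph Γ) (x : Γ) (r R : ℝ) : ℝ≥0∞ :=
  G.resistance (G.ball x r) (G.ball x R)ᶜ

/-- `ρ(x,R,4R) ≤ C ρ(x,2R,4R)` for all `x` and `R > 0`. -/
def OuterResistanceBound (G : WeightedGraph Γ) (C : ℝ) : Prop :=
  ∀ (x : Γ) (R : ℝ), 0 < R →
    G.rho x R (4 * R) ≤ ENNReal.ofReal C * G.rho x (2 * R) (4 * R)

/-- `ρ(x,R,4R) ≤ C ρ(x,R,2R)` for all `x` and `R > 0`. -/
def InnerResistanceBound (G : WeightedGraph Γ) (C : ℝ) : Prop :=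
  ∀ (x : Γ) (R : ℝ), 0 < R →
    G.rho x R (4 * R) ≤ ENNReal.ofReal C * G.rho x R (2 * R)

/-! ### The random walk and its mean exit times -/

lemma weight_nonneg (G : WeightedGraph Γ) (x y : Γ) : 0 ≤ G.weight x y := by
  by_cases h : G.graph.Adj x y
  · exact (G.weight_pos x y h).le
  · exact (G.weight_eq_zero x y h).ge

lemma mu_pos [Nontrivial Γ] (G : WeightedGraph Γ) (x : Γ) : 0 < G.mu x := by
  obtain ⟨y, hy⟩ := G.connected.preconnected.exists_adj_of_nontrivial x
  exact (G.summable_weight x).tsum_pos (G.weight_nonneg x) y (G.weight_pos x y hy)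

lemma hasSum_P [Nontrivial Γ] (G : WeightedGraph Γ) (x : Γ) :
    HasSum (fun y => ENNReal.ofReal (G.P x y)) 1 := by
  have h : HasSum (G.P x) 1 := by
    have := (G.summable_weight x).hasSum.div_const (G.mu x)
    rwa [show (∑' y, G.weight x y) / G.mu x = 1 from div_self (G.mu_pos x).ne'] at this
  have h0 : ∀ y, 0 ≤ G.P x y := fun y => div_nonneg (G.weight_nonneg x y) (G.mu_pos x).le
  have h1 := ENNReal.ofReal_tsum_of_nonneg h0 h.summable
  rw [h.tsum_eq, ENNReal.ofReal_one] at h1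
  rw [h1]
  exact ENNReal.summable.hasSum

/-- The law `P(x,·)` of one step of the walk. -/
noncomputable def stepPMF [Nontrivial Γ] (G : WeightedGraph Γ) (x : Γ) : PMF Γ :=
  ⟨fun y => ENNReal.ofReal (G.P x y), G.hasSum_P x⟩

/-- The transition kernel of the walk. -/
noncomputable def stepKernel [Nontrivial Γ] [MeasurableSpace Γ] [DiscreteMeasurableSpace Γ]
    (G : WeightedGraph Γ) : Kernel Γ Γ where
  toFun x := (G.stepPMF x).toMeasure
  measurable' := Measurable.of_discrete

instance [Nontrivial Γ] [MeasurableSpace Γ] [DiscreteMeasurableSpace Γ] (G : WeightedGraph Γ) :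
    IsMarkovKernel G.stepKernel :=
  ⟨fun x => PMF.toMeasure.isProbabilityMeasure (G.stepPMF x)⟩

/-- The law of `X_{n+1}` given `X_0, …, X_n`: the step kernel at the current position `X_n`. -/
noncomputable def historyKernel [Nontrivial Γ] [MeasurableSpace Γ] [DiscreteMeasurableSpace Γ]
    (G : WeightedGraph Γ) (n : ℕ) : Kernel (Finset.Iic n → Γ) Γ :=
  G.stepKernel.comap (fun h => h ⟨n, Finset.mem_Iic.2 le_rfl⟩) (measurable_pi_apply _)

instance [Nontrivial Γ] [MeasurableSpace Γ] [DiscreteMeasurableSpace Γ] (G : WeightedGraph Γ)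
    (n : ℕ) : IsMarkovKernel (G.historyKernel n) := by
  unfold historyKernel
  infer_instance

/-- The law on path space of the random walk `X_0, X_1, …` started at `x`. -/
noncomputable def pathLaw [Nontrivial Γ] [MeasurableSpace Γ] [DiscreteMeasurableSpace Γ]
    (G : WeightedGraph Γ) (x : Γ) : Measure (ℕ → Γ) :=
  Kernel.traj (X := fun _ => Γ) G.historyKernel 0 (fun _ => x)

/-- The exit time `T_A = min {k : X_k ∉ A}` of a path (`∞` if the path stays in `A`). -/
noncomputable def exitTime (A : Set Γ) (X : ℕ → Γ) : ℝ≥0∞ :=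
  sInf ((fun k : ℕ => (k : ℝ≥0∞)) '' {k | X k ∉ A})

/-- The mean exit time `E_z(A)`. -/
noncomputable def meanExit [Nontrivial Γ] [MeasurableSpace Γ] [DiscreteMeasurableSpace Γ]
    (G : WeightedGraph Γ) (z : Γ) (A : Set Γ) : ℝ≥0∞ :=
  ∫⁻ X, exitTime A X ∂(G.pathLaw z)

/-- `E(x,R) = E_x(B(x,R))`. -/
noncomputable def exitE [Nontrivial Γ] [MeasurableSpace Γ] [DiscreteMeasurableSpace Γ]
    (G : WeightedGraph Γ) (x : Γ) (R : ℝ) : ℝ≥0∞ :=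
  G.meanExit x (G.ball x R)

end WeightedGraph

/-!
All the quantities are compared through the Green function `g` of a ball `B(x, R)` with pole `x`,
for which `E(x, R) = ∑ g(y) μ(y)`. By the Harnack inequality `g` is, at distance about `r` from
`x`, comparable to the resistance `ρ(x, r, R)`. Hence resistances are almost additive: the series
law `ρ(x, r, s) + ρ(x, s, R) ≤ ρ(x, r, R)` is sharp up to an error that decays exponentially in the
number of dyadic scales, and iterating `(R₁)` or `(R₂)` over these scales yields growth by the
factors `C₁ - 1` and `C₂ - 1` per scale, with no loss in the exponent. Summing `g μ` over the ball
converts this into the bounds on `V / E`, while `E(x, R) ≥ c R²` follows from the Cauchy-Schwarz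
inequality relating resistance and volume. Under `(BC)` the resistance bound `(R₁)` is obtained by
covering two spheres by boundedly many small balls, separating each pair of balls by a potential
of bounded energy, and taking minima of these potentials.
-/

namespace WeightedGraph

variable {Γ : Type*}

/-! ### Distances, balls and controlled weights -/

/-- Every vertex has finitely many neighbours. Unlike `SimpleGraph.LocallyFinite`, this is a
proposition. -/
def LocallyFinite (G : WeightedGraph Γ) : Prop :=
  ∀ x, (G.graph.neighborSet x).Finite

/-- The condition `(p₀)` with the constant `p`, in a form without division. -/
def ControlledWeightsWith (G : WeightedGraph Γ) (p : ℝ) : Prop :=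
  0 < p ∧ ∀ x y, G.graph.Adj x y → p * G.mu x ≤ G.weight x y

variable {G : WeightedGraph Γ} {p : ℝ}

lemma weight_le_mu (G : WeightedGraph Γ) (x y : Γ) : G.weight x y ≤ G.mu x :=
  (G.summable_weight x).le_tsum y fun z _ => G.weight_nonneg x z

section ControlledWeights

variable [Nontrivial Γ]

lemma ControlledWeights.exists_controlledWeightsWith (h : G.ControlledWeights) :
    ∃ p, G.ControlledWeightsWith p := by
  obtain ⟨p, hp, h⟩ := h
  exact ⟨p, hp, fun x y hxy => (le_div_iff₀ (G.mu_pos x)).1 (h x y hxy)⟩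

lemma ControlledWeightsWith.locallyFinite (hp : G.ControlledWeightsWith p) :
    G.LocallyFinite := by
  intro x
  have hpos : 0 < p * G.mu x := mul_pos hp.1 (G.mu_pos x)
  have hsmall := (G.summable_weight x).tendsto_cofinite_zero.eventually (gt_mem_nhds hpos)
  exact (Filter.eventually_cofinite.1 hsmall).subset fun y hy => not_lt.2 (hp.2 x y hy)

lemma ControlledWeights.locallyFinite (h : G.ControlledWeights) : G.LocallyFinite :=
  h.exists_controlledWeightsWith.choose_spec.locallyFinite

lemma ControlledWeightsWith.le_one (hp : G.ControlledWeightsWith p) : p ≤ 1 := by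
  obtain ⟨x, -⟩ := exists_pair_ne Γ
  obtain ⟨y, hxy⟩ := G.connected.preconnected.exists_adj_of_nontrivial x
  have h : p * G.mu x ≤ 1 * G.mu x := by
    simpa only [one_mul] using (hp.2 x y hxy).trans (G.weight_le_mu x y)
  exact le_of_mul_le_mul_right h (G.mu_pos x)

end ControlledWeights

lemma ControlledWeightsWith.mul_mu_le_mu_of_adj (hp : G.ControlledWeightsWith p) {x y : Γ}
    (hxy : G.graph.Adj x y) : p * G.mu x ≤ G.mu y :=
  (hp.2 x y hxy).trans (G.weight_symm x y ▸ G.weight_le_mu y x)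

lemma dist_triangle (G : WeightedGraph Γ) (x y z : Γ) :
    (G.graph.dist x z : ℝ) ≤ G.graph.dist x y + G.graph.dist y z := by
  exact_mod_cast G.connected.dist_triangle (u := x) (v := y) (w := z)

lemma dist_le_dist_add_one (G : WeightedGraph Γ) (x : Γ) {y z : Γ} (h : G.graph.Adj y z) :
    G.graph.dist x z ≤ G.graph.dist x y + 1 := by
  simpa only [SimpleGraph.dist_eq_one_iff_adj.2 h] using
    G.connected.dist_triangle (u := x) (v := y) (w := z)

lemma mem_ball {x y : Γ} {R : ℝ} : y ∈ G.ball x R ↔ (G.graph.dist x y : ℝ) < R := Iff.rfl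

lemma mem_ball_self (G : WeightedGraph Γ) (x : Γ) {R : ℝ} (hR : 0 < R) : x ∈ G.ball x R := by
  simpa [mem_ball] using hR

lemma ball_subset_ball (G : WeightedGraph Γ) (x : Γ) {r R : ℝ} (h : r ≤ R) :
    G.ball x r ⊆ G.ball x R := fun _ hy => lt_of_lt_of_le hy h

lemma ball_subset_ball_of_dist_add_le {x y : Γ} {r R : ℝ} (h : G.graph.dist x y + r ≤ R) :
    G.ball y r ⊆ G.ball x R := fun z hz => by
  have := G.dist_triangle x y z
  rw [mem_ball] at hz ⊢
  linarith

lemma disjoint_ball_ball {x y : Γ} {r s : ℝ} (h : r + s ≤ G.graph.dist x y) :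
    Disjoint (G.ball x r) (G.ball y s) := by
  refine Set.disjoint_left.2 fun a ha ha' => ?_
  rw [mem_ball] at ha ha'
  rw [SimpleGraph.dist_comm] at ha'
  linarith [G.dist_triangle x a y]

lemma subset_closedNhd (G : WeightedGraph Γ) (A : Set Γ) : A ⊆ G.closedNhd A :=
  fun _ => Or.inl

lemma mem_closedNhd_of_adj {A : Set Γ} {a b : Γ} (ha : a ∈ A) (h : G.graph.Adj a b) :
    b ∈ G.closedNhd A := Or.inr ⟨a, ha, h⟩

lemma closedNhd_mono {A B : Set Γ} (h : A ⊆ B) : G.closedNhd A ⊆ G.closedNhd B := by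
  rintro y (hy | ⟨x, hx, hxy⟩)
  exacts [Or.inl (h hy), Or.inr ⟨x, h hx, hxy⟩]

lemma dist_lt_of_mem_closedNhd_ball {x y : Γ} {R : ℝ} (hy : y ∈ G.closedNhd (G.ball x R)) :
    (G.graph.dist x y : ℝ) < R + 1 := by
  rcases hy with hy | ⟨z, hz, hzy⟩
  · exact (mem_ball.1 hy).trans (lt_add_one R)
  · have hzy' : (G.graph.dist x y : ℝ) ≤ G.graph.dist x z + 1 := by
      exact_mod_cast G.dist_le_dist_add_one x hzy
    linarith [mem_ball.1 hz]

lemma dist_add_dist_getVert {u v : Γ} {w : G.graph.Walk u v} (hw : w.length = G.graph.dist u v)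
    {i : ℕ} (hi : i ≤ w.length) :
    G.graph.dist u (w.getVert i) = i ∧ G.graph.dist (w.getVert i) v + i = G.graph.dist u v := by
  have htake := SimpleGraph.dist_le (w.take i)
  have hdrop := SimpleGraph.dist_le (w.drop i)
  have htri := G.connected.dist_triangle (u := u) (v := w.getVert i) (w := v)
  rw [SimpleGraph.Walk.take_length, min_eq_left hi] at htake
  rw [SimpleGraph.Walk.drop_length] at hdrop
  omega

lemma exists_dist_eq_of_le_dist (G : WeightedGraph Γ) {u v : Γ} {i : ℕ}
    (hi : i ≤ G.graph.dist u v) :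
    ∃ z, G.graph.dist u z = i ∧ G.graph.dist z v + i = G.graph.dist u v := by
  obtain ⟨w, hw⟩ := G.connected.exists_walk_length_eq_dist u v
  exact ⟨w.getVert i, dist_add_dist_getVert hw (hw ▸ hi)⟩

lemma dist_add_dist_of_mem_support {u v z : Γ} {w : G.graph.Walk u v}
    (hw : w.length = G.graph.dist u v) (hz : z ∈ w.support) :
    G.graph.dist u z + G.graph.dist z v = G.graph.dist u v := by
  obtain ⟨i, rfl, hi⟩ := SimpleGraph.Walk.mem_support_iff_exists_getVert.1 hz
  have := dist_add_dist_getVert hw hi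
  omega

namespace LocallyFinite

lemma closedNhd_finite (hf : G.LocallyFinite) {A : Set Γ} (hA : A.Finite) :
    (G.closedNhd A).Finite := by
  refine (hA.union (hA.biUnion fun y _ => hf y)).subset ?_
  rintro y (hy | ⟨x, hx, hxy⟩)
  exacts [Or.inl hy, Or.inr (Set.mem_iUnion₂.2 ⟨x, hx, hxy⟩)]

lemma exists_closedNhd_subset (hf : G.LocallyFinite) {A : Set Γ} (hA : A.Finite) :
    ∃ W : Finset Γ, G.closedNhd A ⊆ W :=
  ⟨(hf.closedNhd_finite hA).toFinset, by simp⟩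

lemma ball_finite (hf : G.LocallyFinite) (x : Γ) (R : ℝ) : (G.ball x R).Finite := by
  have hclosed : ∀ n : ℕ, {y | G.graph.dist x y ≤ n}.Finite := by
    intro n
    induction n with
    | zero => simp [G.connected.dist_eq_zero_iff]
    | succ n ih =>
      refine (hf.closedNhd_finite ih).subset fun y hy => ?_
      rcases Nat.lt_or_ge n (G.graph.dist x y) with hlt | hle
      · obtain ⟨z, hxz, hzy⟩ := G.exists_dist_eq_of_le_dist hlt.le
        have hzy : G.graph.dist z y = 1 := by have : G.graph.dist x y ≤ n + 1 := hy; omega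
        exact mem_closedNhd_of_adj (show z ∈ {y | G.graph.dist x y ≤ n} from hxz.le)
          (SimpleGraph.dist_eq_one_iff_adj.1 hzy)
      · exact G.subset_closedNhd _ hle
  refine (hclosed ⌈R⌉₊).subset fun y hy => ?_
  exact_mod_cast ((mem_ball.1 hy).trans_le (Nat.le_ceil R)).le

lemma exists_dist_eq [Infinite Γ] (hf : G.LocallyFinite) (x : Γ) (n : ℕ) :
    ∃ y, G.graph.dist x y = n := by
  obtain ⟨z, hz⟩ := (hf.ball_finite x n).exists_notMem
  have hz : n ≤ G.graph.dist x z := by simpa [mem_ball] using hz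
  obtain ⟨y, hy, -⟩ := G.exists_dist_eq_of_le_dist hz
  exact ⟨y, hy⟩

end LocallyFinite

/-! ### The Markov operator and the minimum principle -/

/-- `u` is superharmonic on `A`: `P u ≤ u` there. -/
def SuperharmonicOn (G : WeightedGraph Γ) (u : Γ → ℝ) (A : Set Γ) : Prop :=
  ∀ x ∈ A, G.markovOp u x ≤ u x

lemma HarmonicOn.superharmonicOn {u : Γ → ℝ} {A : Set Γ} (h : G.HarmonicOn u A) :
    G.SuperharmonicOn u A := fun x hx => (h x hx).le

lemma HarmonicOn.mono {u : Γ → ℝ} {A B : Set Γ} (h : G.HarmonicOn u B) (hAB : A ⊆ B) :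
    G.HarmonicOn u A := fun x hx => h x (hAB hx)

lemma SuperharmonicOn.mono {u : Γ → ℝ} {A B : Set Γ} (h : G.SuperharmonicOn u B) (hAB : A ⊆ B) :
    G.SuperharmonicOn u A := fun x hx => h x (hAB hx)

section MarkovOperator

variable [Nontrivial Γ]

lemma P_nonneg (G : WeightedGraph Γ) (x y : Γ) : 0 ≤ G.P x y :=
  div_nonneg (G.weight_nonneg x y) (G.mu_pos x).le

lemma tsum_P (G : WeightedGraph Γ) (x : Γ) : ∑' y, G.P x y = 1 := by
  simp only [P, tsum_div_const]
  exact div_self (G.mu_pos x).ne'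

lemma markovOp_const (G : WeightedGraph Γ) (c : ℝ) (x : Γ) : G.markovOp (fun _ => c) x = c := by
  rw [markovOp, tsum_mul_right, G.tsum_P, one_mul]

lemma mu_mul_neg_laplacian {W : Finset Γ} {x : Γ} (h : ∀ y, G.graph.Adj x y → y ∈ W)
    (u : Γ → ℝ) : G.mu x * -G.laplacian u x = ∑ y ∈ W, G.weight x y * (u x - u y) := by
  have hweight : ∀ y ∉ W, G.weight x y = 0 := fun y hy =>
    G.weight_eq_zero x y fun hxy => hy (h y hxy)
  have hmu : G.mu x = ∑ y ∈ W, G.weight x y := tsum_eq_sum hweight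
  have hmarkov : G.mu x * G.markovOp u x = ∑ y ∈ W, G.weight x y * u y := by
    rw [markovOp, tsum_eq_sum (s := W) fun y hy => by simp [P, hweight y hy], Finset.mul_sum]
    refine Finset.sum_congr rfl fun y _ => ?_
    rw [P, ← mul_assoc, mul_div_cancel₀ _ (G.mu_pos x).ne']
  rw [laplacian, neg_sub, mul_sub, hmarkov]
  nth_rewrite 1 [hmu]
  simp only [Finset.sum_mul, mul_sub, Finset.sum_sub_distrib]

end MarkovOperator

namespace LocallyFinite

lemma summable_P_mul (hf : G.LocallyFinite) (u : Γ → ℝ) (x : Γ) :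
    Summable fun y => G.P x y * u y := by
  refine summable_of_hasFiniteSupport ((hf x).subset fun y hy => ?_)
  by_contra hxy
  exact hy (by simp [P, G.weight_eq_zero x y hxy])

lemma markovOp_add (hf : G.LocallyFinite) (u v : Γ → ℝ) (x : Γ) :
    G.markovOp (u + v) x = G.markovOp u x + G.markovOp v x := by
  simp only [markovOp, Pi.add_apply, mul_add]
  exact (hf.summable_P_mul u x).tsum_add (hf.summable_P_mul v x)

lemma markovOp_sub (hf : G.LocallyFinite) (u v : Γ → ℝ) (x : Γ) :
    G.markovOp (u - v) x = G.markovOp u x - G.markovOp v x := by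
  simp only [markovOp, Pi.sub_apply, mul_sub]
  exact (hf.summable_P_mul u x).tsum_sub (hf.summable_P_mul v x)

end LocallyFinite

lemma markovOp_smul (G : WeightedGraph Γ) (c : ℝ) (u : Γ → ℝ) (x : Γ) :
    G.markovOp (c • u) x = c * G.markovOp u x := by
  simp only [markovOp, Pi.smul_apply, smul_eq_mul, mul_left_comm _ c, tsum_mul_left]

namespace LocallyFinite

section Nontrivial

variable [Nontrivial Γ]

lemma markovOp_const_sub (hf : G.LocallyFinite) (c : ℝ) (u : Γ → ℝ) (x : Γ) :
    G.markovOp (fun y => c - u y) x = c - G.markovOp u x :=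
  (hf.markovOp_sub (fun _ => c) u x).trans (by rw [G.markovOp_const])

lemma markovOp_mono (hf : G.LocallyFinite) {u v : Γ → ℝ} {x : Γ}
    (h : ∀ y, G.graph.Adj x y → u y ≤ v y) : G.markovOp u x ≤ G.markovOp v x := by
  refine (hf.summable_P_mul u x).tsum_le_tsum (fun y => ?_) (hf.summable_P_mul v x)
  by_cases hxy : G.graph.Adj x y
  · exact mul_le_mul_of_nonneg_left (h y hxy) (G.P_nonneg x y)
  · simp [P, G.weight_eq_zero x y hxy]

lemma P_mul_le_markovOp (hf : G.LocallyFinite) {u : Γ → ℝ} {x y : Γ}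
    (h : ∀ z, G.graph.Adj x z → 0 ≤ u z) : G.P x y * u y ≤ G.markovOp u x := by
  refine (hf.summable_P_mul u x).le_tsum y fun z _ => ?_
  by_cases hxz : G.graph.Adj x z
  · exact mul_nonneg (G.P_nonneg x z) (h z hxz)
  · simp [P, G.weight_eq_zero x z hxz]

lemma eq_of_superharmonic_of_forall_adj_le (hf : G.LocallyFinite) {v : Γ → ℝ} {x y : Γ}
    (hs : G.markovOp v x ≤ v x) (hmin : ∀ z, G.graph.Adj x z → v x ≤ v z)
    (hxy : G.graph.Adj x y) : v y = v x := by
  have hdrop : ∀ z, G.graph.Adj x z → 0 ≤ (fun z => v z - v x) z := fun z hz =>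
    sub_nonneg.2 (hmin z hz)
  have hle : G.P x y * (v y - v x) ≤ 0 := by
    refine (hf.P_mul_le_markovOp hdrop).trans ?_
    have := hf.markovOp_sub v (fun _ => v x) x
    rw [G.markovOp_const] at this
    exact this.trans_le (sub_nonpos.2 hs)
  have hP : 0 < G.P x y := div_pos (G.weight_pos x y hxy) (G.mu_pos x)
  have : v y - v x ≤ 0 := nonpos_of_mul_nonpos_right hle hP
  linarith [hmin y hxy]

end Nontrivial

lemma nonneg_of_superharmonicOn [Infinite Γ] (hf : G.LocallyFinite) {A : Set Γ} (hA : A.Finite)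
    {v : Γ → ℝ} (hs : G.SuperharmonicOn v A) (hb : ∀ x ∈ G.closedNhd A \ A, 0 ≤ v x) :
    ∀ x ∈ A, 0 ≤ v x := by
  intro x₀ hx₀
  obtain ⟨m, hm, hmin⟩ := hA.exists_minimalFor v A ⟨x₀, hx₀⟩
  have hmin : ∀ y ∈ A, v m ≤ v y := fun y hy => (le_total (v m) (v y)).elim id (hmin hy)
  by_contra! hneg
  have hvm : v m < 0 := (hmin x₀ hx₀).trans_lt hneg
  -- The minimum propagates along edges, hence to the whole graph, which is infinite.
  have hstep : ∀ x y, x ∈ A ∧ v x = v m → G.graph.Adj x y → y ∈ A ∧ v y = v m := by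
    rintro x y ⟨hx, hxm⟩ hxy
    have hge : ∀ z, G.graph.Adj x z → v x ≤ v z := fun z hxz => by
      by_cases hz : z ∈ A
      · exact hxm.trans_le (hmin z hz)
      · exact (hxm.trans_lt hvm).le.trans (hb z ⟨mem_closedNhd_of_adj hx hxz, hz⟩)
    have hym : v y = v m := (hf.eq_of_superharmonic_of_forall_adj_le (hs x hx) hge hxy).trans hxm
    refine ⟨by_contra fun hy => ?_, hym⟩
    linarith [hb y ⟨mem_closedNhd_of_adj hx hxy, hy⟩]
  have hwalk : ∀ x y, G.graph.Walk x y → x ∈ A ∧ v x = v m → y ∈ A ∧ v y = v m := by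
    intro x y w
    induction w with
    | nil => exact id
    | cons hxy _ ih => exact fun hx => ih (hstep _ _ hx hxy)
  refine Set.infinite_univ (hA.subset fun y _ => ?_)
  obtain ⟨w⟩ := G.connected.preconnected m y
  exact (hwalk m y w ⟨hm, rfl⟩).1

/-- The Laplacian of a locally finite graph as a linear endomorphism of all functions. -/
noncomputable def laplacianLinearMap (hf : G.LocallyFinite) : (Γ → ℝ) →ₗ[ℝ] (Γ → ℝ) where
  toFun := G.laplacian
  map_add' u v := by
    funext x
    simp only [laplacian, hf.markovOp_add, Pi.add_apply]
    ring
  map_smul' c u := by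
    funext x
    simp only [laplacian, G.markovOp_smul, Pi.smul_apply, smul_eq_mul, RingHom.id_apply, mul_sub]

lemma eq_zero_of_laplacian_eq_zero [Infinite Γ] (hf : G.LocallyFinite) {A : Set Γ}
    (hA : A.Finite) {u : Γ → ℝ} (h0 : ∀ x ∉ A, u x = 0) (hu : ∀ x ∈ A, G.laplacian u x = 0) :
    u = 0 := by
  have hharm : G.HarmonicOn u A := fun x hx => sub_eq_zero.1 (hu x hx)
  have hnonneg := hf.nonneg_of_superharmonicOn hA hharm.superharmonicOn
    fun x hx => (h0 x hx.2).ge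
  have hnonpos := hf.nonneg_of_superharmonicOn hA (v := fun x => 0 - u x)
    (fun x hx => by rw [hf.markovOp_const_sub, hharm x hx])
    (fun x hx => by simp [h0 x hx.2])
  funext x
  by_cases hx : x ∈ A
  · exact le_antisymm (by simpa using hnonpos x hx) (hnonneg x hx)
  · exact h0 x hx

lemma exists_neg_laplacian_eq [Infinite Γ] (hf : G.LocallyFinite) {A : Set Γ} (hA : A.Finite)
    (φ : Γ → ℝ) : ∃ u : Γ → ℝ, (∀ x ∉ A, u x = 0) ∧ ∀ x ∈ A, -G.laplacian u x = φ x := by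
  have : Finite A := hA
  let extend := Function.ExtendByZero.linearMap ℝ (Subtype.val : A → Γ)
  have extend_notMem : ∀ (f : A → ℝ), ∀ x ∉ A, extend f x = 0 := fun f x hx =>
    Function.extend_apply' f (0 : Γ → ℝ) x fun ⟨a, ha⟩ => hx (ha ▸ a.2)
  have extend_coe : ∀ (f : A → ℝ) (a : A), extend f a = f a := fun f a =>
    Subtype.val_injective.extend_apply f (0 : Γ → ℝ) a
  let T : (A → ℝ) →ₗ[ℝ] (A → ℝ) :=
    LinearMap.funLeft ℝ ℝ Subtype.val ∘ₗ hf.laplacianLinearMap ∘ₗ extend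
  have hinj : Function.Injective T := by
    rw [← LinearMap.ker_eq_bot, LinearMap.ker_eq_bot']
    intro f hf0
    have hzero : extend f = 0 := hf.eq_zero_of_laplacian_eq_zero hA (extend_notMem f)
      fun x hx => congrFun hf0 ⟨x, hx⟩
    funext a
    rw [← extend_coe f a, hzero, Pi.zero_apply, Pi.zero_apply]
  obtain ⟨f, hf'⟩ := LinearMap.injective_iff_surjective.1 hinj fun a => -φ a
  exact ⟨extend f, extend_notMem f, fun x hx => neg_eq_iff_eq_neg.2 (congrFun hf' ⟨x, hx⟩)⟩

end LocallyFinite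

lemma ControlledWeightsWith.mul_le_of_superharmonic [Nontrivial Γ]
    (hp : G.ControlledWeightsWith p) {u : Γ → ℝ} {x y : Γ} (h0 : ∀ z, G.graph.Adj x z → 0 ≤ u z)
    (hs : G.markovOp u x ≤ u x) (hxy : G.graph.Adj x y) : p * u y ≤ u x :=
  calc p * u y ≤ G.P x y * u y :=
        mul_le_mul_of_nonneg_right ((le_div_iff₀ (G.mu_pos x)).2 (hp.2 x y hxy)) (h0 y hxy)
    _ ≤ G.markovOp u x := hp.locallyFinite.P_mul_le_markovOp h0
    _ ≤ u x := hs

/-! ### The Dirichlet form -/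

/-- The Dirichlet form restricted to the edges inside the finite window `W`. On functions
supported in `D` with `G.closedNhd D ⊆ W` it does not depend on `W`. -/
noncomputable def dirichletForm (G : WeightedGraph Γ) (W : Finset Γ) :
    LinearMap.BilinForm ℝ (Γ → ℝ) :=
  let eval (x : Γ) : (Γ → ℝ) →ₗ[ℝ] ℝ := LinearMap.proj x
  (1 / 2 : ℝ) • ∑ x ∈ W, ∑ y ∈ W,
    G.weight x y • (LinearMap.mul ℝ ℝ).compl₁₂ (eval x - eval y) (eval x - eval y)

lemma dirichletForm_apply (G : WeightedGraph Γ) (W : Finset Γ) (f g : Γ → ℝ) :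
    G.dirichletForm W f g =
      1 / 2 * ∑ x ∈ W, ∑ y ∈ W, G.weight x y * ((f x - f y) * (g x - g y)) := by
  simp [dirichletForm, sub_mul]

lemma dirichletForm_isSymm (G : WeightedGraph Γ) (W : Finset Γ) :
    LinearMap.IsSymm (G.dirichletForm W) :=
  ⟨fun f g => by
    rw [RingHom.id_apply]
    simp only [dirichletForm_apply, mul_comm (f _ - f _)]⟩

lemma dirichletForm_comm (G : WeightedGraph Γ) (W : Finset Γ) (f g : Γ → ℝ) :
    G.dirichletForm W f g = G.dirichletForm W g f :=
  (G.dirichletForm_isSymm W).eq f g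

lemma dirichletForm_self_nonneg (G : WeightedGraph Γ) (W : Finset Γ) (f : Γ → ℝ) :
    0 ≤ G.dirichletForm W f f := by
  rw [dirichletForm_apply]
  exact mul_nonneg (by norm_num) (Finset.sum_nonneg fun x _ => Finset.sum_nonneg fun y _ =>
    mul_nonneg (G.weight_nonneg x y) (mul_self_nonneg _))

lemma dirichletForm_sq_le (G : WeightedGraph Γ) (W : Finset Γ) (f g : Γ → ℝ) :
    G.dirichletForm W f g ^ 2 ≤ G.dirichletForm W f f * G.dirichletForm W g g :=
  (G.dirichletForm W).apply_sq_le_of_symm (G.dirichletForm_self_nonneg W)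
    (G.dirichletForm_isSymm W) f g

lemma dirichletForm_mono (G : WeightedGraph Γ) (W : Finset Γ) {f g f' g' : Γ → ℝ}
    (h : ∀ x y, G.graph.Adj x y → (f x - f y) * (g x - g y) ≤ (f' x - f' y) * (g' x - g' y)) :
    G.dirichletForm W f g ≤ G.dirichletForm W f' g' := by
  simp only [dirichletForm_apply]
  refine mul_le_mul_of_nonneg_left ?_ (by norm_num)
  refine Finset.sum_le_sum fun x _ => Finset.sum_le_sum fun y _ => ?_
  by_cases hxy : G.graph.Adj x y
  · exact mul_le_mul_of_nonneg_left (h x y hxy) (G.weight_nonneg x y)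
  · simp only [G.weight_eq_zero x y hxy, zero_mul, le_refl]

lemma dirichletForm_congr (G : WeightedGraph Γ) (W : Finset Γ) {f g f' g' : Γ → ℝ}
    (h : ∀ x y, G.graph.Adj x y → (f x - f y) * (g x - g y) = (f' x - f' y) * (g' x - g' y)) :
    G.dirichletForm W f g = G.dirichletForm W f' g' :=
  le_antisymm (G.dirichletForm_mono W fun x y hxy => (h x y hxy).le)
    (G.dirichletForm_mono W fun x y hxy => (h x y hxy).ge)

lemma dirichletForm_min_const_le (G : WeightedGraph Γ) (W : Finset Γ) (g : Γ → ℝ) (m : ℝ) :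
    G.dirichletForm W (fun x => min (g x) m) (fun x => min (g x) m) ≤
      G.dirichletForm W g fun x => min (g x) m := by
  refine G.dirichletForm_mono W fun x y _ => ?_
  rcases le_total (g x) m with hx | hx <;> rcases le_total (g y) m with hy | hy <;>
    simp only [hx, hy, min_eq_left, min_eq_right] <;> nlinarith

lemma dirichletForm_self_le_of_abs_sub_le (G : WeightedGraph Γ) (W : Finset Γ) {f g : Γ → ℝ}
    (h : ∀ x y, G.graph.Adj x y → |f x - f y| ≤ |g x - g y|) :
    G.dirichletForm W f f ≤ G.dirichletForm W g g :=
  G.dirichletForm_mono W fun x y hxy => abs_le_iff_mul_self_le.1 (h x y hxy)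

lemma dirichletForm_min_const_self_le (G : WeightedGraph Γ) (W : Finset Γ) (f : Γ → ℝ) (m : ℝ) :
    G.dirichletForm W (fun x => min (f x) m) (fun x => min (f x) m) ≤ G.dirichletForm W f f :=
  G.dirichletForm_self_le_of_abs_sub_le W fun x y _ => by
    simpa using abs_min_sub_min_le_max (f x) m (f y) m

lemma dirichletForm_clamp_le (G : WeightedGraph Γ) (W : Finset Γ) (f : Γ → ℝ) :
    G.dirichletForm W (fun x => max 0 (min 1 (f x))) (fun x => max 0 (min 1 (f x))) ≤
      G.dirichletForm W f f :=
  G.dirichletForm_self_le_of_abs_sub_le W fun x y _ => calc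
    |max 0 (min 1 (f x)) - max 0 (min 1 (f y))|
      ≤ |min 1 (f x) - min 1 (f y)| := by
        simpa using abs_max_sub_max_le_max 0 (min 1 (f x)) 0 (min 1 (f y))
    _ ≤ |f x - f y| := by simpa using abs_min_sub_min_le_max 1 (f x) 1 (f y)

lemma continuous_dirichletForm_self (G : WeightedGraph Γ) (W : Finset Γ) :
    Continuous fun f => G.dirichletForm W f f := by
  simp only [dirichletForm_apply]
  fun_prop

section Green

variable [Nontrivial Γ]

lemma dirichletForm_eq_sum_neg_laplacian (G : WeightedGraph Γ) {W : Finset Γ} {D : Set Γ}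
    (hW : G.closedNhd D ⊆ W) (u : Γ → ℝ) {f : Γ → ℝ} (hf : ∀ x ∉ D, f x = 0) :
    G.dirichletForm W u f = ∑ x ∈ W, -G.laplacian u x * f x * G.mu x := by
  have hswap : ∑ x ∈ W, ∑ y ∈ W, G.weight x y * ((u x - u y) * f y) =
      -∑ x ∈ W, ∑ y ∈ W, G.weight x y * ((u x - u y) * f x) := by
    rw [Finset.sum_comm]
    simp only [← Finset.sum_neg_distrib]
    refine Finset.sum_congr rfl fun x _ => Finset.sum_congr rfl fun y _ => ?_
    rw [G.weight_symm y x]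
    ring
  calc G.dirichletForm W u f
      = ∑ x ∈ W, ∑ y ∈ W, G.weight x y * ((u x - u y) * f x) := by
        simp only [dirichletForm_apply, mul_sub (u _ - u _), mul_sub (G.weight _ _) (_ * f _),
          Finset.sum_sub_distrib, hswap]
        ring
    _ = ∑ x ∈ W, -G.laplacian u x * f x * G.mu x := by
        refine Finset.sum_congr rfl fun x _ => ?_
        by_cases hx : x ∈ D
        · rw [mul_right_comm, mul_comm _ (G.mu x),
            G.mu_mul_neg_laplacian (fun y hxy => hW (mem_closedNhd_of_adj hx hxy)) u,
            Finset.sum_mul]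
          simp only [mul_assoc]
        · simp [hf x hx]

lemma energy_eq_dirichletForm (G : WeightedGraph Γ) {W : Finset Γ} {D : Set Γ}
    (hW : G.closedNhd D ⊆ W) {f : Γ → ℝ} (hf : ∀ x ∉ D, f x = 0) :
    G.energy f = G.dirichletForm W f f := by
  rw [G.dirichletForm_eq_sum_neg_laplacian hW f hf, energy, innerMu, tsum_eq_sum fun x hx => ?_]
  rw [hf x fun h => hx (hW (G.subset_closedNhd D h)), mul_zero, zero_mul]

end Green

/-! ### Green functions -/

/-- `g` is the Green function of `D` with pole `x`: the function `G^D(x, ·)`, normalised with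
respect to `μ`. -/
structure IsGreen (G : WeightedGraph Γ) (D : Set Γ) (x : Γ) (g : Γ → ℝ) : Prop where
  mem : x ∈ D
  eq_zero : ∀ y ∉ D, g y = 0
  neg_laplacian_pole : -G.laplacian g x * G.mu x = 1
  harmonicOn : G.HarmonicOn g (D \ {x})

lemma LocallyFinite.exists_isGreen [Infinite Γ] (hf : G.LocallyFinite) {D : Set Γ}
    (hD : D.Finite) {x : Γ} (hx : x ∈ D) : ∃ g, G.IsGreen D x g := by
  classical
  obtain ⟨g, hg0, hg⟩ := hf.exists_neg_laplacian_eq hD (Pi.single x (G.mu x)⁻¹)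
  refine ⟨g, hx, hg0, ?_, fun y hy => ?_⟩
  · rw [hg x hx, Pi.single_eq_same, inv_mul_cancel₀ (G.mu_pos x).ne']
  · have h := hg y hy.1
    rw [Pi.single_eq_of_ne hy.2, neg_eq_zero] at h
    exact sub_eq_zero.1 h

namespace IsGreen

variable {D : Set Γ} {x : Γ} {g : Γ → ℝ}

lemma superharmonicOn [Nontrivial Γ] (hg : G.IsGreen D x g) : G.SuperharmonicOn g D := by
  intro y hy
  by_cases hyx : y = x
  · subst hyx
    have hpos : 0 < -G.laplacian g y :=
      pos_of_mul_pos_left (hg.neg_laplacian_pole ▸ one_pos) (G.mu_pos y).le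
    rw [laplacian] at hpos
    linarith
  · exact (hg.harmonicOn y ⟨hy, hyx⟩).le

lemma dirichletForm_eq [Nontrivial Γ] (hg : G.IsGreen D x g) {W : Finset Γ}
    (hW : G.closedNhd D ⊆ W) {f : Γ → ℝ} (hf : ∀ y ∉ D, f y = 0) :
    G.dirichletForm W g f = f x := by
  rw [G.dirichletForm_eq_sum_neg_laplacian hW g hf, Finset.sum_eq_single_of_mem x
    (hW (G.subset_closedNhd D hg.mem))]
  · rw [mul_right_comm, hg.neg_laplacian_pole, one_mul]
  · intro y _ hyx
    by_cases hy : y ∈ D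
    · simp [laplacian, hg.harmonicOn y ⟨hy, hyx⟩]
    · simp [hf y hy]

variable [Infinite Γ] (hf : G.LocallyFinite) (hD : D.Finite)
include hf hD

lemma nonneg (hg : G.IsGreen D x g) (y : Γ) : 0 ≤ g y := by
  by_cases hy : y ∈ D
  · exact hf.nonneg_of_superharmonicOn hD hg.superharmonicOn
      (fun z hz => (hg.eq_zero z hz.2).ge) y hy
  · exact (hg.eq_zero y hy).ge

lemma symm (hg : G.IsGreen D x g) {y : Γ} {h : Γ → ℝ} (hh : G.IsGreen D y h) : g y = h x := by
  obtain ⟨W, hW⟩ := hf.exists_closedNhd_subset hD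
  rw [← hg.dirichletForm_eq hW hh.eq_zero, ← hh.dirichletForm_eq hW hg.eq_zero,
    dirichletForm_comm]

lemma inv_mu_le (hg : G.IsGreen D x g) : (G.mu x)⁻¹ ≤ g x := by
  have hmarkov : 0 ≤ G.markovOp g x :=
    (G.markovOp_const 0 x).ge.trans (hf.markovOp_mono fun y _ => hg.nonneg hf hD y)
  rw [inv_le_iff_one_le_mul₀ (G.mu_pos x), ← hg.neg_laplacian_pole]
  refine mul_le_mul_of_nonneg_right ?_ (G.mu_pos x).le
  rw [laplacian]
  linarith

lemma le_of_forall_dist_eq (hg : G.IsGreen D x g) {n : ℕ} {M : ℝ} (hM : 0 ≤ M)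
    (h : ∀ y, G.graph.dist x y = n → g y ≤ M) {y : Γ} (hy : n ≤ G.graph.dist x y) : g y ≤ M := by
  let A : Set Γ := {z ∈ D | n < G.graph.dist x z}
  have hA : ∀ z, n ≤ G.graph.dist x z → z ∉ A → g z ≤ M := by
    intro z hnz hz
    by_cases hzD : z ∈ D
    · exact h z (le_antisymm (not_lt.1 fun hlt => hz ⟨hzD, hlt⟩) hnz)
    · exact (hg.eq_zero z hzD).trans_le hM
  by_cases hyA : y ∈ A
  · refine sub_nonneg.1 (hf.nonneg_of_superharmonicOn (hD.subset fun z hz => hz.1)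
      (v := fun z => M - g z) ?_ ?_ y hyA)
    · rintro z ⟨hzD, hnz⟩
      have hzx : z ≠ x := by rintro rfl; simp at hnz
      rw [hf.markovOp_const_sub, hg.harmonicOn z ⟨hzD, hzx⟩]
    · rintro z ⟨hz | ⟨w, hw, hwz⟩, hzA⟩
      · exact absurd hz hzA
      · have hdist := G.dist_le_dist_add_one x hwz.symm
        exact sub_nonneg.2 (hA z (by have := hw.2; omega) hzA)
  · exact hA y hy hyA

lemma ge_of_forall_dist_eq (hg : G.IsGreen D x g) {n : ℕ} {m : ℝ}
    (hnD : ∀ y, G.graph.dist x y < n → y ∈ D) (h : ∀ y, G.graph.dist x y = n → m ≤ g y) {y : Γ}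
    (hy : G.graph.dist x y ≤ n) : m ≤ g y := by
  rcases hy.eq_or_lt with hy | hy
  · exact h y hy
  refine sub_nonneg.1 (hf.nonneg_of_superharmonicOn (A := {z | G.graph.dist x z < n})
    (hD.subset hnD) (v := g - fun _ => m) ?_ ?_ y hy)
  · intro z hz
    rw [hf.markovOp_sub, G.markovOp_const, Pi.sub_apply]
    exact sub_le_sub_right (hg.superharmonicOn z (hnD z hz)) m
  · rintro z ⟨hz | ⟨w, hw, hwz⟩, hz'⟩
    · exact absurd hz hz'
    · have hdist := G.dist_le_dist_add_one x hwz
      refine sub_nonneg.2 (h z (le_antisymm ?_ (not_lt.1 hz')))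
      exact hdist.trans (Nat.succ_le_of_lt hw)

end IsGreen

lemma ControlledWeightsWith.pow_dist_mul_le [Nontrivial Γ] (hp : G.ControlledWeightsWith p)
    {u : Γ → ℝ} {x y : Γ} {R : ℝ} (h0 : ∀ z, 0 ≤ u z) (hs : G.SuperharmonicOn u (G.ball x R))
    (hy : y ∈ G.ball x R) : p ^ G.graph.dist x y * u x ≤ u y := by
  induction hn : G.graph.dist x y generalizing y with
  | zero =>
    rw [G.connected.dist_eq_zero_iff] at hn
    simp [hn]
  | succ n ih =>
    obtain ⟨z, hxz, hzy⟩ := G.exists_dist_eq_of_le_dist (u := x) (v := y) (i := n) (by omega)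
    have hadj : G.graph.Adj y z :=
      (SimpleGraph.dist_eq_one_iff_adj.1 (show G.graph.dist z y = 1 by omega)).symm
    have hz : z ∈ G.ball x R := by
      refine lt_of_le_of_lt (Nat.cast_le.2 ?_) (mem_ball.1 hy)
      omega
    calc p ^ (n + 1) * u x = p * (p ^ n * u x) := by ring
      _ ≤ p * u z := mul_le_mul_of_nonneg_left (ih hz hxz) hp.1.le
      _ ≤ u y := hp.mul_le_of_superharmonic (fun w _ => h0 w) (hs y hy) hadj

/-! ### Capacities -/

/-- `f` takes values in `[0, 1]`, is `1` on `A` and vanishes on `B`. -/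
structure IsCutoff (A B : Set Γ) (f : Γ → ℝ) : Prop where
  nonneg : ∀ x, 0 ≤ f x
  le_one : ∀ x, f x ≤ 1
  eq_one : ∀ x ∈ A, f x = 1
  eq_zero : ∀ x ∈ B, f x = 0

/-- The capacity of the annulus between `B(x, r)` and `B(x, R)`, the inverse of `ρ(x, r, R)`. -/
noncomputable def cap (G : WeightedGraph Γ) (x : Γ) (r R : ℝ) : ℝ := (G.rho x r R)⁻¹.toReal

/-- `φ` is the equilibrium potential of the annulus between `B(x, r)` and `B(x, R)`: a cutoff
function whose energy is the capacity. -/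
structure IsCapacitor (G : WeightedGraph Γ) (x : Γ) (r R : ℝ) (φ : Γ → ℝ) : Prop extends
    IsCutoff (G.ball x r) (G.ball x R)ᶜ φ where
  energy_eq : G.energy φ = G.cap x r R

section Minimizer

variable {A B : Set Γ}

lemma isCutoff_indicator (hAB : Disjoint A B) : IsCutoff A B (A.indicator fun _ => 1) where
  nonneg := Set.indicator_nonneg fun _ _ => zero_le_one
  le_one _ := Set.indicator_apply_le' (fun _ => le_rfl) fun _ => zero_le_one
  eq_one _ hx := Set.indicator_of_mem hx _
  eq_zero _ hx := Set.indicator_of_notMem (hAB.notMem_of_mem_right hx) _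

lemma isCutoff_clamp {f : Γ → ℝ} (h1 : ∀ x ∈ A, f x = 1) (h0 : ∀ x ∈ B, f x = 0) :
    IsCutoff A B fun x => max 0 (min 1 (f x)) where
  nonneg x := le_max_left _ _
  le_one x := max_le zero_le_one (min_le_left _ _)
  eq_one x hx := by simp [h1 x hx]
  eq_zero x hx := by simp [h0 x hx]

lemma isCompact_setOf_isCutoff (A B : Set Γ) : IsCompact {f | IsCutoff A B f} := by
  have heq : {f | IsCutoff A B f} = Set.pi Set.univ (fun _ => Set.Icc 0 1) ∩
      ((⋂ x ∈ A, {f | f x = 1}) ∩ ⋂ x ∈ B, {f | f x = 0}) := by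
    ext f
    simp only [Set.mem_ofPred_eq, Set.mem_inter_iff, Set.mem_univ_pi, Set.mem_Icc, Set.mem_iInter]
    exact ⟨fun h => ⟨fun x => ⟨h.nonneg x, h.le_one x⟩, h.eq_one, h.eq_zero⟩,
      fun h => ⟨fun x => (h.1 x).1, fun x => (h.1 x).2, h.2.1, h.2.2⟩⟩
  rw [heq]
  refine (isCompact_univ_pi fun _ => isCompact_Icc).inter_right (IsClosed.inter ?_ ?_) <;>
    exact isClosed_biInter fun x _ => isClosed_eq (continuous_apply x) continuous_const

lemma exists_isCutoff_forall_dirichletForm_le (G : WeightedGraph Γ) (W : Finset Γ)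
    (hAB : Disjoint A B) : ∃ φ, IsCutoff A B φ ∧ ∀ f : Γ → ℝ, (∀ x ∈ A, f x = 1) →
      (∀ x ∈ B, f x = 0) → G.dirichletForm W φ φ ≤ G.dirichletForm W f f := by
  obtain ⟨φ, hφ, hmin⟩ := (isCompact_setOf_isCutoff A B).exists_isMinOn
    ⟨_, isCutoff_indicator hAB⟩ (G.continuous_dirichletForm_self W).continuousOn
  exact ⟨φ, hφ, fun f h1 h0 => (hmin (isCutoff_clamp h1 h0)).trans (G.dirichletForm_clamp_le W f)⟩

lemma markovOp_eq_of_forall_dirichletForm_le [Nontrivial Γ] (G : WeightedGraph Γ) {W : Finset Γ}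
    {φ : Γ → ℝ} (h1 : ∀ x ∈ A, φ x = 1) (h0 : ∀ x ∈ B, φ x = 0)
    (hmin : ∀ f : Γ → ℝ, (∀ x ∈ A, f x = 1) → (∀ x ∈ B, f x = 0) →
      G.dirichletForm W φ φ ≤ G.dirichletForm W f f)
    {x : Γ} (hW : G.closedNhd {x} ⊆ W) (hA : x ∉ A) (hB : x ∉ B) :
    G.markovOp φ x = φ x := by
  classical
  let δ : Γ → ℝ := Pi.single x 1
  let t := G.laplacian φ x
  have hδ : ∀ y, y ≠ x → δ y = 0 := fun y hy => Pi.single_eq_of_ne hy _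
  have hδx : δ x = 1 := Pi.single_eq_same x _
  have hform : ∀ u, G.dirichletForm W u δ = -G.laplacian u x * G.mu x := fun u => by
    rw [G.dirichletForm_eq_sum_neg_laplacian hW u hδ, Finset.sum_eq_single_of_mem x
      (hW (G.subset_closedNhd _ rfl)) fun y _ hy => by simp [hδ y hy], hδx, mul_one]
  have hlap : G.laplacian δ x = -1 := by
    have : G.markovOp δ x = 0 := by
      rw [markovOp, tsum_eq_single x fun y hy => by rw [hδ y hy, mul_zero], P,
        G.weight_eq_zero x x (G.graph.irrefl), zero_div, zero_mul]
    rw [laplacian, this, hδx, zero_sub]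
  have hvar : ∀ y, y ≠ x → (φ + t • δ) y = φ y := fun y hy => by simp [hδ y hy]
  -- `t = Δφ(x)` is the optimal correction at `x`: it lowers the energy by `t² μ(x)`.
  have hle := hmin (φ + t • δ)
    (fun y hy => (hvar y (ne_of_mem_of_not_mem hy hA)).trans (h1 y hy))
    (fun y hy => (hvar y (ne_of_mem_of_not_mem hy hB)).trans (h0 y hy))
  simp only [map_add, map_smul, LinearMap.add_apply, LinearMap.smul_apply, smul_eq_mul,
    G.dirichletForm_comm W δ φ, hform, hlap] at hle
  have ht : t ^ 2 * G.mu x ≤ 0 := by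
    change _ ≤ _ + t * (-t * G.mu x) + t * (-t * G.mu x + _) at hle
    linarith
  have hzero : t = 0 := pow_eq_zero_iff two_ne_zero |>.1 <|
    le_antisymm (nonpos_of_mul_nonpos_left ht (G.mu_pos x)) (sq_nonneg t)
  exact sub_eq_zero.1 hzero

end Minimizer

section Capacity

variable {x : Γ} {r R : ℝ}

lemma LocallyFinite.energy_nonneg [Nontrivial Γ] (hf : G.LocallyFinite) {D : Set Γ}
    (hD : D.Finite) {f : Γ → ℝ} (h0 : ∀ x ∉ D, f x = 0) : 0 ≤ G.energy f := by
  obtain ⟨W, hW⟩ := hf.exists_closedNhd_subset hD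
  exact (G.dirichletForm_self_nonneg W f).trans_eq (G.energy_eq_dirichletForm hW h0).symm

lemma LocallyFinite.inv_rho_le_energy (hf : G.LocallyFinite) {f : Γ → ℝ}
    (h1 : ∀ y ∈ G.ball x r, f y = 1) (h0 : ∀ y ∉ G.ball x R, f y = 0) :
    (G.rho x r R)⁻¹ ≤ ENNReal.ofReal (G.energy f) := by
  rw [rho, resistance, inv_inv]
  refine sInf_le ⟨f, ⟨(hf.ball_finite x R).subset fun y hy => ?_, h1, h0⟩, rfl⟩
  exact by_contra fun h => hy (h0 y h)

lemma LocallyFinite.cap_le_energy [Nontrivial Γ] (hf : G.LocallyFinite) {f : Γ → ℝ}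
    (h1 : ∀ y ∈ G.ball x r, f y = 1) (h0 : ∀ y ∉ G.ball x R, f y = 0) :
    G.cap x r R ≤ G.energy f :=
  ENNReal.toReal_le_of_le_ofReal (hf.energy_nonneg (hf.ball_finite x R) h0)
    (hf.inv_rho_le_energy h1 h0)

lemma LocallyFinite.cap_le_dirichletForm [Nontrivial Γ] (hf : G.LocallyFinite) {W : Finset Γ}
    (hW : G.closedNhd (G.ball x R) ⊆ W) {f : Γ → ℝ} (h1 : ∀ y ∈ G.ball x r, f y = 1)
    (h0 : ∀ y ∉ G.ball x R, f y = 0) : G.cap x r R ≤ G.dirichletForm W f f :=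
  G.energy_eq_dirichletForm hW h0 ▸ hf.cap_le_energy h1 h0

lemma LocallyFinite.ofReal_cap (hf : G.LocallyFinite) (x : Γ) (hrR : r ≤ R) :
    ENNReal.ofReal (G.cap x r R) = (G.rho x r R)⁻¹ := by
  have hcut := isCutoff_indicator
    (Set.disjoint_compl_right_iff_subset.2 (G.ball_subset_ball x hrR))
  exact ENNReal.ofReal_toReal
    (ne_top_of_le_ne_top ENNReal.ofReal_ne_top (hf.inv_rho_le_energy hcut.eq_one hcut.eq_zero))

lemma LocallyFinite.exists_isCapacitor [Nontrivial Γ] (hf : G.LocallyFinite) (x : Γ)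
    (hrR : r ≤ R) : ∃ φ, G.IsCapacitor x r R φ := by
  obtain ⟨W, hW⟩ := hf.exists_closedNhd_subset (hf.ball_finite x R)
  obtain ⟨φ, hφ, hmin⟩ := G.exists_isCutoff_forall_dirichletForm_le W
    (Set.disjoint_compl_right_iff_subset.2 (G.ball_subset_ball x hrR))
  refine ⟨φ, hφ, le_antisymm ?_ (hf.cap_le_energy hφ.eq_one hφ.eq_zero)⟩
  refine (ENNReal.ofReal_le_ofReal_iff ENNReal.toReal_nonneg).1 ?_
  change _ ≤ ENNReal.ofReal (G.cap x r R)
  rw [hf.ofReal_cap x hrR, rho, resistance, inv_inv]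
  refine le_sInf ?_
  rintro _ ⟨f, ⟨-, h1, h0⟩, rfl⟩
  refine ENNReal.ofReal_le_ofReal ?_
  rw [G.energy_eq_dirichletForm hW hφ.eq_zero, G.energy_eq_dirichletForm hW h0]
  exact hmin f h1 h0

namespace IsCapacitor

variable [Nontrivial Γ] {φ : Γ → ℝ} (hφ : G.IsCapacitor x r R φ)
include hφ

lemma dirichletForm_eq {W : Finset Γ} (hW : G.closedNhd (G.ball x R) ⊆ W) :
    G.dirichletForm W φ φ = G.cap x r R := by
  rw [← hφ.energy_eq, G.energy_eq_dirichletForm hW hφ.eq_zero]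

lemma harmonicOn (hf : G.LocallyFinite) : G.HarmonicOn φ (G.ball x R \ G.ball x r) := by
  rintro y ⟨hyR, hyr⟩
  obtain ⟨W, hW⟩ := hf.exists_closedNhd_subset (hf.ball_finite x R)
  refine G.markovOp_eq_of_forall_dirichletForm_le hφ.eq_one hφ.eq_zero (fun f h1 h0 => ?_)
    ((closedNhd_mono (Set.singleton_subset_iff.2 hyR)).trans hW) hyr (not_not.2 hyR)
  exact hφ.dirichletForm_eq hW ▸ hf.cap_le_dirichletForm hW h1 h0

lemma superharmonicOn (hf : G.LocallyFinite) : G.SuperharmonicOn φ (G.ball x R) := by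
  intro y hyR
  by_cases hyr : y ∈ G.ball x r
  · rw [hφ.eq_one y hyr, ← G.markovOp_const 1 y]
    exact hf.markovOp_mono fun z _ => hφ.le_one z
  · exact (hφ.harmonicOn hf y ⟨hyR, hyr⟩).le

end IsCapacitor

variable [Infinite Γ]

lemma LocallyFinite.cap_pos (hf : G.LocallyFinite) (x : Γ) (hr : 0 < r) (hrR : r ≤ R) :
    0 < G.cap x r R := by
  have hD := hf.ball_finite x R
  obtain ⟨W, hW⟩ := hf.exists_closedNhd_subset hD
  obtain ⟨φ, hφ⟩ := hf.exists_isCapacitor x hrR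
  obtain ⟨g, hg⟩ := hf.exists_isGreen hD (G.mem_ball_self x (hr.trans_le hrR))
  have hsq := G.dirichletForm_sq_le W g φ
  rw [hg.dirichletForm_eq hW hφ.eq_zero, hφ.eq_one x (G.mem_ball_self x hr), one_pow,
    hφ.dirichletForm_eq hW] at hsq
  exact pos_of_mul_pos_right (one_pos.trans_le hsq) (G.dirichletForm_self_nonneg W g)

lemma LocallyFinite.rho_eq (hf : G.LocallyFinite) (x : Γ) (hr : 0 < r) (hrR : r ≤ R) :
    G.rho x r R = ENNReal.ofReal (G.cap x r R)⁻¹ := by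
  rw [ENNReal.ofReal_inv_of_pos (hf.cap_pos x hr hrR), hf.ofReal_cap x hrR, inv_inv]

lemma IsGreen.mul_cap_le_one (hf : G.LocallyFinite) {m : ℝ} (hr : 0 < r) {g : Γ → ℝ}
    (hg : G.IsGreen (G.ball x R) x g) (hm : 0 < m) (h : ∀ y ∈ G.ball x r, m ≤ g y) :
    m * G.cap x r R ≤ 1 := by
  obtain ⟨W, hW⟩ := hf.exists_closedNhd_subset (hf.ball_finite x R)
  let v : Γ → ℝ := fun y => min (g y) m
  have hv : ∀ y ∈ G.ball x r, v y = m := fun y hy => min_eq_right (h y hy)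
  have hv0 : ∀ y ∉ G.ball x R, v y = 0 := fun y hy => by
    simp only [v, hg.eq_zero y hy, min_eq_left hm.le]
  have henergy : G.dirichletForm W v v ≤ m := by
    refine (G.dirichletForm_min_const_le W g m).trans_eq ?_
    exact (hg.dirichletForm_eq hW hv0).trans (hv x (G.mem_ball_self x hr))
  have hcap := hf.cap_le_dirichletForm (r := r) hW (f := m⁻¹ • v)
    (fun y hy => by simp [hv y hy, hm.ne']) (fun y hy => by simp [hv0 y hy])
  calc m * G.cap x r R ≤ m * (m⁻¹ * (m⁻¹ * G.dirichletForm W v v)) := by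
        refine mul_le_mul_of_nonneg_left (hcap.trans_eq ?_) hm.le
        simp only [map_smul, LinearMap.smul_apply, smul_eq_mul]
    _ ≤ m * (m⁻¹ * (m⁻¹ * m)) := by gcongr
    _ = 1 := by field_simp

lemma IsGreen.one_le_mul_cap (hf : G.LocallyFinite) {M : ℝ} {n : ℕ} (hn : (n : ℝ) < r)
    (hrR : r ≤ R) {g : Γ → ℝ} (hg : G.IsGreen (G.ball x R) x g) (hM : 0 ≤ M)
    (h : ∀ y, G.graph.dist x y = n → g y ≤ M) : 1 ≤ M * G.cap x r R := by
  have hD := hf.ball_finite x R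
  obtain ⟨W, hW⟩ := hf.exists_closedNhd_subset hD
  obtain ⟨φ, hφ⟩ := hf.exists_isCapacitor x hrR
  let v : Γ → ℝ := fun y => min (g y) M
  have hv0 : ∀ y ∉ G.ball x R, v y = 0 := fun y hy => by
    simp only [v, hg.eq_zero y hy, min_eq_left hM]
  have henergy : G.dirichletForm W v v ≤ M :=
    ((G.dirichletForm_min_const_le W g M).trans_eq (hg.dirichletForm_eq hW hv0)).trans
      (min_le_right _ _)
  -- Truncating `g` at `M` only changes it where `φ` is constant.
  have hpair : G.dirichletForm W v φ = 1 := by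
    rw [← hφ.eq_one x (mem_ball.2 (by simpa using n.cast_nonneg.trans_lt hn)),
      ← hg.dirichletForm_eq hW hφ.eq_zero]
    refine G.dirichletForm_congr W fun y z hyz => ?_
    have hyz' := G.dist_le_dist_add_one x hyz
    have hzy' := G.dist_le_dist_add_one x hyz.symm
    by_cases hle : G.graph.dist x y ≤ n ∧ G.graph.dist x z ≤ n
    · have hone : ∀ w, G.graph.dist x w ≤ n → φ w = 1 := fun w hw =>
        hφ.eq_one w (lt_of_le_of_lt (Nat.cast_le.2 hw) hn)
      rw [hone y hle.1, hone z hle.2, sub_self, mul_zero, mul_zero]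
    · have hv : ∀ w, n ≤ G.graph.dist x w → v w = g w := fun w hw =>
        min_eq_left (hg.le_of_forall_dist_eq hf hD hM h hw)
      rw [hv y (by omega), hv z (by omega)]
  calc (1 : ℝ) = G.dirichletForm W v φ ^ 2 := by rw [hpair, one_pow]
    _ ≤ G.dirichletForm W v v * G.dirichletForm W φ φ := G.dirichletForm_sq_le W v φ
    _ ≤ M * G.cap x r R := by
      rw [hφ.dirichletForm_eq hW]
      exact mul_le_mul_of_nonneg_right henergy ENNReal.toReal_nonneg

end Capacity

/-! ### Mean exit times -/

/-- The indicator of the event that the path `X` stays in `D` up to time `n`. -/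
noncomputable def survive (D : Set Γ) (n : ℕ) (X : ℕ → Γ) : ℝ≥0∞ :=
  ∏ i ∈ Finset.Iic n, D.indicator 1 (X i)

section Exit

variable {D : Set Γ}

lemma survive_zero (D : Set Γ) (X : ℕ → Γ) : survive D 0 X = D.indicator 1 (X 0) := by
  rw [survive, ← Nat.range_succ_eq_Iic, zero_add, Finset.prod_range_one]

lemma survive_succ (D : Set Γ) (n : ℕ) (X : ℕ → Γ) :
    survive D (n + 1) X = survive D n X * D.indicator 1 (X (n + 1)) := by
  simp only [survive, ← Nat.range_succ_eq_Iic, Finset.prod_range_succ]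

lemma survive_of_forall {n : ℕ} {X : ℕ → Γ} (h : ∀ i ≤ n, X i ∈ D) : survive D n X = 1 :=
  Finset.prod_eq_one fun i hi => Set.indicator_of_mem (h i (Finset.mem_Iic.1 hi)) _

lemma survive_of_notMem {n i : ℕ} {X : ℕ → Γ} (hi : i ≤ n) (h : X i ∉ D) : survive D n X = 0 :=
  Finset.prod_eq_zero (Finset.mem_Iic.2 hi) (Set.indicator_of_notMem h _)

lemma exitTime_eq_tsum (D : Set Γ) (X : ℕ → Γ) : exitTime D X = ∑' n, survive D n X := by
  classical
  by_cases h : ∃ k, X k ∉ D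
  · have hmin : ∀ i < Nat.find h, X i ∈ D := fun i hi => not_not.1 (Nat.find_min h hi)
    have hexit : exitTime D X = Nat.find h := by
      refine le_antisymm (sInf_le ⟨_, Nat.find_spec h, rfl⟩) (le_sInf ?_)
      rintro _ ⟨j, hj, rfl⟩
      exact Nat.cast_le.2 (Nat.find_le hj)
    rw [hexit, tsum_eq_sum (s := Finset.range (Nat.find h)) fun n hn =>
        survive_of_notMem (by simpa using hn) (Nat.find_spec h),
      Finset.sum_congr rfl fun n hn => survive_of_forall fun i hi =>
        hmin i (hi.trans_lt (Finset.mem_range.1 hn))]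
    simp
  · push Not at h
    simp [exitTime, h, survive_of_forall fun i _ => h i]

variable [MeasurableSpace Γ] [DiscreteMeasurableSpace Γ]

lemma measurable_survive (D : Set Γ) (n : ℕ) : Measurable (survive D n) :=
  Finset.measurable_fun_prod _ fun i _ =>
    (Measurable.of_discrete (f := D.indicator 1)).comp (measurable_pi_apply i)

variable [Nontrivial Γ]

lemma lintegral_stepKernel_ofReal [Countable Γ] (hf : G.LocallyFinite) {e : Γ → ℝ}
    (he : ∀ y, 0 ≤ e y) (x : Γ) :
    ∫⁻ y, ENNReal.ofReal (e y) ∂G.stepKernel x = ENNReal.ofReal (G.markovOp e x) := by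
  rw [lintegral_countable', markovOp, ENNReal.ofReal_tsum_of_nonneg
    (fun y => mul_nonneg (G.P_nonneg x y) (he y)) (hf.summable_P_mul e x)]
  refine tsum_congr fun y => ?_
  rw [mul_comm (G.P x y), ENNReal.ofReal_mul (he y)]
  congr 1
  exact PMF.toMeasure_apply_singleton _ _ (measurableSet_singleton y)

lemma lintegral_pathLaw_eval_zero (G : WeightedGraph Γ) (x : Γ) (f : Γ → ℝ≥0∞) :
    ∫⁻ X, f (X 0) ∂G.pathLaw x = f x := by
  rw [pathLaw, Kernel.lintegral_traj]
  · simp [Function.updateFinset]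
  · exact Measurable.of_discrete.comp (measurable_pi_apply 0)

lemma lintegral_pathLaw_eval_succ (G : WeightedGraph Γ) (x : Γ) (n : ℕ)
    {F : (Finset.Iic n → Γ) → ℝ≥0∞} (hF : Measurable F) (f : Γ → ℝ≥0∞) :
    ∫⁻ X, F (Preorder.frestrictLe n X) * f (X (n + 1)) ∂G.pathLaw x =
      ∫⁻ X, F (Preorder.frestrictLe n X) * ∫⁻ y, f y ∂G.stepKernel (X n) ∂G.pathLaw x := by
  have hf : Measurable f := Measurable.of_discrete
  have hmeas : Measurable fun q : (Finset.Iic n → Γ) × Γ => F q.1 * f q.2 :=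
    (hF.comp measurable_fst).mul (hf.comp measurable_snd)
  calc ∫⁻ X, F (Preorder.frestrictLe n X) * f (X (n + 1)) ∂G.pathLaw x
      = ∫⁻ q, F q.1 * f q.2 ∂((G.pathLaw x).map
          fun X => (Preorder.frestrictLe (π := fun _ => Γ) n X, X (n + 1))) := by
        rw [lintegral_map hmeas]
        exact (Preorder.measurable_frestrictLe n).prodMk (measurable_pi_apply _)
    _ = ∫⁻ h, ∫⁻ y, F h * f y ∂G.historyKernel n h
          ∂((G.pathLaw x).map (Preorder.frestrictLe (π := fun _ => Γ) n)) := by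
        rw [pathLaw, ← Kernel.partialTraj_compProd_eq_map_traj (κ := G.historyKernel)
          (X := fun _ => Γ) (a := 0) (x₀ := fun _ => x) (Nat.zero_le n),
          Measure.lintegral_compProd hmeas, Kernel.traj_map_frestrictLe_apply]
    _ = ∫⁻ X, F (Preorder.frestrictLe n X) * ∫⁻ y, f y ∂G.stepKernel (X n) ∂G.pathLaw x := by
        rw [lintegral_map hmeas.lintegral_kernel_prod_right' (Preorder.measurable_frestrictLe n)]
        exact lintegral_congr fun X =>
          lintegral_const_mul (μ := G.stepKernel (X n))
            (F (Preorder.frestrictLe (π := fun _ => Γ) n X)) hf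

lemma lintegral_survive_succ_mul (G : WeightedGraph Γ) (x : Γ) (n : ℕ) {f : Γ → ℝ≥0∞}
    (h0 : ∀ y ∉ D, f y = 0) :
    ∫⁻ X, survive D (n + 1) X * f (X (n + 1)) ∂G.pathLaw x =
      ∫⁻ X, survive D n X * ∫⁻ y, f y ∂G.stepKernel (X n) ∂G.pathLaw x := by
  have hF : Measurable fun h : Finset.Iic n → Γ => ∏ i, D.indicator (1 : Γ → ℝ≥0∞) (h i) :=
    Finset.measurable_fun_prod _ fun i _ =>
      (Measurable.of_discrete (f := D.indicator 1)).comp (measurable_pi_apply i)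
  have hrestrict : ∀ X : ℕ → Γ, ∏ i, D.indicator (1 : Γ → ℝ≥0∞)
      (Preorder.frestrictLe (π := fun _ => Γ) n X i) = survive D n X := fun X =>
    Finset.prod_coe_sort (Finset.Iic n) fun i => D.indicator (1 : Γ → ℝ≥0∞) (X i)
  have hmarkov := G.lintegral_pathLaw_eval_succ x n hF f
  simp only [hrestrict] at hmarkov
  rw [← hmarkov]
  refine lintegral_congr fun X => ?_
  by_cases hX : X (n + 1) ∈ D
  · simp [survive_succ, hX]
  · simp [h0 _ hX]

lemma meanExit_eq_tsum (G : WeightedGraph Γ) (D : Set Γ) (x : Γ) :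
    G.meanExit x D = ∑' n, ∫⁻ X, survive D n X ∂G.pathLaw x := by
  simp only [meanExit, exitTime_eq_tsum]
  exact lintegral_tsum fun n => (measurable_survive D n).aemeasurable

variable [Countable Γ] {e : Γ → ℝ}

lemma lintegral_survive_mul_ofReal_succ (hf : G.LocallyFinite) (h0 : ∀ y ∉ D, e y = 0)
    (he : ∀ y, 0 ≤ e y) (hD : ∀ y ∈ D, -G.laplacian e y = 1) (x : Γ) (n : ℕ) :
    ∫⁻ X, survive D (n + 1) X * ENNReal.ofReal (e (X (n + 1))) ∂G.pathLaw x +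
        ∫⁻ X, survive D n X ∂G.pathLaw x =
      ∫⁻ X, survive D n X * ENNReal.ofReal (e (X n)) ∂G.pathLaw x := by
  rw [G.lintegral_survive_succ_mul x n (f := fun y => ENNReal.ofReal (e y))
    (fun y hy => by rw [h0 y hy, ENNReal.ofReal_zero]),
    ← lintegral_add_right _ (measurable_survive D n)]
  refine lintegral_congr fun X => ?_
  rw [lintegral_stepKernel_ofReal hf he]
  by_cases hX : X n ∈ D
  · have hmarkov : 0 ≤ G.markovOp e (X n) := tsum_nonneg fun y =>
      mul_nonneg (G.P_nonneg _ y) (he y)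
    have hstep : e (X n) = G.markovOp e (X n) + 1 := by rw [← hD _ hX, laplacian]; ring
    rw [hstep, ENNReal.ofReal_add hmarkov zero_le_one, ENNReal.ofReal_one, mul_add, mul_one]
  · simp only [survive_of_notMem le_rfl hX, zero_mul, add_zero]

lemma lintegral_survive_mul_ofReal_add_sum (hf : G.LocallyFinite) (h0 : ∀ y ∉ D, e y = 0)
    (he : ∀ y, 0 ≤ e y) (hD : ∀ y ∈ D, -G.laplacian e y = 1) (x : Γ) (n : ℕ) :
    ∫⁻ X, survive D n X * ENNReal.ofReal (e (X n)) ∂G.pathLaw x +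
      ∑ i ∈ Finset.range n, ∫⁻ X, survive D i X ∂G.pathLaw x = ENNReal.ofReal (e x) := by
  induction n with
  | zero =>
    rw [Finset.sum_range_zero, add_zero,
      ← G.lintegral_pathLaw_eval_zero x fun y => ENNReal.ofReal (e y)]
    refine lintegral_congr fun X => ?_
    by_cases hX : X 0 ∈ D
    · simp [survive_zero, hX]
    · simp [h0 _ hX]
  | succ n ih =>
    rw [Finset.sum_range_succ, add_comm _ (∫⁻ X, survive D n X ∂_), ← add_assoc,
      lintegral_survive_mul_ofReal_succ hf h0 he hD, ih]

theorem meanExit_eq_of_neg_laplacian_eq_one (hf : G.LocallyFinite) (hfin : D.Finite)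
    (h0 : ∀ y ∉ D, e y = 0) (he : ∀ y, 0 ≤ e y) (hD : ∀ y ∈ D, -G.laplacian e y = 1) (x : Γ) :
    G.meanExit x D = ENNReal.ofReal (e x) := by
  let q : ℕ → ℝ≥0∞ := fun n => ∫⁻ X, survive D n X ∂G.pathLaw x
  let A : ℕ → ℝ≥0∞ := fun n => ∫⁻ X, survive D n X * ENNReal.ofReal (e (X n)) ∂G.pathLaw x
  have hsum : ∀ n, A n + ∑ i ∈ Finset.range n, q i = ENNReal.ofReal (e x) :=
    lintegral_survive_mul_ofReal_add_sum hf h0 he hD x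
  have hle : ∑' n, q n ≤ ENNReal.ofReal (e x) := by
    rw [ENNReal.tsum_eq_iSup_nat]
    exact iSup_le fun n => hsum n ▸ le_add_self
  have hq : Filter.Tendsto q Filter.atTop (nhds 0) :=
    ENNReal.tendsto_atTop_zero_of_tsum_ne_top (ne_top_of_le_ne_top ENNReal.ofReal_ne_top hle)
  obtain ⟨M, hM⟩ := (hfin.image e).bddAbove
  have hAq : ∀ n, A n ≤ q n * ENNReal.ofReal M := fun n => by
    rw [← lintegral_mul_const _ (measurable_survive D n)]
    refine lintegral_mono fun X => ?_
    by_cases hX : X n ∈ D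
    · gcongr
      exact hM ⟨_, hX, rfl⟩
    · simp [survive_of_notMem le_rfl hX]
  have hA : Filter.Tendsto A Filter.atTop (nhds 0) := by
    refine tendsto_of_tendsto_of_tendsto_of_le_of_le tendsto_const_nhds ?_ (fun _ => zero_le) hAq
    simpa using ENNReal.Tendsto.mul_const hq (Or.inr ENNReal.ofReal_ne_top)
  have hlim := hA.add (ENNReal.tendsto_nat_tsum q)
  simp only [hsum, zero_add] at hlim
  rw [G.meanExit_eq_tsum]
  exact tendsto_nhds_unique hlim tendsto_const_nhds

end Exit

section ExitBall

lemma LocallyFinite.vol_eq [Nontrivial Γ] (hf : G.LocallyFinite) (x : Γ) (R : ℝ) :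
    G.vol x R = ENNReal.ofReal (∑ y ∈ (hf.ball_finite x R).toFinset, G.mu y) := by
  have : Fintype (G.ball x R) := (hf.ball_finite x R).fintype
  rw [vol, tsum_fintype, ENNReal.ofReal_sum_of_nonneg fun y _ => (G.mu_pos y).le,
    ← Finset.sum_coe_sort (hf.ball_finite x R).toFinset]
  exact Fintype.sum_equiv (Equiv.subtypeEquivRight fun y => by simp) _ _ fun _ => rfl

variable [Countable Γ] [Infinite Γ] [MeasurableSpace Γ] [DiscreteMeasurableSpace Γ]

lemma IsGreen.exitE_eq (hf : G.LocallyFinite) {x : Γ} {R : ℝ} {g : Γ → ℝ}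
    (hg : G.IsGreen (G.ball x R) x g) :
    G.exitE x R = ENNReal.ofReal (∑ y ∈ (hf.ball_finite x R).toFinset, g y * G.mu y) := by
  classical
  have hD := hf.ball_finite x R
  obtain ⟨e, he0, heD⟩ := hf.exists_neg_laplacian_eq hD fun _ => 1
  have hsuper : G.SuperharmonicOn e (G.ball x R) := fun y hy => by
    have := heD y hy
    rw [laplacian] at this
    linarith
  have he : ∀ y, 0 ≤ e y := fun y => by
    by_cases hy : y ∈ G.ball x R
    · exact hf.nonneg_of_superharmonicOn hD hsuper (fun z hz => (he0 z hz.2).ge) y hy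
    · exact (he0 y hy).ge
  obtain ⟨W, hW⟩ := hf.exists_closedNhd_subset hD
  rw [exitE, meanExit_eq_of_neg_laplacian_eq_one hf hD he0 he heD,
    ← hg.dirichletForm_eq hW he0, dirichletForm_comm,
    G.dirichletForm_eq_sum_neg_laplacian hW e hg.eq_zero]
  congr 1
  refine (Finset.sum_subset_zero_on_sdiff (fun y hy => ?_) (fun y hy => ?_) fun y hy => ?_).symm
  · exact hW (G.subset_closedNhd _ (by simpa using hy))
  · rw [hg.eq_zero y (by simpa using (Finset.mem_sdiff.1 hy).2), mul_zero, zero_mul]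
  · rw [heD y (by simpa using hy), one_mul]

lemma IsGreen.mul_vol_le_exitE (hf : G.LocallyFinite) {x : Γ} {r R m : ℝ} (hrR : r ≤ R)
    {g : Γ → ℝ} (hg : G.IsGreen (G.ball x R) x g) (hm : 0 ≤ m) (h : ∀ y ∈ G.ball x r, m ≤ g y) :
    ENNReal.ofReal m * G.vol x r ≤ G.exitE x R := by
  rw [hg.exitE_eq hf, hf.vol_eq, ← ENNReal.ofReal_mul hm, Finset.mul_sum]
  refine ENNReal.ofReal_le_ofReal ?_
  calc ∑ y ∈ (hf.ball_finite x r).toFinset, m * G.mu y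
      ≤ ∑ y ∈ (hf.ball_finite x r).toFinset, g y * G.mu y :=
        Finset.sum_le_sum fun y hy =>
          mul_le_mul_of_nonneg_right (h y (by simpa using hy)) (G.mu_pos y).le
    _ ≤ ∑ y ∈ (hf.ball_finite x R).toFinset, g y * G.mu y :=
        Finset.sum_le_sum_of_subset_of_nonneg (Set.Finite.toFinset_mono (G.ball_subset_ball x hrR))
          fun y _ _ => mul_nonneg (hg.nonneg hf (hf.ball_finite x R) y) (G.mu_pos y).le

end ExitBall

/-! ### Harnack chains -/

section HarnackChain

lemma le_pow_mul_of_walk {u : Γ → ℝ} {A : ℝ} (hA : 0 ≤ A) {k : ℕ} {a b : Γ}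
    (w : G.graph.Walk a b)
    (h : ∀ c ∈ w.support, ∀ d ∈ w.support, G.graph.dist c d ≤ k → u c ≤ A * u d) {m : ℕ}
    (hw : w.length ≤ m * k) : u a ≤ A ^ m * u b := by
  induction m generalizing a with
  | zero =>
    obtain rfl := w.eq_of_length_eq_zero (by simpa using hw)
    simp
  | succ m ih =>
    have hsupp : ∀ c ∈ (w.drop k).support, c ∈ w.support := fun c hc =>
      List.mem_of_mem_drop (w.drop_support_eq_support_drop_min k ▸ hc)
    have hdist : G.graph.dist a (w.getVert k) ≤ k :=
      (SimpleGraph.dist_le (w.take k)).trans (by simp [SimpleGraph.Walk.take_length])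
    calc u a ≤ A * u (w.getVert k) :=
          h a w.start_mem_support _ (w.getVert_mem_support k) hdist
      _ ≤ A * (A ^ m * u b) := by
          refine mul_le_mul_of_nonneg_left (ih (w.drop k) (fun c hc d hd =>
            h c (hsupp c hc) d (hsupp d hd)) ?_) hA
          rw [SimpleGraph.Walk.drop_length]
          rw [Nat.succ_mul] at hw
          omega
      _ = A ^ (m + 1) * u b := by ring

variable [Nontrivial Γ]

lemma exists_le_mul_of_dist_le (hp : G.ControlledWeights) (hH : G.EllipticHarnack) :
    ∃ A : ℝ, 1 ≤ A ∧ ∀ r : ℝ, 0 < r → ∃ k : ℕ, r ≤ 4 * k ∧ ∀ u : Γ → ℝ, (∀ a, 0 ≤ u a) →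
      ∀ c d, G.HarmonicOn u (G.ball d r) → G.graph.dist c d ≤ k → u c ≤ A * u d := by
  obtain ⟨p, hp⟩ := hp.exists_controlledWeightsWith
  obtain ⟨H, -, hH⟩ := hH
  have hpinv : 1 ≤ p⁻¹ := (one_le_inv₀ hp.1).2 hp.le_one
  refine ⟨max H p⁻¹, hpinv.trans (le_max_right _ _), fun r hr => ?_⟩
  rcases le_or_gt r 4 with hr4 | hr4
  · -- Balls of radius `r / 2` may be single vertices here, and `(p₀)` replaces `(H)`.
    refine ⟨1, by simpa using hr4, fun u hu c d hharm hcd => ?_⟩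
    rcases hcd.eq_or_lt with hcd | hcd
    · have hadj : G.graph.Adj d c := (SimpleGraph.dist_eq_one_iff_adj.1 hcd).symm
      have hle : p * u c ≤ u d := hp.mul_le_of_superharmonic (fun z _ => hu z)
        (hharm d (G.mem_ball_self d hr)).le hadj
      calc u c ≤ p⁻¹ * u d := (le_inv_mul_iff₀ hp.1).2 hle
        _ ≤ max H p⁻¹ * u d := mul_le_mul_of_nonneg_right (le_max_right _ _) (hu d)
    · obtain rfl := G.connected.dist_eq_zero_iff.1 (Nat.lt_one_iff.1 hcd)
      exact le_mul_of_one_le_left (hu c) (hpinv.trans (le_max_right _ _))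
  · have hfloor := Nat.floor_le (div_nonneg hr.le zero_le_four)
    have hfloor' := Nat.lt_floor_add_one (r / 4)
    refine ⟨⌊r / 4⌋₊ + 1, by push_cast; linarith, fun u hu c d hharm hcd => ?_⟩
    have hc : c ∈ G.ball d (r / 2) := by
      have hcd : (G.graph.dist c d : ℝ) ≤ ⌊r / 4⌋₊ + 1 := by exact_mod_cast hcd
      rw [mem_ball, SimpleGraph.dist_comm]
      linarith
    calc u c ≤ H * u d := hH d (r / 2) (half_pos hr) u (fun y _ => hu y)
          (by rwa [mul_div_cancel₀ r two_ne_zero]) c hc d (G.mem_ball_self d (half_pos hr))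
      _ ≤ max H p⁻¹ * u d := mul_le_mul_of_nonneg_right (le_max_left _ _) (hu d)

theorem exists_le_mul_of_walk (hp : G.ControlledWeights) (hH : G.EllipticHarnack) (N : ℕ) :
    ∃ C : ℝ, 1 ≤ C ∧ ∀ r : ℝ, 0 < r → ∀ u : Γ → ℝ, (∀ a, 0 ≤ u a) →
      ∀ (a b : Γ) (w : G.graph.Walk a b), w.length ≤ N * r →
        (∀ z ∈ w.support, G.HarmonicOn u (G.ball z r)) → u a ≤ C * u b := by
  obtain ⟨A, hA, hlocal⟩ := exists_le_mul_of_dist_le hp hH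
  refine ⟨A ^ (4 * N), one_le_pow₀ hA, fun r hr u hu a b w hw hharm => ?_⟩
  obtain ⟨k, hk, hstep⟩ := hlocal r hr
  refine le_pow_mul_of_walk (zero_le_one.trans hA) w
    (fun c _ d hd hcd => hstep u hu c d (hharm d hd) hcd) ?_
  have hlength : (w.length : ℝ) ≤ (4 * N * k : ℕ) := by
    push_cast
    calc (w.length : ℝ) ≤ N * r := hw
      _ ≤ N * (4 * k) := by gcongr
      _ = 4 * N * k := by ring
  exact_mod_cast hlength

end HarnackChain

/-! ### Green functions under the Harnack inequality -/

section GreenHarnack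

variable [Infinite Γ]

lemma IsGreen.exists_le_mul_of_walk (hp : G.ControlledWeights) (hH : G.EllipticHarnack) (N : ℕ) :
    ∃ C : ℝ, 1 ≤ C ∧ ∀ (D : Set Γ), D.Finite → ∀ (x : Γ) (g : Γ → ℝ), G.IsGreen D x g →
      ∀ r : ℝ, 0 < r → ∀ (a b : Γ) (w : G.graph.Walk a b), w.length ≤ N * r →
        (∀ z ∈ w.support, r ≤ G.graph.dist x z ∧ G.ball z r ⊆ D) → g a ≤ C * g b := by
  obtain ⟨C, hC, hchain⟩ := WeightedGraph.exists_le_mul_of_walk hp hH N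
  refine ⟨C, hC, fun D hD x g hg r hr a b w hw hsupp => ?_⟩
  refine hchain r hr g (hg.nonneg hp.locallyFinite hD) a b w hw fun z hz y hy => ?_
  refine hg.harmonicOn y ⟨(hsupp z hz).2 hy, ?_⟩
  rintro rfl
  rw [mem_ball, SimpleGraph.dist_comm] at hy
  exact hy.not_ge (hsupp z hz).1

lemma IsGreen.exists_le_mul_of_dist_le (hp : G.ControlledWeights) (hH : G.EllipticHarnack) :
    ∃ C : ℝ, 1 ≤ C ∧ ∀ (D : Set Γ), D.Finite → ∀ (o : Γ) (n : ℕ), 0 < n →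
      G.ball o (3 * n / 2) ⊆ D → ∀ g, G.IsGreen D o g → ∀ x y, G.graph.dist o x = n →
        (G.graph.dist x y : ℝ) ≤ n / 4 → g x ≤ C * g y := by
  obtain ⟨C, hC, hwalk⟩ := IsGreen.exists_le_mul_of_walk hp hH 1
  refine ⟨C, hC, fun D hD o n hn hnD g hg x y hx hxy => ?_⟩
  have hn : (0 : ℝ) < n := Nat.cast_pos.2 hn
  obtain ⟨w, hw⟩ := G.connected.exists_walk_length_eq_dist x y
  refine hwalk D hD o g hg (n / 4) (by positivity) x y w (by rw [hw]; simpa using hxy)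
    fun z hz => ?_
  have hxz : (G.graph.dist x z : ℝ) ≤ n / 4 := by
    have := dist_add_dist_of_mem_support hw hz
    exact le_trans (by exact_mod_cast (by omega)) hxy
  have hx : (G.graph.dist o x : ℝ) = n := by exact_mod_cast hx
  have hlower := G.dist_triangle o z x
  have hupper := G.dist_triangle o x z
  rw [SimpleGraph.dist_comm (u := z)] at hlower
  exact ⟨by linarith, (ball_subset_ball_of_dist_add_le (by linarith)).trans hnD⟩

lemma IsGreen.exists_comparable_pole (hp : G.ControlledWeights) (hH : G.EllipticHarnack) :
    ∃ C : ℝ, 1 ≤ C ∧ ∀ (D : Set Γ), D.Finite → ∀ (o : Γ) (n : ℕ), 0 < n →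
      G.ball o (3 * n / 2) ⊆ D → ∀ x y, G.graph.dist o x = n → G.graph.dist o y = n →
        (n : ℝ) / 4 ≤ G.graph.dist x y → ∀ h, G.IsGreen D x h → h o ≤ C * h y ∧ h y ≤ C * h o := by
  obtain ⟨C, hC, hwalk⟩ := IsGreen.exists_le_mul_of_walk hp hH 8
  refine ⟨C, hC, fun D hD o n hn hnD x y hx hy hxy h hh => ?_⟩
  have hn : (0 : ℝ) < n := Nat.cast_pos.2 hn
  obtain ⟨w, hw⟩ := G.connected.exists_walk_length_eq_dist o y
  have hlength : (w.length : ℝ) ≤ (8 : ℕ) * (n / 8 : ℝ) := by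
    rw [hw, hy]
    push_cast
    linarith
  have hsupp : ∀ z ∈ w.support, (n : ℝ) / 8 ≤ G.graph.dist x z ∧ G.ball z (n / 8) ⊆ D := by
    intro z hz
    have hgeod : (G.graph.dist o z + G.graph.dist z y : ℝ) = n := by
      exact_mod_cast (dist_add_dist_of_mem_support hw hz).trans hy
    have hx : (G.graph.dist o x : ℝ) = n := by exact_mod_cast hx
    have hxzo := G.dist_triangle o z x
    have hxzy := G.dist_triangle x z y
    have hzy : (0 : ℝ) ≤ G.graph.dist z y := Nat.cast_nonneg _
    rw [SimpleGraph.dist_comm (u := z)] at hxzo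
    exact ⟨by linarith, (ball_subset_ball_of_dist_add_le (by linarith)).trans hnD⟩
  exact ⟨hwalk D hD x h hh (n / 8) (by positivity) o y w hlength hsupp,
    hwalk D hD x h hh (n / 8) (by positivity) y o w.reverse (by simpa using hlength)
      fun z hz => hsupp z (by simpa using hz)⟩

lemma IsGreen.exists_le_mul_of_dist_eq (hp : G.ControlledWeights) (hH : G.EllipticHarnack) :
    ∃ C : ℝ, 1 ≤ C ∧ ∀ (D : Set Γ), D.Finite → ∀ (o : Γ) (n : ℕ),
      G.ball o (3 * n / 2) ⊆ D → ∀ g, G.IsGreen D o g → ∀ x y, G.graph.dist o x = n →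
        G.graph.dist o y = n → g x ≤ C * g y := by
  have hf := hp.locallyFinite
  obtain ⟨C₁, hC₁, hnear⟩ := IsGreen.exists_le_mul_of_dist_le hp hH
  obtain ⟨C₂, hC₂, hfar⟩ := IsGreen.exists_comparable_pole hp hH
  have hC₂C₂ : 1 ≤ C₂ * C₂ := one_le_mul_of_one_le_of_one_le hC₂ hC₂
  refine ⟨C₁ * (C₂ * C₂), one_le_mul_of_one_le_of_one_le hC₁ hC₂C₂,
    fun D hD o n hnD g hg x y hx hy => ?_⟩
  have hg0 := hg.nonneg hf hD
  have hC₁0 : 0 ≤ C₁ := zero_le_one.trans hC₁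
  rcases n.eq_zero_or_pos with rfl | hn
  · obtain rfl := G.connected.dist_eq_zero_iff.1 hx
    obtain rfl := G.connected.dist_eq_zero_iff.1 hy
    exact le_mul_of_one_le_left (hg0 o) (one_le_mul_of_one_le_of_one_le hC₁ hC₂C₂)
  rcases le_total (G.graph.dist x y : ℝ) (n / 4) with hxy | hxy
  · calc g x ≤ C₁ * g y := hnear D hD o n hn hnD g hg x y hx hxy
      _ ≤ C₁ * (C₂ * C₂) * g y :=
        mul_le_mul_of_nonneg_right (le_mul_of_one_le_right hC₁0 hC₂C₂) (hg0 y)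
  · -- Symmetry moves the pole away from the walks joining `o` to `y` and to `x`.
    have hsphere : ∀ z, G.graph.dist o z = n → z ∈ D := fun z hz => hnD <| by
      have hn : (0 : ℝ) < n := Nat.cast_pos.2 hn
      rw [mem_ball, hz]
      linarith
    obtain ⟨gx, hgx⟩ := hf.exists_isGreen hD (hsphere x hx)
    obtain ⟨gy, hgy⟩ := hf.exists_isGreen hD (hsphere y hy)
    have hox := (hfar D hD o n hn hnD x y hx hy hxy gx hgx).1
    have hoy := (hfar D hD o n hn hnD y x hy hx (by rwa [SimpleGraph.dist_comm]) gy hgy).2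
    calc g x = gx o := hg.symm hf hD hgx
      _ ≤ C₂ * gx y := hox
      _ = C₂ * gy x := by rw [hgx.symm hf hD hgy]
      _ ≤ C₂ * (C₂ * gy o) := mul_le_mul_of_nonneg_left hoy (zero_le_one.trans hC₂)
      _ = C₂ * C₂ * g y := by rw [hg.symm hf hD hgy, mul_assoc]
      _ ≤ C₁ * (C₂ * C₂) * g y :=
        mul_le_mul_of_nonneg_right (le_mul_of_one_le_left (zero_le_one.trans hC₂C₂) hC₁) (hg0 y)

lemma IsGreen.exists_le_mul_of_dist_eq_of_dist_le (hp : G.ControlledWeights)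
    (hH : G.EllipticHarnack) :
    ∃ C : ℝ, 1 ≤ C ∧ ∀ (D : Set Γ), D.Finite → ∀ (o : Γ) (n : ℕ),
      G.ball o (3 * n / 2) ⊆ D → ∀ g, G.IsGreen D o g → ∀ x y, G.graph.dist o x = n →
        G.graph.dist o y ≤ n → g x ≤ C * g y := by
  obtain ⟨C, hC, hsphere⟩ := IsGreen.exists_le_mul_of_dist_eq hp hH
  have hC0 : 0 < C := zero_lt_one.trans_le hC
  refine ⟨C, hC, fun D hD o n hnD g hg x y hx hy => ?_⟩
  have hball : ∀ z, G.graph.dist o z < n → z ∈ D := fun z hz => hnD <| by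
    have hz : (G.graph.dist o z : ℝ) < n := by exact_mod_cast hz
    rw [mem_ball]
    linarith [hz, (Nat.cast_nonneg n : (0 : ℝ) ≤ n)]
  refine (div_le_iff₀' hC0).1 (hg.ge_of_forall_dist_eq hp.locallyFinite hD hball
    (fun z hz => ?_) hy)
  exact (div_le_iff₀' hC0).2 (hsphere D hD o n hnD g hg x z hx hz)

end GreenHarnack

section DoubleScale

lemma exists_nat_lt_le_add_one {R : ℝ} (hR : 0 < R) : ∃ n : ℕ, (n : ℝ) < R ∧ R ≤ n + 1 := by
  obtain ⟨n, hn⟩ := Nat.exists_eq_succ_of_ne_zero (Nat.ceil_pos.2 hR).ne'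
  have hlt := Nat.ceil_lt_add_one hR.le
  have hle := Nat.le_ceil R
  rw [hn, Nat.cast_succ] at hlt hle
  exact ⟨n, by linarith, hle⟩

variable [Infinite Γ]

lemma LocallyFinite.exists_forall_dist_eq_le (hf : G.LocallyFinite) (x : Γ) (n : ℕ) (g : Γ → ℝ) :
    ∃ z, G.graph.dist x z = n ∧ ∀ y, G.graph.dist x y = n → g y ≤ g z := by
  have hfin : {y | G.graph.dist x y = n}.Finite :=
    (hf.ball_finite x (n + 1)).subset fun y (hy : G.graph.dist x y = n) => by
      simp [mem_ball, hy]
  obtain ⟨z, hz, hmax⟩ := hfin.exists_maximalFor g _ (hf.exists_dist_eq x n)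
  exact ⟨z, hz, fun y hy => (le_total (g y) (g z)).elim id fun h => hmax hy h⟩

lemma IsGreen.exists_dist_le_le_mul (hp : G.ControlledWeights) (hH : G.EllipticHarnack) :
    ∃ C : ℝ, 1 ≤ C ∧ ∀ (x : Γ) (R : ℝ) (n : ℕ), (n : ℝ) < R → R ≤ n + 1 →
      ∀ g, G.IsGreen (G.ball x (4 * R)) x g → ∀ y ∈ G.ball x (2 * R),
        ∃ v, G.graph.dist x v ≤ n ∧ g v ≤ C * g y := by
  have hf := hp.locallyFinite
  obtain ⟨C, hC, hwalk⟩ := IsGreen.exists_le_mul_of_walk hp hH 3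
  obtain ⟨p, hp⟩ := hp.exists_controlledWeightsWith
  refine ⟨max C p⁻¹, hC.trans (le_max_left _ _), fun x R n hnR hRn g hg y hy => ?_⟩
  have hD := hf.ball_finite x (4 * R)
  have hg0 := hg.nonneg hf hD
  have hy2 := mem_ball.1 hy
  rcases le_or_gt (G.graph.dist x y) n with hyn | hyn
  · exact ⟨y, hyn, le_mul_of_one_le_left (hg0 y) (hC.trans (le_max_left _ _))⟩
  rcases n.eq_zero_or_pos with rfl | hn
  · have hadj : G.graph.Adj y x := by
      have hlt : (G.graph.dist x y : ℝ) < (2 : ℕ) := by push_cast at hRn ⊢; linarith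
      have := Nat.cast_lt.1 hlt
      exact (SimpleGraph.dist_eq_one_iff_adj.1 (by omega : G.graph.dist x y = 1)).symm
    have hle : p * g x ≤ g y := hp.mul_le_of_superharmonic (fun z _ => hg0 z)
      (hg.superharmonicOn y (mem_ball.2 (by linarith))) hadj
    refine ⟨x, by simp, ?_⟩
    calc g x ≤ p⁻¹ * g y := (le_inv_mul_iff₀ hp.1).2 hle
      _ ≤ max C p⁻¹ * g y := mul_le_mul_of_nonneg_right (le_max_right _ _) (hg0 y)
  · have hn : (1 : ℝ) ≤ n := by exact_mod_cast hn
    obtain ⟨v, hxv, hvy⟩ := G.exists_dist_eq_of_le_dist hyn.le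
    obtain ⟨w, hw⟩ := G.connected.exists_walk_length_eq_dist v y
    have hvy' : (G.graph.dist v y + n : ℝ) = G.graph.dist x y := by exact_mod_cast hvy
    refine ⟨v, hxv.le, (hwalk _ hD x g hg n (by linarith) v y w ?_ fun z hz => ?_).trans
      (mul_le_mul_of_nonneg_right (le_max_left _ _) (hg0 y))⟩
    · rw [hw]
      push_cast
      linarith
    · have hgeod : (G.graph.dist v z + G.graph.dist z y : ℝ) = G.graph.dist v y := by
        exact_mod_cast dist_add_dist_of_mem_support hw hz
      have hxzy := G.dist_triangle x z y
      have hxvz := G.dist_triangle x v z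
      have hzy : (0 : ℝ) ≤ G.graph.dist z y := Nat.cast_nonneg _
      rw [hxv] at hxvz
      exact ⟨by linarith, ball_subset_ball_of_dist_add_le (by linarith)⟩

theorem IsGreen.exists_forall_le_mul (hp : G.ControlledWeights) (hH : G.EllipticHarnack) :
    ∃ C : ℝ, 1 ≤ C ∧ ∀ (x : Γ) (R : ℝ), 0 < R → ∀ g, G.IsGreen (G.ball x (4 * R)) x g →
      ∃ (M : ℝ) (n : ℕ), 0 < M ∧ n < R ∧ (∀ y, G.graph.dist x y = n → g y ≤ M) ∧
        ∀ y ∈ G.ball x (2 * R), M ≤ C * g y := by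
  have hf := hp.locallyFinite
  obtain ⟨C₁, hC₁, hinner⟩ := IsGreen.exists_le_mul_of_dist_eq_of_dist_le hp hH
  obtain ⟨C₂, hC₂, houter⟩ := IsGreen.exists_dist_le_le_mul hp hH
  refine ⟨C₁ * C₂, one_le_mul_of_one_le_of_one_le hC₁ hC₂, fun x R hR g hg => ?_⟩
  obtain ⟨n, hnR, hRn⟩ := exists_nat_lt_le_add_one hR
  have hD := hf.ball_finite x (4 * R)
  obtain ⟨z, hz, hmax⟩ := hf.exists_forall_dist_eq_le x n g
  have hz0 := hg.nonneg hf hD z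
  have hpos : 0 < g z := by
    have hcap := hg.one_le_mul_cap hf hnR (by linarith) hz0 hmax
    exact hz0.lt_of_ne fun h => by simp [← h] at hcap; linarith
  refine ⟨g z, n, hpos, hnR, hmax, fun y hy => ?_⟩
  obtain ⟨v, hv, hvy⟩ := houter x R n hnR hRn g hg y hy
  calc g z ≤ C₁ * g v := hinner _ hD x n (G.ball_subset_ball x (by linarith)) g hg z v hz hv
    _ ≤ C₁ * (C₂ * g y) := mul_le_mul_of_nonneg_left hvy (zero_le_one.trans hC₁)
    _ = C₁ * C₂ * g y := by ring

theorem exists_cap_le_mul_cap (hp : G.ControlledWeights) (hH : G.EllipticHarnack) :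
    ∃ C : ℝ, 1 ≤ C ∧ ∀ (x : Γ) (R : ℝ), 0 < R →
      G.cap x (2 * R) (4 * R) ≤ C * G.cap x R (4 * R) := by
  have hf := hp.locallyFinite
  obtain ⟨C, hC, hgreen⟩ := IsGreen.exists_forall_le_mul hp hH
  have hC0 : 0 < C := zero_lt_one.trans_le hC
  refine ⟨C, hC, fun x R hR => ?_⟩
  obtain ⟨g, hg⟩ := hf.exists_isGreen (hf.ball_finite x (4 * R))
    (G.mem_ball_self x (by linarith))
  obtain ⟨M, n, hM, hnR, hle, hge⟩ := hgreen x R hR g hg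
  have hupper := hg.one_le_mul_cap hf hnR (by linarith) hM.le hle
  have hlower := hg.mul_cap_le_one hf (r := 2 * R) (by linarith) (div_pos hM hC0)
    fun y hy => (div_le_iff₀' hC0).2 (hge y hy)
  rw [div_mul_eq_mul_div, div_le_one hC0] at hlower
  refine le_of_mul_le_mul_left ?_ hM
  calc M * G.cap x (2 * R) (4 * R) ≤ C * 1 := by rwa [mul_one]
    _ ≤ C * (M * G.cap x R (4 * R)) := mul_le_mul_of_nonneg_left hupper hC0.le
    _ = M * (C * G.cap x R (4 * R)) := by ring

lemma le_of_superharmonicOn_of_le_isGreen (hf : G.LocallyFinite) {ξ : Γ} {r R t M : ℝ}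
    {h g : Γ → ℝ} {n : ℕ} (ht : 0 ≤ t) (hnn : ∀ a ∈ G.closedNhd (G.ball ξ R), 0 ≤ h a)
    (hsup : G.SuperharmonicOn h (G.ball ξ R)) (hball : ∀ a ∈ G.ball ξ r, t ≤ h a)
    (hg : G.IsGreen (G.ball ξ R) ξ g) (hM : 0 < M) (hnr : (n : ℝ) < r)
    (hle : ∀ y, G.graph.dist ξ y = n → g y ≤ M) {a : Γ} (ha : a ∈ G.ball ξ R)
    (hna : n < G.graph.dist ξ a) : t / M * g a ≤ h a := by
  let A : Set Γ := {b ∈ G.ball ξ R | n < G.graph.dist ξ b}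
  have hA : A ⊆ G.ball ξ R := fun b hb => hb.1
  refine sub_nonneg.1 (hf.nonneg_of_superharmonicOn ((hf.ball_finite ξ R).subset hA)
    (v := h - (t / M) • g) (fun b hb => ?_) ?_ a ⟨ha, hna⟩)
  · have hbξ : b ≠ ξ := by
      rintro rfl
      simpa using hb.2
    rw [hf.markovOp_sub, G.markovOp_smul, hg.harmonicOn b ⟨hb.1, hbξ⟩]
    exact sub_le_sub_right (hsup b hb.1) _
  · rintro b ⟨hb, hbA⟩
    refine sub_nonneg.2 ?_
    by_cases hbR : b ∈ G.ball ξ R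
    · obtain ⟨c, hc, hcb⟩ := hb.resolve_left hbA
      have hnb : ¬n < G.graph.dist ξ b := fun hlt => hbA ⟨hbR, hlt⟩
      have hcb := G.dist_le_dist_add_one ξ hcb.symm
      have hbn : G.graph.dist ξ b = n := by have := hc.2; omega
      calc t / M * g b ≤ t / M * M :=
            mul_le_mul_of_nonneg_left (hle b hbn) (div_nonneg ht hM.le)
        _ = t := div_mul_cancel₀ t hM.ne'
        _ ≤ h b := hball b (by rwa [mem_ball, hbn])
    · simpa [hg.eq_zero b hbR] using hnn b (closedNhd_mono hA hb)

theorem exists_mul_le_of_superharmonicOn (hp : G.ControlledWeights) (hH : G.EllipticHarnack) :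
    ∃ c : ℝ, 0 < c ∧ c < 1 ∧ ∀ (ξ : Γ) (r : ℝ), 0 < r → ∀ (h : Γ → ℝ) (t : ℝ), 0 ≤ t →
      (∀ a ∈ G.closedNhd (G.ball ξ (4 * r)), 0 ≤ h a) →
      G.SuperharmonicOn h (G.ball ξ (4 * r)) →
      (∀ a ∈ G.ball ξ r, t ≤ h a) → ∀ a ∈ G.ball ξ (2 * r), c * t ≤ h a := by
  have hf := hp.locallyFinite
  obtain ⟨C, hC, hgreen⟩ := IsGreen.exists_forall_le_mul hp hH
  have hC0 : 0 < C := zero_lt_one.trans_le hC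
  refine ⟨(C + 1)⁻¹, by positivity, inv_lt_one_of_one_lt₀ (by linarith),
    fun ξ r hr h t ht hnn hsup hball a ha => ?_⟩
  obtain ⟨g, hg⟩ := hf.exists_isGreen (hf.ball_finite ξ (4 * r))
    (G.mem_ball_self ξ (by linarith))
  obtain ⟨M, n, hM, hnr, hle, hge⟩ := hgreen ξ r hr g hg
  have ht_le : (C + 1)⁻¹ * t ≤ C⁻¹ * t :=
    mul_le_mul_of_nonneg_right (inv_anti₀ hC0 (by linarith)) ht
  refine ht_le.trans ?_
  rcases le_or_gt (G.graph.dist ξ a) n with han | han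
  · have han : (G.graph.dist ξ a : ℝ) ≤ n := by exact_mod_cast han
    calc C⁻¹ * t ≤ t := mul_le_of_le_one_left ht (inv_le_one_of_one_le₀ hC)
      _ ≤ h a := hball a (han.trans_lt hnr)
  · calc C⁻¹ * t = t / M * (M / C) := by field_simp
      _ ≤ t / M * g a := mul_le_mul_of_nonneg_left ((div_le_iff₀' hC0).2 (hge a ha))
          (div_nonneg ht hM.le)
      _ ≤ h a := le_of_superharmonicOn_of_le_isGreen hf ht hnn hsup hball hg hM hnr hle
          (G.ball_subset_ball ξ (by linarith) ha) han

end DoubleScale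

/-! ### Resistance conditions in terms of capacities -/

section ResistanceBound

variable [Infinite Γ]

lemma LocallyFinite.rho_le_mul_rho_iff (hf : G.LocallyFinite) {x : Γ} {r R s S C : ℝ}
    (hr : 0 < r) (hrR : r ≤ R) (hs : 0 < s) (hsS : s ≤ S) (hC : 0 ≤ C) :
    G.rho x r R ≤ ENNReal.ofReal C * G.rho x s S ↔ G.cap x s S ≤ C * G.cap x r R := by
  have hcap := hf.cap_pos x hr hrR
  have hcap' := hf.cap_pos x hs hsS
  rw [hf.rho_eq x hr hrR, hf.rho_eq x hs hsS, ← ENNReal.ofReal_mul hC,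
    ENNReal.ofReal_le_ofReal_iff (by positivity), inv_le_iff_one_le_mul₀ hcap, mul_assoc,
    inv_mul_eq_div, mul_div_assoc', le_div_iff₀ hcap', one_mul]

lemma LocallyFinite.outerResistanceBound_iff (hf : G.LocallyFinite) {C : ℝ} (hC : 0 ≤ C) :
    G.OuterResistanceBound C ↔
      ∀ (x : Γ) (R : ℝ), 0 < R → G.cap x (2 * R) (4 * R) ≤ C * G.cap x R (4 * R) :=
  forall₃_congr fun _ _ _ =>
    hf.rho_le_mul_rho_iff (by linarith) (by linarith) (by linarith) (by linarith) hC

lemma LocallyFinite.innerResistanceBound_iff (hf : G.LocallyFinite) {C : ℝ} (hC : 0 ≤ C) :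
    G.InnerResistanceBound C ↔
      ∀ (x : Γ) (R : ℝ), 0 < R → G.cap x R (2 * R) ≤ C * G.cap x R (4 * R) :=
  forall₃_congr fun _ _ _ =>
    hf.rho_le_mul_rho_iff (by linarith) (by linarith) (by linarith) (by linarith) hC

end ResistanceBound

/-! ### Almost additivity of resistances -/

lemma exists_forall_le_mul_rpow_neg {b θ : ℝ} (hb : 1 < b) (hθ0 : 0 < θ) (hθ1 : θ < 1) :
    ∃ β : ℝ, 0 < β ∧ ∀ a t : ℝ, 1 ≤ t → (∀ j : ℕ, b ^ j ≤ t → a ≤ θ ^ j) → a ≤ θ⁻¹ * t ^ (-β) := by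
  have hb0 : 0 < b := zero_lt_one.trans hb
  refine ⟨-Real.logb b θ, neg_pos.2 (Real.logb_neg hb hθ0 hθ1), fun a t ht h => ?_⟩
  obtain ⟨j, hjt, htj⟩ := exists_nat_pow_near ht hb
  refine (h j hjt).trans ?_
  rw [neg_neg, inv_mul_eq_div, le_div_iff₀ hθ0, ← pow_succ]
  calc θ ^ (j + 1) = (b ^ (j + 1)) ^ Real.logb b θ := by
        rw [← Real.rpow_natCast b, ← Real.rpow_mul hb0.le, mul_comm, Real.rpow_mul hb0.le,
          Real.rpow_logb hb0 hb.ne' hθ0, Real.rpow_natCast]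
    _ ≤ t ^ Real.logb b θ :=
        Real.rpow_le_rpow_of_nonpos (zero_lt_one.trans_le ht) htj.le
          (Real.logb_neg hb hθ0 hθ1).le

lemma exp_neg_mul_le_of_one_sub_le {p C y s : ℝ} (hp : 0 < p) (hpy : p ≤ y)
    (hs : 0 ≤ C * s) (h : 1 - y ≤ C * s) : Real.exp (-(C / p * s)) ≤ y := by
  have hy : 0 < y := hp.trans_le hpy
  rw [← Real.le_log_iff_exp_le hy]
  have hlog := Real.one_sub_inv_le_log_of_pos hy
  have hinv : y⁻¹ - 1 ≤ C / p * s := by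
    calc y⁻¹ - 1 = (1 - y) / y := by field_simp
      _ ≤ C * s / p := div_le_div₀ hs h hp hpy
      _ = C / p * s := by ring
  linarith

lemma dirichletForm_eq_zero_of_eqOn_closedNhd (G : WeightedGraph Γ) (W : Finset Γ) {A : Set Γ}
    {f g : Γ → ℝ} {c : ℝ} (hf : ∀ y ∉ A, f y = 0) (hg : ∀ y ∈ G.closedNhd A, g y = c) :
    G.dirichletForm W f g = 0 := by
  rw [← map_zero (G.dirichletForm W f)]
  refine G.dirichletForm_congr W fun a b hab => ?_
  by_cases ha : a ∈ A
  · rw [hg a (G.subset_closedNhd A ha), hg b (mem_closedNhd_of_adj ha hab)]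
    simp only [Pi.zero_apply, sub_self]
  by_cases hb : b ∈ A
  · rw [hg b (G.subset_closedNhd A hb), hg a (mem_closedNhd_of_adj hb hab.symm)]
    simp only [Pi.zero_apply, sub_self]
  · rw [hf a ha, hf b hb]
    simp only [Pi.zero_apply, sub_self, mul_zero, zero_mul]

section Infinite

variable [Infinite Γ] {x w : Γ} {s t : ℝ} {φ : Γ → ℝ}

lemma IsCapacitor.exists_one_sub_le_mul (hp : G.ControlledWeights) (hH : G.EllipticHarnack) :
    ∃ c : ℝ, 0 < c ∧ c < 1 ∧ ∀ (x : Γ) (s t : ℝ) (φ : Γ → ℝ), G.IsCapacitor x s t φ →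
      ∀ w ∈ G.closedNhd (G.ball x s) \ G.ball x s, ∀ k : ℕ, 0 < k → (k : ℝ) ≤ s →
      s + 1 + 3 * k ≤ t → ∀ S, 0 ≤ S → (∀ q ∈ G.ball w (6 * k), 1 - φ q ≤ S) →
      ∀ q ∈ G.ball w k, 1 - φ q ≤ (1 - c) * S := by
  have hf := hp.locallyFinite
  obtain ⟨c, hc0, hc1, hc⟩ := exists_mul_le_of_superharmonicOn hp hH
  refine ⟨c, hc0, hc1, fun x s t φ hφ w hw k hk hks hkt S hS h q hq => ?_⟩
  have hk1 : (1 : ℝ) ≤ k := by exact_mod_cast hk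
  have hxw := dist_lt_of_mem_closedNhd_ball hw.1
  have hsw : s ≤ G.graph.dist x w := not_lt.1 hw.2
  have hkw : k ≤ G.graph.dist w x := by
    rw [SimpleGraph.dist_comm]; exact_mod_cast hks.trans hsw
  -- From a vertex `ζ` at distance `k` from `w` towards `x`, the ball `B(ζ, k)`, on which
  -- `φ = 1`, is comparable with a ball around `w`.
  obtain ⟨ζ, hwζ, hζx⟩ := G.exists_dist_eq_of_le_dist hkw
  have hxζ : (G.graph.dist x ζ : ℝ) + k = G.graph.dist x w := by
    rw [SimpleGraph.dist_comm, SimpleGraph.dist_comm (u := x)]; exact_mod_cast hζx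
  have hζw : (G.graph.dist ζ w : ℝ) = k := by rw [SimpleGraph.dist_comm, hwζ]
  have hnear : ∀ a ∈ G.closedNhd (G.ball ζ (4 * k)), 1 - φ a ≤ S := fun a ha => by
    have hwa := G.dist_triangle w ζ a
    rw [hwζ] at hwa
    exact h a (by rw [mem_ball]; linarith [dist_lt_of_mem_closedNhd_ball ha])
  have hsuper : G.SuperharmonicOn (fun a => φ a - (1 - S)) (G.ball ζ (4 * k)) := fun a ha => by
    have hsub := hf.markovOp_sub φ (fun _ => 1 - S) a
    rw [markovOp_const] at hsub
    have hax : a ∈ G.ball x t := G.ball_subset_ball_of_dist_add_le (by linarith) ha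
    exact hsub.trans_le (sub_le_sub_right (hφ.superharmonicOn hf a hax) _)
  have hone : ∀ a ∈ G.ball ζ k, S ≤ φ a - (1 - S) := fun a ha => by
    have hxa : (G.graph.dist x a : ℝ) < G.graph.dist x w := by
      linarith [G.dist_triangle x ζ a, mem_ball.1 ha]
    have hxa' : (G.graph.dist x a : ℝ) + 1 ≤ G.graph.dist x w := by exact_mod_cast hxa
    linarith [hφ.eq_one a (mem_ball.2 (by linarith))]
  have hlow := hc ζ k (by linarith) _ S hS (fun a ha => by linarith [hnear a ha]) hsuper hone q
    (G.ball_subset_ball_of_dist_add_le (by linarith) hq)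
  linarith

lemma IsCapacitor.exists_one_sub_le_mul_rpow (hp : G.ControlledWeights)
    (hH : G.EllipticHarnack) :
    ∃ C β : ℝ, 0 < C ∧ 0 < β ∧ ∀ (x : Γ) (R : ℝ), 1 ≤ R → ∀ φ, G.IsCapacitor x (2 * R) (4 * R) φ →
      ∀ w ∈ G.closedNhd (G.ball x (2 * R)), 1 - φ w ≤ C * R ^ (-β) := by
  obtain ⟨c, hc0, hc1, hc⟩ := IsCapacitor.exists_one_sub_le_mul hp hH
  have hθ : 0 < 1 - c := sub_pos.2 hc1
  obtain ⟨β, hβ, hpow⟩ := exists_forall_le_mul_rpow_neg (b := 6) (by norm_num) hθ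
    (sub_lt_self 1 hc0)
  refine ⟨(1 - c)⁻¹, β, inv_pos.2 hθ, hβ, fun x R hR φ hφ w hw => ?_⟩
  by_cases hwR : w ∈ G.ball x (2 * R)
  · rw [hφ.eq_one w hwR, sub_self]
    positivity
  have hdecay : ∀ j : ℕ, (6 : ℝ) ^ j ≤ R → ∀ S, 0 ≤ S →
      (∀ q ∈ G.ball w (6 ^ j), 1 - φ q ≤ S) → 1 - φ w ≤ (1 - c) ^ j * S := by
    intro j
    induction j with
    | zero => exact fun _ S _ h => by simpa using h w (G.mem_ball_self w (by simp))
    | succ j ih =>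
      intro hj S hS h
      rw [pow_succ'] at hj h
      have hj1 : (1 : ℝ) ≤ 6 ^ j := one_le_pow₀ (by norm_num)
      rw [pow_succ, mul_assoc]
      refine ih (by linarith) _ (mul_nonneg hθ.le hS) fun q hq => ?_
      exact hc x _ _ φ hφ w ⟨hw, hwR⟩ (6 ^ j) (by positivity) (by push_cast; linarith)
        (by push_cast; linarith) S hS (by exact_mod_cast h) q (by exact_mod_cast hq)
  refine hpow _ R hR fun j hj => ?_
  simpa only [mul_one] using
    hdecay j hj 1 zero_le_one fun q _ => sub_le_self _ (hφ.nonneg q)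

lemma IsCapacitor.le_of_mem_closedNhd (hp : G.ControlledWeightsWith p) (hst : s + 1 ≤ t)
    (hφ : G.IsCapacitor x s t φ) (hw : w ∈ G.closedNhd (G.ball x s)) : p ≤ φ w := by
  have hwt : w ∈ G.ball x t := mem_ball.2 ((dist_lt_of_mem_closedNhd_ball hw).trans_le hst)
  rcases hw with hw | ⟨a, ha, hadj⟩
  · exact (hφ.eq_one w hw).symm ▸ hp.le_one
  · have hle := hp.mul_le_of_superharmonic (fun z _ => hφ.nonneg z)
      (hφ.superharmonicOn hp.locallyFinite w hwt) hadj.symm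
    rwa [hφ.eq_one a ha, mul_one] at hle

lemma IsCapacitor.exists_exp_neg_le (hp : G.ControlledWeights) (hH : G.EllipticHarnack) :
    ∃ K β : ℝ, 0 < K ∧ 0 < β ∧ ∀ (x : Γ) (R : ℝ), 1 ≤ R → ∀ φ, G.IsCapacitor x (2 * R) (4 * R) φ →
      ∀ w ∈ G.closedNhd (G.ball x (2 * R)), Real.exp (-(K * R ^ (-β))) ≤ φ w := by
  obtain ⟨p, hpp⟩ := hp.exists_controlledWeightsWith
  obtain ⟨C, β, hC, hβ, h⟩ := IsCapacitor.exists_one_sub_le_mul_rpow hp hH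
  refine ⟨C / p, β, div_pos hC hpp.1, hβ, fun x R hR φ hφ w hw => ?_⟩
  exact exp_neg_mul_le_of_one_sub_le hpp.1 (hφ.le_of_mem_closedNhd hpp (by linarith) hw)
    (by positivity) (h x R hR φ hφ w hw)

lemma LocallyFinite.inv_cap_add_inv_le_of_isCapacitor (hf : G.LocallyFinite) {r m : ℝ}
    (hr : 0 < r) (hrs : r ≤ s) (hst : s ≤ t) (hφ : G.IsCapacitor x s t φ) (hm : 0 < m)
    (h : ∀ y ∈ G.closedNhd (G.ball x s), m ≤ φ y) :
    (G.cap x r s)⁻¹ + m ^ 2 * (G.cap x s t)⁻¹ ≤ (G.cap x r t)⁻¹ := by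
  obtain ⟨f₁, h₁⟩ := hf.exists_isCapacitor x hrs
  obtain ⟨W, hW⟩ := hf.exists_closedNhd_subset (hf.ball_finite x t)
  have hWs := (closedNhd_mono (G.ball_subset_ball x hst)).trans hW
  let v : Γ → ℝ := fun y => min (φ y) m
  let f₂ : Γ → ℝ := m⁻¹ • v
  have hf₂one : ∀ y ∈ G.closedNhd (G.ball x s), f₂ y = 1 := fun y hy => by
    simp only [f₂, v, Pi.smul_apply, smul_eq_mul, min_eq_right (h y hy), inv_mul_cancel₀ hm.ne']
  have hf₂zero : ∀ y ∉ G.ball x t, f₂ y = 0 := fun y hy => by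
    simp only [f₂, v, Pi.smul_apply, smul_eq_mul, hφ.eq_zero y hy, min_eq_left hm.le, mul_zero]
  set E₁ := G.cap x r s
  set E₂ := (m ^ 2)⁻¹ * G.cap x s t with hE₂
  have hE₁0 : 0 < E₁ := hf.cap_pos x hr hrs
  have hE₂0 : 0 < E₂ := mul_pos (by positivity) (hf.cap_pos x (hr.trans_le hrs) hst)
  have hE₁f : G.dirichletForm W f₁ f₁ = E₁ := h₁.dirichletForm_eq hWs
  have hE₂f : G.dirichletForm W f₂ f₂ ≤ E₂ := by
    have hv : G.dirichletForm W v v ≤ G.cap x s t := by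
      rw [← hφ.dirichletForm_eq hW]
      exact G.dirichletForm_min_const_self_le W φ m
    calc G.dirichletForm W f₂ f₂ = (m ^ 2)⁻¹ * G.dirichletForm W v v := by
          simp only [f₂, map_smul, LinearMap.smul_apply, smul_eq_mul]; ring
      _ ≤ E₂ := mul_le_mul_of_nonneg_left hv (by positivity)
  have hcross : G.dirichletForm W f₁ f₂ = 0 :=
    G.dirichletForm_eq_zero_of_eqOn_closedNhd W h₁.eq_zero hf₂one
  -- The weight `a` minimizes `a² E₁ + (1 - a)² E₂`, with minimum `(E₁⁻¹ + E₂⁻¹)⁻¹`.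
  set a := E₂ / (E₁ + E₂) with ha
  have hcap : G.cap x r t ≤ a ^ 2 * E₁ + (1 - a) ^ 2 * E₂ := by
    refine (hf.cap_le_dirichletForm hW (f := a • f₁ + (1 - a) • f₂) (fun y hy => ?_)
      fun y hy => ?_).trans ?_
    · have hys := G.subset_closedNhd _ (G.ball_subset_ball x hrs hy)
      simp [h₁.eq_one y hy, hf₂one y hys]
    · have hys : y ∉ G.ball x s := fun hy' => hy (G.ball_subset_ball x hst hy')
      simp [h₁.eq_zero y hys, hf₂zero y hy]
    · simp only [map_add, map_smul, LinearMap.add_apply, LinearMap.smul_apply, smul_eq_mul,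
        G.dirichletForm_comm W f₂ f₁, hcross, hE₁f]
      nlinarith [mul_le_mul_of_nonneg_left hE₂f (sq_nonneg (1 - a))]
  have hval : a ^ 2 * E₁ + (1 - a) ^ 2 * E₂ = (E₁⁻¹ + E₂⁻¹)⁻¹ := by
    rw [ha]; field_simp; ring
  have hE₂inv : m ^ 2 * (G.cap x s t)⁻¹ = E₂⁻¹ := by rw [hE₂, mul_inv, inv_inv]
  rw [hE₂inv]
  exact (le_inv_comm₀ (by positivity) (hf.cap_pos x hr (hrs.trans hst))).2 (hval ▸ hcap)

lemma exists_inv_cap_add_exp_mul_inv_cap_le (hp : G.ControlledWeights)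
    (hH : G.EllipticHarnack) :
    ∃ K β : ℝ, 0 < K ∧ 0 < β ∧ ∀ (x : Γ) (R : ℝ), 1 ≤ R →
      (G.cap x R (2 * R))⁻¹ + Real.exp (-(K * R ^ (-β))) * (G.cap x (2 * R) (4 * R))⁻¹ ≤
        (G.cap x R (4 * R))⁻¹ := by
  have hf := hp.locallyFinite
  obtain ⟨K, β, hK, hβ, h⟩ := IsCapacitor.exists_exp_neg_le hp hH
  refine ⟨2 * K, β, by positivity, hβ, fun x R hR => ?_⟩
  obtain ⟨φ, hφ⟩ := hf.exists_isCapacitor x (show 2 * R ≤ 4 * R by linarith)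
  have hsq : Real.exp (-(2 * K * R ^ (-β))) = Real.exp (-(K * R ^ (-β))) ^ 2 := by
    rw [← Real.exp_nat_mul]; congr 1; push_cast; ring
  rw [hsq]
  exact hf.inv_cap_add_inv_le_of_isCapacitor (by linarith) (by linarith) (by linarith) hφ
    (Real.exp_pos _) (h x R hR φ hφ)

end Infinite

/-! ### Growth of capacities along dyadic scales -/

lemma le_of_forall_le_two_mul {T : ℝ → ℝ} {q : ℝ} (hstep : ∀ R, 1 ≤ R → T R ≤ T (2 * R))
    (hbase : ∀ R, 1 ≤ R → R ≤ 2 → q ≤ T R) {R : ℝ} (hR : 1 ≤ R) : q ≤ T R := by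
  obtain ⟨k, hkR, hRk⟩ := exists_nat_pow_near hR one_lt_two
  have hiter : ∀ (k : ℕ) (R : ℝ), 1 ≤ R → R ≤ 2 → q ≤ T (2 ^ k * R) := by
    intro k R hR hR2
    induction k with
    | zero => simpa using hbase R hR hR2
    | succ k ih =>
      rw [pow_succ', mul_assoc]
      exact ih.trans (hstep _ (one_le_mul_of_one_le_of_one_le (one_le_pow₀ one_le_two) hR))
  have h2k : (0 : ℝ) < 2 ^ k := by positivity
  rw [← mul_div_cancel₀ R h2k.ne']
  refine hiter k _ ((one_le_div₀ h2k).2 hkR) ((div_le_iff₀ h2k).2 ?_)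
  rw [← pow_succ']
  exact hRk.le

-- With `γ = log₂ A` and `L = K / (1 - 2^(-β))`, the recursion says that
-- `R ↦ Q R * (R ^ γ * exp (-L * R ^ (-β)))` does not decrease under doubling `R`.
lemma exists_mul_rpow_le_of_le_two_mul {A K β : ℝ} (hA : 0 < A) (hK : 0 ≤ K) (hβ : 0 < β) :
    ∃ c : ℝ, 0 < c ∧ ∀ (Q : ℝ → ℝ) (q : ℝ), 0 ≤ q →
      (∀ R, 1 ≤ R → Q R ≤ A * Real.exp (K * R ^ (-β)) * Q (2 * R)) →
      (∀ R, 1 ≤ R → R ≤ 2 → q ≤ Q R) →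
      ∀ R, 1 ≤ R → c * q * R ^ (-Real.logb 2 A) ≤ Q R := by
  set γ := Real.logb 2 A
  have hb1 : (2 : ℝ) ^ (-β) < 1 := Real.rpow_lt_one_of_one_lt_of_neg one_lt_two (neg_lt_zero.2 hβ)
  set L := K / (1 - 2 ^ (-β)) with hL
  have hL0 : 0 ≤ L := div_nonneg hK (by linarith)
  have hKL : K = L - L * 2 ^ (-β) := by rw [hL, ← mul_one_sub, div_mul_cancel₀ _ (by linarith)]
  have h2γ : (2 : ℝ) ^ γ = A := Real.rpow_logb two_pos (by norm_num) hA
  let F : ℝ → ℝ := fun R => R ^ γ * Real.exp (-(L * R ^ (-β)))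
  have hFdouble : ∀ R, 1 ≤ R → F (2 * R) = A * Real.exp (K * R ^ (-β)) * F R := fun R hR => by
    have hexp : Real.exp (-(L * (2 ^ (-β) * R ^ (-β)))) =
        Real.exp (K * R ^ (-β)) * Real.exp (-(L * R ^ (-β))) := by
      rw [← Real.exp_add, hKL]; congr 1; ring
    have hR0 : 0 ≤ R := zero_le_one.trans hR
    simp only [F]
    rw [Real.mul_rpow two_pos.le hR0, Real.mul_rpow two_pos.le hR0, h2γ, hexp]
    ring
  have hFlow : ∀ R, 1 ≤ R → R ≤ 2 → 2 ^ (-|γ|) * Real.exp (-L) ≤ F R := fun R hR hR2 => by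
    have hR0 : 0 < R := zero_lt_one.trans_le hR
    have hRβ : R ^ (-β) ≤ 1 := Real.rpow_le_one_of_one_le_of_nonpos hR (neg_nonpos.2 hβ.le)
    have hRγ : (2 : ℝ) ^ (-|γ|) ≤ R ^ γ := calc
      (2 : ℝ) ^ (-|γ|) ≤ R ^ (-|γ|) :=
        Real.rpow_le_rpow_of_nonpos hR0 hR2 (neg_nonpos.2 (abs_nonneg γ))
      _ ≤ R ^ γ := Real.rpow_le_rpow_of_exponent_le hR (neg_abs_le γ)
    exact mul_le_mul hRγ (Real.exp_le_exp.2 (neg_le_neg (mul_le_of_le_one_right hL0 hRβ)))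
      (Real.exp_pos _).le (by positivity)
  refine ⟨2 ^ (-|γ|) * Real.exp (-L), by positivity, fun Q q hq hstep hbase R hR => ?_⟩
  have hF0 : 0 < F R := by positivity
  have hT : 2 ^ (-|γ|) * Real.exp (-L) * q ≤ F R * Q R := by
    refine le_of_forall_le_two_mul (T := fun R => F R * Q R) (fun R hR => ?_)
      (fun R hR hR2 => ?_) hR
    · calc F R * Q R ≤ F R * (A * Real.exp (K * R ^ (-β)) * Q (2 * R)) :=
            mul_le_mul_of_nonneg_left (hstep R hR) (by positivity)
        _ = F (2 * R) * Q (2 * R) := by rw [hFdouble R hR]; ring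
    · exact mul_le_mul (hFlow R hR hR2) (hbase R hR hR2) hq (by positivity)
  have hQ0 : 0 ≤ Q R := nonneg_of_mul_nonneg_right (hT.trans' (by positivity)) hF0
  rw [Real.rpow_neg (zero_le_one.trans hR), ← div_eq_mul_inv, div_le_iff₀' (by positivity)]
  refine hT.trans (mul_le_mul_of_nonneg_right (mul_le_of_le_one_right (by positivity) ?_) hQ0)
  exact Real.exp_le_one_iff.2 (neg_nonpos.2 (by positivity))

lemma add_one_sub_exp_neg_le {A : ℝ} (hA : 0 < A) (s : ℝ) :
    A + 1 - Real.exp (-s) ≤ A * Real.exp (s / A) := by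
  have hmul := mul_le_mul_of_nonneg_left (Real.add_one_le_exp (s / A)) hA.le
  rw [mul_add, mul_div_cancel₀ s hA.ne'] at hmul
  linarith [Real.one_sub_le_exp_neg s]

section Infinite

variable [Infinite Γ] {C₁ C₂ : ℝ}

lemma OuterResistanceBound.exists_inv_cap_le (hp : G.ControlledWeights) (hH : G.EllipticHarnack)
    (hC₂ : 1 < C₂) (hout : G.OuterResistanceBound C₂) :
    ∃ K β : ℝ, 0 < K ∧ 0 < β ∧ ∀ (x : Γ) (R : ℝ), 1 ≤ R → (G.cap x R (2 * R))⁻¹ ≤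
      (C₂ - 1) * Real.exp (K * R ^ (-β)) * (G.cap x (2 * R) (4 * R))⁻¹ := by
  have hf := hp.locallyFinite
  rw [hf.outerResistanceBound_iff (by linarith)] at hout
  obtain ⟨K, β, hK, hβ, hser⟩ := exists_inv_cap_add_exp_mul_inv_cap_le hp hH
  have hA : 0 < C₂ - 1 := sub_pos.2 hC₂
  refine ⟨K / (C₂ - 1), β, div_pos hK hA, hβ, fun x R hR => ?_⟩
  have hc2 : 0 < G.cap x (2 * R) (4 * R) := hf.cap_pos x (by linarith) (by linarith)
  have hc3 : 0 < G.cap x R (4 * R) := hf.cap_pos x (by linarith) (by linarith)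
  have hinv : (G.cap x R (4 * R))⁻¹ ≤ C₂ * (G.cap x (2 * R) (4 * R))⁻¹ := by
    rw [← div_eq_mul_inv, le_div_iff₀ hc2, inv_mul_le_iff₀ hc3]
    linarith [hout x R (by linarith)]
  have hexp := mul_le_mul_of_nonneg_right (add_one_sub_exp_neg_le hA (K * R ^ (-β)))
    (inv_pos.2 hc2).le
  rw [div_mul_eq_mul_div]
  linarith [hser x R hR]

lemma InnerResistanceBound.exists_cap_le (hp : G.ControlledWeights) (hH : G.EllipticHarnack)
    (hC₁ : 1 < C₁) (hin : G.InnerResistanceBound C₁) :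
    ∃ K β : ℝ, 0 < K ∧ 0 < β ∧ ∀ (x : Γ) (R : ℝ), 1 ≤ R → G.cap x R (2 * R) ≤
      (C₁ - 1) * Real.exp (K * R ^ (-β)) * G.cap x (2 * R) (4 * R) := by
  have hf := hp.locallyFinite
  rw [hf.innerResistanceBound_iff (by linarith)] at hin
  obtain ⟨K, β, hK, hβ, hser⟩ := exists_inv_cap_add_exp_mul_inv_cap_le hp hH
  refine ⟨K, β, hK, hβ, fun x R hR => ?_⟩
  have hc1 : 0 < G.cap x R (2 * R) := hf.cap_pos x (by linarith) (by linarith)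
  have hc2 : 0 < G.cap x (2 * R) (4 * R) := hf.cap_pos x (by linarith) (by linarith)
  have hc3 : 0 < G.cap x R (4 * R) := hf.cap_pos x (by linarith) (by linarith)
  have hinv : (G.cap x R (4 * R))⁻¹ ≤ C₁ * (G.cap x R (2 * R))⁻¹ := by
    rw [← div_eq_mul_inv, le_div_iff₀ hc1, inv_mul_le_iff₀ hc3]
    linarith [hin x R (by linarith)]
  have hexp : Real.exp (-(K * R ^ (-β))) * (G.cap x (2 * R) (4 * R))⁻¹ ≤
      (C₁ - 1) * (G.cap x R (2 * R))⁻¹ := by linarith [hser x R hR]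
  rw [Real.exp_neg, ← mul_inv, ← div_eq_mul_inv, le_div_iff₀ hc1,
    inv_mul_le_iff₀ (by positivity)] at hexp
  linarith

end Infinite

/-! ### Capacities at bounded scales -/

lemma exists_sub_le_card_mul_sub {n : ℕ} (hn : 0 < n) (a : ℕ → ℝ) :
    ∃ i < n, a 0 - a n ≤ n * (a i - a (i + 1)) := by
  obtain ⟨i, hi, hle⟩ := Finset.exists_le_of_sum_le (s := Finset.range n)
    (f := fun _ => a 0 - a n) (g := fun i => n * (a i - a (i + 1)))
    (Finset.nonempty_range_iff.2 hn.ne') (by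
      rw [← Finset.mul_sum, Finset.sum_range_sub' a, Finset.sum_const, Finset.card_range,
        nsmul_eq_mul])
  exact ⟨i, Finset.mem_range.1 hi, hle⟩

lemma weight_mul_sq_le_dirichletForm (G : WeightedGraph Γ) {W : Finset Γ} {x y : Γ} (hx : x ∈ W)
    (hy : y ∈ W) (f : Γ → ℝ) : G.weight x y * (f x - f y) ^ 2 ≤ 2 * G.dirichletForm W f f := by
  have hterm : ∀ a b, 0 ≤ G.weight a b * ((f a - f b) * (f a - f b)) := fun a b =>
    mul_nonneg (G.weight_nonneg a b) (mul_self_nonneg _)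
  rw [dirichletForm_apply, sq, ← mul_assoc (2 : ℝ), mul_one_div_cancel two_ne_zero, one_mul]
  exact (Finset.single_le_sum (fun b _ => hterm x b) hy).trans
    (Finset.single_le_sum (f := fun a => ∑ b ∈ W, G.weight a b * ((f a - f b) * (f a - f b)))
      (fun a _ => Finset.sum_nonneg fun b _ => hterm a b) hx)

lemma ControlledWeightsWith.pow_length_mul_mu_le (hp : G.ControlledWeightsWith p) {x y : Γ}
    (w : G.graph.Walk x y) : p ^ w.length * G.mu x ≤ G.mu y := by
  induction w with
  | nil => simp
  | cons h w ih =>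
    rw [SimpleGraph.Walk.length_cons, pow_succ, mul_assoc]
    exact (mul_le_mul_of_nonneg_left (hp.mul_mu_le_mu_of_adj h) (pow_nonneg hp.1.le _)).trans ih

lemma ControlledWeightsWith.pow_mul_mu_mul_sq_le [Nontrivial Γ] (hp : G.ControlledWeightsWith p)
    {W : Finset Γ} {x y : Γ} (w : G.graph.Walk x y) (hw : 0 < w.length)
    (hW : ∀ z ∈ w.support, z ∈ W) {f : Γ → ℝ} (hxy : f y ≤ f x) :
    p ^ w.length * G.mu x * (f x - f y) ^ 2 ≤ 2 * w.length ^ 2 * G.dirichletForm W f f := by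
  obtain ⟨i, hi, hdiff⟩ := exists_sub_le_card_mul_sub hw fun i => f (w.getVert i)
  simp only [SimpleGraph.Walk.getVert_zero, SimpleGraph.Walk.getVert_length] at hdiff
  set a := w.getVert i
  set b := w.getVert (i + 1)
  have hweight : p ^ w.length * G.mu x ≤ G.weight a b := by
    have hmu := hp.pow_length_mul_mu_le (w.take i)
    rw [SimpleGraph.Walk.take_length, min_eq_left hi.le] at hmu
    calc p ^ w.length * G.mu x ≤ p ^ (i + 1) * G.mu x :=
          mul_le_mul_of_nonneg_right (pow_le_pow_of_le_one hp.1.le hp.le_one hi) (G.mu_pos x).le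
      _ = p * (p ^ i * G.mu x) := by ring
      _ ≤ p * G.mu a := mul_le_mul_of_nonneg_left hmu hp.1.le
      _ ≤ G.weight a b := hp.2 a b (w.adj_getVert_succ hi)
  calc p ^ w.length * G.mu x * (f x - f y) ^ 2
      ≤ G.weight a b * (w.length * (f a - f b)) ^ 2 :=
        mul_le_mul hweight (pow_le_pow_left₀ (sub_nonneg.2 hxy) hdiff 2) (sq_nonneg _)
          (G.weight_nonneg a b)
    _ = w.length ^ 2 * (G.weight a b * (f a - f b) ^ 2) := by ring
    _ ≤ w.length ^ 2 * (2 * G.dirichletForm W f f) :=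
        mul_le_mul_of_nonneg_left (G.weight_mul_sq_le_dirichletForm
          (hW _ (w.getVert_mem_support i)) (hW _ (w.getVert_mem_support (i + 1))) f) (sq_nonneg _)
    _ = 2 * w.length ^ 2 * G.dirichletForm W f f := by ring

section Infinite

variable [Infinite Γ]

lemma ControlledWeightsWith.cap_le_mul_mu (hp : G.ControlledWeightsWith p) (x : Γ) {r R : ℝ}
    {N : ℕ} (hr : 0 < r) (hrR : r ≤ R) (hrN : r ≤ N) :
    G.cap x r R ≤ (p ^ N)⁻¹ * G.mu x := by
  have hf := hp.locallyFinite
  have hD := hf.ball_finite x R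
  obtain ⟨g, hg⟩ := hf.exists_isGreen hD (G.mem_ball_self x (hr.trans_le hrR))
  have hmu := G.mu_pos x
  have hpN : 0 < p ^ N := pow_pos hp.1 N
  have hlow : ∀ y ∈ G.ball x r, p ^ N * (G.mu x)⁻¹ ≤ g y := fun y hy => by
    have hyN : G.graph.dist x y ≤ N := by exact_mod_cast (mem_ball.1 hy).le.trans hrN
    calc p ^ N * (G.mu x)⁻¹ ≤ p ^ G.graph.dist x y * g x :=
          mul_le_mul (pow_le_pow_of_le_one hp.1.le hp.le_one hyN) (hg.inv_mu_le hf hD)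
            (by positivity) (pow_nonneg hp.1.le _)
      _ ≤ g y := hp.pow_dist_mul_le (hg.nonneg hf hD) hg.superharmonicOn
          (G.ball_subset_ball x hrR hy)
  have hcap := hg.mul_cap_le_one hf hr (by positivity) hlow
  rwa [mul_assoc, inv_mul_eq_div, ← le_div_iff₀' hpN, div_le_iff₀ hmu, one_div] at hcap

lemma ControlledWeightsWith.mul_mu_le_cap (hp : G.ControlledWeightsWith p) (x : Γ) {r R : ℝ}
    {N : ℕ} (hr : 0 < r) (hrR : r ≤ R) (hRN : R ≤ N) :
    p ^ N / (2 * N ^ 2) * G.mu x ≤ G.cap x r R := by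
  have hf := hp.locallyFinite
  have hN : (0 : ℝ) < N := (hr.trans_le hrR).trans_le hRN
  obtain ⟨φ, hφ⟩ := hf.exists_isCapacitor x hrR
  obtain ⟨y, hy⟩ := hf.exists_dist_eq x N
  obtain ⟨w, hw⟩ := G.connected.exists_walk_length_eq_dist x y
  rw [hy] at hw
  obtain ⟨W, hW⟩ := hf.exists_closedNhd_subset
    ((hf.ball_finite x R).union w.support.finite_toSet)
  have hsub := (G.subset_closedNhd _).trans hW
  have hφx : φ x = 1 := hφ.eq_one x (G.mem_ball_self x hr)
  have hφy : φ y = 0 := hφ.eq_zero y fun h => by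
    rw [mem_ball, hy] at h; linarith
  have hle := hp.pow_mul_mu_mul_sq_le w (by rw [hw]; exact_mod_cast hN)
    (fun z hz => hsub (Or.inr hz)) (f := φ) (by rw [hφx, hφy]; exact zero_le_one)
  rw [hφ.dirichletForm_eq ((closedNhd_mono Set.subset_union_left).trans hW), hφx, hφy, hw,
    sub_zero, one_pow, mul_one] at hle
  rwa [div_mul_eq_mul_div, div_le_iff₀' (by positivity)]

end Infinite

section Infinite

variable [Infinite Γ] {C₁ C₂ : ℝ}

lemma OuterResistanceBound.exists_cap_le_mul_rpow (hp : G.ControlledWeights)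
    (hH : G.EllipticHarnack) (hC₂ : 1 < C₂) (hout : G.OuterResistanceBound C₂) :
    ∃ C : ℝ, 0 < C ∧ ∀ (x : Γ) (R : ℝ), 1 ≤ R →
      G.cap x R (2 * R) ≤ C * G.mu x * R ^ Real.logb 2 (C₂ - 1) := by
  have hf := hp.locallyFinite
  obtain ⟨p, hpp⟩ := hp.exists_controlledWeightsWith
  obtain ⟨K, β, hK, hβ, hstep⟩ := hout.exists_inv_cap_le hp hH hC₂
  obtain ⟨c, hc, hiter⟩ := exists_mul_rpow_le_of_le_two_mul (sub_pos.2 hC₂) hK.le hβ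
  have hp0 : 0 < p := hpp.1
  refine ⟨(c * p ^ 2)⁻¹, by positivity, fun x R hR => ?_⟩
  have hmu := G.mu_pos x
  have hR0 : 0 < R := zero_lt_one.trans_le hR
  have hcap : ∀ {R : ℝ}, 1 ≤ R → 0 < G.cap x R (2 * R) := fun hR =>
    hf.cap_pos x (by linarith) (by linarith)
  have hbase : ∀ R, 1 ≤ R → R ≤ 2 → p ^ 2 * (G.mu x)⁻¹ ≤ (G.cap x R (2 * R))⁻¹ :=
    fun R hR hR2 => by
      have hle := hpp.cap_le_mul_mu x (N := 2) (show 0 < R by linarith)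
        (show R ≤ 2 * R by linarith) (by exact_mod_cast hR2)
      simpa only [mul_inv, inv_inv] using inv_anti₀ (hcap hR) hle
  have hle := hiter (fun R => (G.cap x R (2 * R))⁻¹) _ (by positivity)
    (fun R hR => by rw [← mul_assoc 2 2 R, show (2 : ℝ) * 2 = 4 by norm_num]; exact hstep x R hR)
    hbase R hR
  rw [le_inv_comm₀ (by positivity) (hcap hR), Real.rpow_neg hR0.le] at hle
  refine hle.trans_eq ?_
  simp only [mul_inv, inv_inv]
  ring

lemma InnerResistanceBound.exists_mul_rpow_le_cap (hp : G.ControlledWeights)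
    (hH : G.EllipticHarnack) (hC₁ : 1 < C₁) (hin : G.InnerResistanceBound C₁) :
    ∃ c : ℝ, 0 < c ∧ ∀ (x : Γ) (R : ℝ), 1 ≤ R →
      c * G.mu x * R ^ (-Real.logb 2 (C₁ - 1)) ≤ G.cap x R (2 * R) := by
  obtain ⟨p, hpp⟩ := hp.exists_controlledWeightsWith
  obtain ⟨K, β, hK, hβ, hstep⟩ := hin.exists_cap_le hp hH hC₁
  obtain ⟨c, hc, hiter⟩ := exists_mul_rpow_le_of_le_two_mul (sub_pos.2 hC₁) hK.le hβ
  have hp0 : 0 < p := hpp.1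
  refine ⟨c * (p ^ 4 / (2 * 4 ^ 2)), by positivity, fun x R hR => ?_⟩
  have hmu := G.mu_pos x
  rw [mul_assoc c]
  refine hiter (fun R => G.cap x R (2 * R)) _ (by positivity) (fun R hR => ?_)
    (fun R hR hR2 => ?_) R hR
  · rw [← mul_assoc 2 2 R, show (2 : ℝ) * 2 = 4 by norm_num]
    exact hstep x R hR
  · exact_mod_cast hpp.mul_mu_le_cap x (N := 4) (by linarith) (by linarith)
      (by push_cast; linarith)

end Infinite

/-! ### Exit times and volumes -/

section Infinite

variable [Infinite Γ]

lemma IsGreen.exists_inv_cap_le (hp : G.ControlledWeights) (hH : G.EllipticHarnack) :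
    ∃ c : ℝ, 0 < c ∧ ∀ (x : Γ) (R : ℝ), 0 < R → ∀ g, G.IsGreen (G.ball x (2 * R)) x g →
      ∀ y ∈ G.ball x R, c * (G.cap x R (2 * R))⁻¹ ≤ g y := by
  have hf := hp.locallyFinite
  obtain ⟨C, hC1, hC⟩ := IsGreen.exists_le_mul_of_dist_eq_of_dist_le hp hH
  have hC0 : 0 < C := zero_lt_one.trans_le hC1
  refine ⟨C⁻¹, by positivity, fun x R hR g hg y hy => ?_⟩
  have hD := hf.ball_finite x (2 * R)
  obtain ⟨n, hnR, hRn⟩ := exists_nat_lt_le_add_one hR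
  obtain ⟨z, hz, hmax⟩ := hf.exists_forall_dist_eq_le x n g
  have hyn : G.graph.dist x y ≤ n := by
    have : (G.graph.dist x y : ℝ) < n + 1 := (mem_ball.1 hy).trans_le hRn
    exact Nat.lt_succ_iff.1 (by exact_mod_cast this)
  have hle : g z ≤ C * g y :=
    hC _ hD x n (G.ball_subset_ball x (by linarith)) g hg z y hz hyn
  have hone := hg.one_le_mul_cap hf hnR (by linarith) (hg.nonneg hf hD z) hmax
  rw [inv_mul_le_iff₀ hC0, inv_le_iff_one_le_mul₀ (hf.cap_pos x hR (by linarith))]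
  exact hone.trans (mul_le_mul_of_nonneg_right hle (hf.cap_pos x hR (by linarith)).le)

lemma LocallyFinite.cap_anti (hf : G.LocallyFinite) (x : Γ) {r R R' : ℝ} (hrR : r ≤ R)
    (hR : R ≤ R') : G.cap x r R' ≤ G.cap x r R := by
  obtain ⟨φ, hφ⟩ := hf.exists_isCapacitor x hrR
  obtain ⟨W, hW⟩ := hf.exists_closedNhd_subset (hf.ball_finite x R')
  have hsub := G.ball_subset_ball x hR
  rw [← hφ.dirichletForm_eq ((closedNhd_mono hsub).trans hW)]
  exact hf.cap_le_dirichletForm hW hφ.eq_one fun a ha => hφ.eq_zero a fun h => ha (hsub h)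

end Infinite

lemma dirichletForm_self_le_sq_mul_sum_mu (G : WeightedGraph Γ) (W D : Finset Γ) {f : Γ → ℝ}
    {L : ℝ} (h0 : ∀ x ∉ D, f x = 0) (hL : ∀ x y, G.graph.Adj x y → |f x - f y| ≤ L) :
    G.dirichletForm W f f ≤ L ^ 2 * ∑ x ∈ D, G.mu x := by
  classical
  let χ : Γ → ℝ := (D : Set Γ).indicator 1
  have hχ : ∀ x, 0 ≤ χ x := Set.indicator_nonneg fun _ _ => zero_le_one
  have hedge : ∀ x y, G.weight x y * ((f x - f y) * (f x - f y)) ≤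
      L ^ 2 * (G.weight x y * χ x + G.weight y x * χ y) := fun x y => by
    rw [G.weight_symm y x, ← mul_add, mul_left_comm (L ^ 2)]
    by_cases hxy : G.graph.Adj x y
    · refine mul_le_mul_of_nonneg_left ?_ (G.weight_nonneg x y)
      by_cases hout : x ∉ D ∧ y ∉ D
      · rw [h0 x hout.1, h0 y hout.2, sub_zero, mul_zero]
        exact mul_nonneg (sq_nonneg L) (add_nonneg (hχ x) (hχ y))
      · have hone : 1 ≤ χ x + χ y := by
          rw [not_and_or, not_not, not_not] at hout
          rcases hout with hx | hy
          · simpa [χ, hx] using hχ y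
          · simpa [χ, hy] using hχ x
        rw [← sq, ← sq_abs]
        exact (pow_le_pow_left₀ (abs_nonneg _) (hL x y hxy) 2).trans
          (le_mul_of_one_le_right (sq_nonneg L) hone)
    · simp only [G.weight_eq_zero x y hxy, zero_mul, le_refl]
  have hmass : ∑ x ∈ W, ∑ y ∈ W, G.weight x y * χ x ≤ ∑ x ∈ D, G.mu x := by
    calc ∑ x ∈ W, ∑ y ∈ W, G.weight x y * χ x ≤ ∑ x ∈ W, G.mu x * χ x := by
          refine Finset.sum_le_sum fun x _ => ?_
          rw [← Finset.sum_mul]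
          exact mul_le_mul_of_nonneg_right
            ((G.summable_weight x).sum_le_tsum W fun y _ => G.weight_nonneg x y) (hχ x)
      _ = ∑ x ∈ W with x ∈ D, G.mu x := by
          simp only [Finset.sum_filter, χ, Set.indicator_apply, Finset.mem_coe, Pi.one_apply,
            mul_ite, mul_one, mul_zero]
      _ ≤ ∑ x ∈ D, G.mu x :=
          Finset.sum_le_sum_of_subset_of_nonneg (fun x hx => (Finset.mem_filter.1 hx).2)
            fun x _ _ => tsum_nonneg (G.weight_nonneg x)
  calc G.dirichletForm W f f
      ≤ 1 / 2 * ∑ x ∈ W, ∑ y ∈ W, L ^ 2 * (G.weight x y * χ x + G.weight y x * χ y) := by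
        rw [dirichletForm_apply]
        exact mul_le_mul_of_nonneg_left (Finset.sum_le_sum fun x _ => Finset.sum_le_sum fun y _ =>
          hedge x y) one_half_pos.le
    _ = L ^ 2 * ∑ x ∈ W, ∑ y ∈ W, G.weight x y * χ x := by
        simp only [← Finset.mul_sum, Finset.sum_add_distrib]
        rw [Finset.sum_comm (f := fun x y => G.weight y x * χ y)]
        ring
    _ ≤ L ^ 2 * ∑ x ∈ D, G.mu x := mul_le_mul_of_nonneg_left hmass (sq_nonneg L)

lemma abs_max_min_sub_max_min_le (a b : ℝ) :
    |max 0 (min 1 a) - max 0 (min 1 b)| ≤ |a - b| := by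
  simpa using (abs_max_sub_max_le_max 0 (min 1 a) 0 (min 1 b)).trans
    (max_le_max_left _ (abs_min_sub_min_le_max 1 a 1 b))

lemma LocallyFinite.sq_mul_cap_le_vol [Nontrivial Γ] (hf : G.LocallyFinite) (x : Γ) {R : ℝ}
    (hR : 0 < R) : ENNReal.ofReal (R ^ 2 * G.cap x R (2 * R)) ≤ G.vol x (2 * R) := by
  have hD := hf.ball_finite x (2 * R)
  obtain ⟨W, hW⟩ := hf.exists_closedNhd_subset hD
  let f : Γ → ℝ := fun y => max 0 (min 1 ((2 * R - G.graph.dist x y) / R))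
  have h1 : ∀ y ∈ G.ball x R, f y = 1 := fun y hy => by
    have : 1 ≤ (2 * R - G.graph.dist x y) / R := by
      rw [one_le_div₀ hR]; linarith [mem_ball.1 hy]
    simp only [f, min_eq_left this, max_eq_right zero_le_one]
  have h0 : ∀ y ∉ G.ball x (2 * R), f y = 0 := fun y hy => by
    rw [mem_ball, not_lt] at hy
    exact max_eq_left ((min_le_right _ _).trans
      (div_nonpos_of_nonpos_of_nonneg (by linarith) hR.le))
  have hLip : ∀ y z, G.graph.Adj y z → |f y - f z| ≤ R⁻¹ := fun y z hyz => by
    refine (abs_max_min_sub_max_min_le _ _).trans ?_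
    have hyz' : (G.graph.dist x z : ℝ) ≤ G.graph.dist x y + 1 := by
      exact_mod_cast G.dist_le_dist_add_one x hyz
    have hzy' : (G.graph.dist x y : ℝ) ≤ G.graph.dist x z + 1 := by
      exact_mod_cast G.dist_le_dist_add_one x hyz.symm
    rw [← sub_div, abs_div, abs_of_pos hR, div_eq_mul_inv]
    refine mul_le_of_le_one_left (inv_pos.2 hR).le (abs_le.2 ⟨?_, ?_⟩) <;> linarith
  have hle := (hf.cap_le_dirichletForm hW h1 h0).trans
    (G.dirichletForm_self_le_sq_mul_sum_mu W hD.toFinset (by simpa using h0) hLip)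
  rw [inv_pow, le_inv_mul_iff₀ (by positivity)] at hle
  rw [hf.vol_eq]
  exact ENNReal.ofReal_le_ofReal hle

section ExitTime

variable [Countable Γ] [Infinite Γ] [MeasurableSpace Γ] [DiscreteMeasurableSpace Γ]

lemma exists_inv_cap_mul_vol_le_exitE (hp : G.ControlledWeights) (hH : G.EllipticHarnack) :
    ∃ c : ℝ, 0 < c ∧ ∀ (x : Γ) (R : ℝ), 0 < R →
      ENNReal.ofReal (c * (G.cap x R (2 * R))⁻¹) * G.vol x R ≤ G.exitE x (2 * R) := by
  have hf := hp.locallyFinite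
  obtain ⟨c, hc, h⟩ := IsGreen.exists_inv_cap_le hp hH
  refine ⟨c, hc, fun x R hR => ?_⟩
  obtain ⟨g, hg⟩ := hf.exists_isGreen (hf.ball_finite x (2 * R))
    (G.mem_ball_self x (by linarith))
  have hcap := hf.cap_pos x hR (show R ≤ 2 * R by linarith)
  exact hg.mul_vol_le_exitE hf (by linarith) (by positivity) (h x R hR g hg)

theorem exists_ofReal_mul_sq_le_exitE_and_exitE_lt_top (hp : G.ControlledWeights)
    (hH : G.EllipticHarnack) :
    ∃ c : ℝ, 0 < c ∧ ∀ (x : Γ) (R : ℝ), 0 < R →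
      ENNReal.ofReal (c * R ^ 2) ≤ G.exitE x R ∧ G.exitE x R < ∞ := by
  have hf := hp.locallyFinite
  obtain ⟨c, hc, hexit⟩ := exists_inv_cap_mul_vol_le_exitE hp hH
  obtain ⟨C, hC1, hC⟩ := exists_cap_le_mul_cap hp hH
  have hC0 : 0 < C := zero_lt_one.trans_le hC1
  refine ⟨c / (16 * C), by positivity, fun x R hR => ⟨?_, ?_⟩⟩
  · obtain ⟨s, rfl⟩ : ∃ s, R = 4 * s := ⟨R / 4, by ring⟩
    have hs : 0 < s := by linarith
    have hcap := hf.cap_pos x (show 0 < 2 * s by linarith) (show 2 * s ≤ 4 * s by linarith)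
    have hle : G.cap x (2 * s) (4 * s) ≤ C * G.cap x s (2 * s) :=
      (hC x s hs).trans (mul_le_mul_of_nonneg_left
        (hf.cap_anti x (by linarith) (by linarith)) hC0.le)
    set κ := G.cap x (2 * s) (4 * s)
    have hE := hexit x (2 * s) (by linarith)
    rw [← mul_assoc 2 2 s, show (2 : ℝ) * 2 = 4 by norm_num] at hE
    refine le_trans ?_ ((mul_le_mul_right (hf.sq_mul_cap_le_vol x hs) _).trans hE)
    rw [← ENNReal.ofReal_mul (by positivity)]
    refine ENNReal.ofReal_le_ofReal ?_
    calc c / (16 * C) * (4 * s) ^ 2 = c * κ⁻¹ * (s ^ 2 * (κ / C)) := by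
          field_simp
          norm_num
      _ ≤ c * κ⁻¹ * (s ^ 2 * G.cap x s (2 * s)) := by
          gcongr
          exact (div_le_iff₀' hC0).2 hle
  · obtain ⟨g, hg⟩ := hf.exists_isGreen (hf.ball_finite x R) (G.mem_ball_self x hR)
    rw [hg.exitE_eq hf]
    exact ENNReal.ofReal_lt_top

theorem OuterResistanceBound.exists_vol_le_mul_exitE_two_mul {C₂ : ℝ}
    (hp : G.ControlledWeights) (hH : G.EllipticHarnack) (hC₂ : 1 < C₂)
    (hout : G.OuterResistanceBound C₂) :
    ∃ C : ℝ, 0 < C ∧ ∀ (x : Γ) (R : ℝ), 1 ≤ R →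
      G.vol x R ≤ ENNReal.ofReal (C * G.mu x * R ^ Real.logb 2 (C₂ - 1)) * G.exitE x (2 * R) := by
  obtain ⟨C, hC, hcap⟩ := hout.exists_cap_le_mul_rpow hp hH hC₂
  obtain ⟨c, hc, hexit⟩ := exists_inv_cap_mul_vol_le_exitE hp hH
  refine ⟨C / c, by positivity, fun x R hR => ?_⟩
  have hmu := G.mu_pos x
  have hpos : 0 < G.cap x R (2 * R) :=
    hp.locallyFinite.cap_pos x (by linarith) (by linarith)
  refine le_trans ?_ (mul_le_mul_right (hexit x R (by linarith)) _)
  rw [← mul_assoc, ← ENNReal.ofReal_mul (by positivity)]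
  refine le_mul_of_one_le_left' (ENNReal.one_le_ofReal.2 ?_)
  calc 1 ≤ C * G.mu x * R ^ Real.logb 2 (C₂ - 1) / G.cap x R (2 * R) :=
        (one_le_div₀ hpos).2 (hcap x R hR)
    _ = C / c * G.mu x * R ^ Real.logb 2 (C₂ - 1) * (c * (G.cap x R (2 * R))⁻¹) := by
        field_simp

end ExitTime

theorem InnerResistanceBound.exists_le_vol_two_mul [Infinite Γ] {C₁ : ℝ}
    (hp : G.ControlledWeights) (hH : G.EllipticHarnack) (hC₁ : 1 < C₁)
    (hin : G.InnerResistanceBound C₁) :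
    ∃ c : ℝ, 0 < c ∧ ∀ (x : Γ) (R : ℝ), 1 ≤ R →
      ENNReal.ofReal (c * G.mu x * R ^ (2 - Real.logb 2 (C₁ - 1))) ≤ G.vol x (2 * R) := by
  obtain ⟨c, hc, hcap⟩ := hin.exists_mul_rpow_le_cap hp hH hC₁
  refine ⟨c, hc, fun x R hR => ?_⟩
  have hR0 : 0 < R := zero_lt_one.trans_le hR
  refine le_trans (ENNReal.ofReal_le_ofReal ?_) (hp.locallyFinite.sq_mul_cap_le_vol x hR0)
  calc c * G.mu x * R ^ (2 - Real.logb 2 (C₁ - 1))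
      = R ^ 2 * (c * G.mu x * R ^ (-Real.logb 2 (C₁ - 1))) := by
        rw [sub_eq_add_neg, Real.rpow_add hR0, Real.rpow_two]
        ring
    _ ≤ R ^ 2 * G.cap x R (2 * R) := mul_le_mul_of_nonneg_left (hcap x R hR) (sq_nonneg R)

/-! ### The Green function near the boundary of the ball -/

section Infinite

variable [Infinite Γ]

lemma IsGreen.exists_le_mul_of_dist_add_dist_eq (hp : G.ControlledWeights)
    (hH : G.EllipticHarnack) (N : ℕ) :
    ∃ C : ℝ, 1 ≤ C ∧ ∀ (x : Γ) (R : ℝ) (g : Γ → ℝ), G.IsGreen (G.ball x R) x g →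
      ∀ r : ℝ, 0 < r → ∀ y z : Γ, G.graph.dist x z + G.graph.dist z y = G.graph.dist x y →
        r ≤ G.graph.dist x z → G.graph.dist x y + r ≤ R → (G.graph.dist z y : ℝ) ≤ N * r →
        g z ≤ C * g y := by
  obtain ⟨C, hC1, hC⟩ := IsGreen.exists_le_mul_of_walk hp hH N
  refine ⟨C, hC1, fun x R g hg r hr y z hxzy hrz hyR hN => ?_⟩
  obtain ⟨w, hw⟩ := G.connected.exists_walk_length_eq_dist z y
  refine hC _ (hp.locallyFinite.ball_finite x R) x g hg r hr z y w (by rwa [hw]) fun v hv => ?_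
  have hzvy : (G.graph.dist z v : ℝ) + G.graph.dist v y = G.graph.dist z y := by
    exact_mod_cast G.dist_add_dist_of_mem_support hw hv
  have hxzy : (G.graph.dist x z : ℝ) + G.graph.dist z y = G.graph.dist x y := by
    exact_mod_cast hxzy
  have hxv := G.dist_triangle x z v
  have hxy := G.dist_triangle x v y
  have hzv := (G.graph.dist z v).cast_nonneg (α := ℝ)
  have hvy := (G.graph.dist v y).cast_nonneg (α := ℝ)
  exact ⟨by linarith only [hvy, hxzy, hzvy, hrz, hxy],
    ball_subset_ball_of_dist_add_le (by linarith only [hzv, hxzy, hzvy, hyR, hxv])⟩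

-- Each Harnack step multiplies the distance to the boundary by at least `3 / 2`.
lemma IsGreen.exists_le_pow_mul (hp : G.ControlledWeights) (hH : G.EllipticHarnack) :
    ∃ A : ℝ, 1 ≤ A ∧ ∀ (x : Γ) (R : ℝ), 8 ≤ R → ∀ g, G.IsGreen (G.ball x R) x g →
      ∀ m, (∀ y ∈ G.ball x (R / 2), m ≤ g y) → ∀ (j : ℕ) (y : Γ), 1 ≤ R - G.graph.dist x y →
        R / 2 < (R - G.graph.dist x y) * (3 / 2) ^ j → m ≤ A ^ j * g y := by
  obtain ⟨A, hA1, hA⟩ := IsGreen.exists_le_mul_of_dist_add_dist_eq hp hH 6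
  refine ⟨A, hA1, fun x R hR g hg m hm j => ?_⟩
  have hgnn := hg.nonneg hp.locallyFinite (hp.locallyFinite.ball_finite x R)
  induction j with
  | zero =>
    intro y _ hy
    rw [pow_zero, one_mul]
    exact hm y (mem_ball.2 (by linarith))
  | succ j ih =>
    intro y hy1 hyj
    by_cases hy : y ∈ G.ball x (R / 2)
    · exact (hm y hy).trans (le_mul_of_one_le_left (hgnn y) (one_le_pow₀ hA1))
    rw [mem_ball, not_lt] at hy
    obtain ⟨t, ht⟩ : ∃ t, R - G.graph.dist x y = t := ⟨_, rfl⟩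
    rw [ht] at hy1 hyj
    obtain ⟨n, hnt, htn⟩ := exists_nat_lt_le_add_one (show 0 < t / 2 + 1 by linarith)
    have hn : n ≤ G.graph.dist x y := by
      have : (n : ℝ) ≤ G.graph.dist x y := by linarith
      exact_mod_cast this
    obtain ⟨z, hxz, hzy⟩ := G.exists_dist_eq_of_le_dist (Nat.sub_le (G.graph.dist x y) n)
    have hxz' : (G.graph.dist x z : ℝ) = G.graph.dist x y - n := by rw [hxz, Nat.cast_sub hn]
    have hzyn : G.graph.dist z y = n := by omega
    have hstep : g z ≤ A * g y := hA x R g hg (t / 4) (by linarith) y z (by omega)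
      (by linarith) (by linarith) (by rw [hzyn]; push_cast; linarith)
    have hzj : R / 2 < (R - G.graph.dist x z) * (3 / 2) ^ j := calc
      R / 2 < t * (3 / 2) ^ (j + 1) := hyj
      _ = t * (3 / 2) * (3 / 2) ^ j := by ring
      _ ≤ _ := mul_le_mul_of_nonneg_right (by linarith) (by positivity)
    calc m ≤ A ^ j * g z := ih z (by linarith) hzj
      _ ≤ A ^ j * (A * g y) := mul_le_mul_of_nonneg_left hstep (by positivity)
      _ = A ^ (j + 1) * g y := by ring

lemma pow_le_rpow_logb {A b R : ℝ} (hA : 1 ≤ A) (hb : 1 < b) {J : ℕ} (hJ : b ^ J ≤ R) :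
    A ^ J ≤ R ^ Real.logb b A := calc
  A ^ J = (b ^ J) ^ Real.logb b A := by
    rw [← Real.rpow_natCast b, ← Real.rpow_mul (by positivity), mul_comm (J : ℝ),
      Real.rpow_mul (by positivity), Real.rpow_logb (by positivity) hb.ne' (by positivity),
      Real.rpow_natCast]
  _ ≤ R ^ Real.logb b A := Real.rpow_le_rpow (by positivity) hJ (Real.logb_nonneg hb hA)

lemma IsGreen.exists_mul_rpow_mul_le (hp : G.ControlledWeights) (hH : G.EllipticHarnack) :
    ∃ c γ : ℝ, 0 < c ∧ 0 ≤ γ ∧ ∀ (x : Γ) (R : ℝ), 8 ≤ R → ∀ g, G.IsGreen (G.ball x R) x g →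
      ∀ m, 0 ≤ m → (∀ y ∈ G.ball x (R / 2), m ≤ g y) →
        ∀ y ∈ G.ball x R, c * R ^ (-γ) * m ≤ g y := by
  obtain ⟨p, hpp⟩ := hp.exists_controlledWeightsWith
  obtain ⟨A, hA1, hA⟩ := IsGreen.exists_le_pow_mul hp hH
  have hp0 : 0 < p := hpp.1
  refine ⟨p, Real.logb (3 / 2) A, hp0, Real.logb_nonneg (by norm_num) hA1,
    fun x R hR g hg m hm hhalf y hy => ?_⟩
  have hf := hp.locallyFinite
  have hgnn := hg.nonneg hf (hf.ball_finite x R)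
  have hR0 : 0 < R := by linarith
  obtain ⟨J, hJR, hRJ⟩ := exists_nat_pow_near (show 1 ≤ R by linarith)
    (show (1 : ℝ) < 3 / 2 by norm_num)
  rw [pow_succ] at hRJ
  have hfar : ∀ z, 1 ≤ R - G.graph.dist x z → R ^ (-Real.logb (3 / 2) A) * m ≤ g z :=
    fun z hz => by
      have hRz : R / 2 < (R - G.graph.dist x z) * (3 / 2) ^ J := calc
        R / 2 < 1 * (3 / 2) ^ J := by linarith
        _ ≤ _ := mul_le_mul_of_nonneg_right hz (by positivity)
      rw [Real.rpow_neg hR0.le, inv_mul_le_iff₀ (by positivity)]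
      exact (hA x R hR g hg m hhalf J z hz hRz).trans (mul_le_mul_of_nonneg_right
        (pow_le_rpow_logb hA1 (by norm_num) hJR) (hgnn z))
  rw [mul_assoc]
  rcases le_or_gt 1 (R - G.graph.dist x y) with hy1 | hy1
  · exact (mul_le_of_le_one_left (by positivity) hpp.le_one).trans (hfar y hy1)
  · have hpos : 1 ≤ G.graph.dist x y := by
      have : (1 : ℝ) ≤ G.graph.dist x y := by linarith
      exact_mod_cast this
    obtain ⟨z, hxz, hzy⟩ := G.exists_dist_eq_of_le_dist (Nat.sub_le (G.graph.dist x y) 1)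
    have hadj : G.graph.Adj y z := (SimpleGraph.dist_eq_one_iff_adj.1 (by omega)).symm
    have hz : 1 ≤ R - G.graph.dist x z := by
      rw [hxz, Nat.cast_sub hpos]; push_cast; linarith [mem_ball.1 hy]
    exact (mul_le_mul_of_nonneg_left (hfar z hz) hp0.le).trans
      (hpp.mul_le_of_superharmonic (fun v _ => hgnn v) (hg.superharmonicOn y hy) hadj)

lemma exists_outerResistanceBound (hp : G.ControlledWeights) (hH : G.EllipticHarnack) :
    ∃ C : ℝ, 1 < C ∧ ∀ C', C ≤ C' → G.OuterResistanceBound C' := by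
  have hf := hp.locallyFinite
  obtain ⟨C, hC1, hC⟩ := exists_cap_le_mul_cap hp hH
  refine ⟨C + 1, by linarith, fun C' hCC' => ?_⟩
  rw [hf.outerResistanceBound_iff (by linarith)]
  exact fun x R hR => (hC x R hR).trans (mul_le_mul_of_nonneg_right (by linarith)
    (hf.cap_pos x hR (by linarith)).le)

lemma IsGreen.exists_mul_rpow_mul_inv_mu_le (hp : G.ControlledWeights)
    (hH : G.EllipticHarnack) :
    ∃ c γ : ℝ, 0 < c ∧ 0 ≤ γ ∧ ∀ (x : Γ) (R : ℝ), 1 ≤ R → ∀ g,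
      G.IsGreen (G.ball x (2 * R)) x g → ∀ y ∈ G.ball x R, c * R ^ (-γ) * (G.mu x)⁻¹ ≤ g y := by
  obtain ⟨C₂, hC₂, hout⟩ := exists_outerResistanceBound hp hH
  have hC₂' : 1 < max C₂ 2 := lt_max_of_lt_left hC₂
  obtain ⟨C, hC, hcap⟩ :=
    (hout _ (le_max_left C₂ 2)).exists_cap_le_mul_rpow hp hH hC₂'
  obtain ⟨c, hc, hinner⟩ := IsGreen.exists_inv_cap_le hp hH
  refine ⟨c / C, Real.logb 2 (max C₂ 2 - 1), by positivity,
    Real.logb_nonneg one_lt_two (by linarith [le_max_right C₂ 2]), fun x R hR g hg y hy => ?_⟩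
  have hpos := hp.locallyFinite.cap_pos x (show 0 < R by linarith) (show R ≤ 2 * R by linarith)
  refine le_trans ?_ (hinner x R (by linarith) g hg y hy)
  calc c / C * R ^ (-Real.logb 2 (max C₂ 2 - 1)) * (G.mu x)⁻¹
      = c * (C * G.mu x * R ^ Real.logb 2 (max C₂ 2 - 1))⁻¹ := by
        rw [Real.rpow_neg (by linarith), mul_inv, mul_inv, div_eq_mul_inv]
        ring
    _ ≤ c * (G.cap x R (2 * R))⁻¹ :=
        mul_le_mul_of_nonneg_left (inv_anti₀ hpos (hcap x R hR)) hc.le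

lemma IsGreen.exists_mul_rpow_le_of_mem_ball (hp : G.ControlledWeights)
    (hH : G.EllipticHarnack) :
    ∃ c γ : ℝ, 0 < c ∧ 0 ≤ γ ∧ ∀ (x : Γ) (R : ℝ), 1 ≤ R → ∀ g, G.IsGreen (G.ball x R) x g →
      ∀ y ∈ G.ball x R, c * R ^ (-γ) * (G.mu x)⁻¹ ≤ g y := by
  have hf := hp.locallyFinite
  obtain ⟨p, hpp⟩ := hp.exists_controlledWeightsWith
  have hp0 : 0 < p := hpp.1
  obtain ⟨a, α, ha, hα, hbulk⟩ := IsGreen.exists_mul_rpow_mul_inv_mu_le hp hH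
  obtain ⟨b, β, hb, hβ, hboundary⟩ := IsGreen.exists_mul_rpow_mul_le hp hH
  refine ⟨min (p ^ 8) (b * a), α + β, by positivity, add_nonneg hα hβ,
    fun x R hR g hg y hy => ?_⟩
  have hmu := G.mu_pos x
  have hR0 : 0 < R := by linarith
  have hD := hf.ball_finite x R
  rcases lt_or_ge R 8 with hR8 | hR8
  · have hdist : G.graph.dist x y ≤ 8 := by
      exact_mod_cast ((mem_ball.1 hy).trans hR8).le
    have hRpow : R ^ (-(α + β)) ≤ 1 :=
      Real.rpow_le_one_of_one_le_of_nonpos hR (by linarith)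
    calc min (p ^ 8) (b * a) * R ^ (-(α + β)) * (G.mu x)⁻¹ ≤ p ^ 8 * 1 * (G.mu x)⁻¹ := by
          gcongr
          exact min_le_left _ _
      _ ≤ p ^ G.graph.dist x y * g x := by
          rw [mul_one]
          exact mul_le_mul (pow_le_pow_of_le_one hp0.le hpp.le_one hdist) (hg.inv_mu_le hf hD)
            (by positivity) (by positivity)
      _ ≤ g y := hpp.pow_dist_mul_le (hg.nonneg hf hD) hg.superharmonicOn hy
  · have hhalf : ∀ y ∈ G.ball x (R / 2), a * (R / 2) ^ (-α) * (G.mu x)⁻¹ ≤ g y :=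
      hbulk x (R / 2) (by linarith) g (by rwa [mul_div_cancel₀ R two_ne_zero])
    calc min (p ^ 8) (b * a) * R ^ (-(α + β)) * (G.mu x)⁻¹
        ≤ b * a * R ^ (-(α + β)) * (G.mu x)⁻¹ := by
          gcongr
          exact min_le_right _ _
      _ = b * R ^ (-β) * (a * R ^ (-α) * (G.mu x)⁻¹) := by
          rw [neg_add, Real.rpow_add hR0]
          ring
      _ ≤ b * R ^ (-β) * (a * (R / 2) ^ (-α) * (G.mu x)⁻¹) := by
          have hRα : R ^ (-α) ≤ (R / 2) ^ (-α) := Real.rpow_le_rpow_of_nonpos (by linarith)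
            (by linarith) (neg_nonpos.2 hα)
          gcongr
      _ ≤ g y := hboundary x R hR8 g hg _ (by positivity) hhalf y hy

end Infinite

theorem exists_outerResistanceBound_and_vol_le_mul_exitE [Countable Γ] [Infinite Γ]
    [MeasurableSpace Γ] [DiscreteMeasurableSpace Γ] (hp : G.ControlledWeights)
    (hH : G.EllipticHarnack) :
    ∃ C₂ : ℝ, 1 < C₂ ∧ G.OuterResistanceBound C₂ ∧
      ∃ C : ℝ, 0 < C ∧ ∀ (x : Γ) (R : ℝ), 1 ≤ R →
        G.vol x R ≤ ENNReal.ofReal (C * G.mu x * R ^ Real.logb 2 (C₂ - 1)) * G.exitE x R := by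
  have hf := hp.locallyFinite
  obtain ⟨C₀, -, hout⟩ := exists_outerResistanceBound hp hH
  obtain ⟨c, γ, hc, -, hgreen⟩ := IsGreen.exists_mul_rpow_le_of_mem_ball hp hH
  have h2γ : (0 : ℝ) < 2 ^ γ := by positivity
  set C₂ := max C₀ (1 + 2 ^ γ)
  have hγC₂ : (2 : ℝ) ^ γ ≤ C₂ - 1 := by linarith [le_max_right C₀ (1 + 2 ^ γ)]
  have hγ : γ ≤ Real.logb 2 (C₂ - 1) :=
    (Real.le_logb_iff_rpow_le one_lt_two (h2γ.trans_le hγC₂)).2 hγC₂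
  refine ⟨C₂, by linarith, hout C₂ (le_max_left _ _), c⁻¹, inv_pos.2 hc, fun x R hR => ?_⟩
  have hR0 : 0 < R := by linarith
  have hmu := G.mu_pos x
  obtain ⟨g, hg⟩ := hf.exists_isGreen (hf.ball_finite x R) (G.mem_ball_self x hR0)
  have hexit := hg.mul_vol_le_exitE hf le_rfl (by positivity) (hgreen x R hR g hg)
  refine le_trans ?_ (mul_le_mul_right hexit _)
  rw [← mul_assoc, ← ENNReal.ofReal_mul (by positivity)]
  refine le_mul_of_one_le_left' (ENNReal.one_le_ofReal.2 ?_)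
  calc 1 ≤ R ^ Real.logb 2 (C₂ - 1) / R ^ γ :=
        (one_le_div₀ (by positivity)).2 (Real.rpow_le_rpow_of_exponent_le hR hγ)
    _ = c⁻¹ * G.mu x * R ^ Real.logb 2 (C₂ - 1) * (c * R ^ (-γ) * (G.mu x)⁻¹) := by
        rw [Real.rpow_neg hR0.le]
        field_simp

/-! ### The inner resistance bound under bounded covering -/

/-- The bounded covering condition with an explicit number of balls. -/
def BoundedCoveringWith (G : WeightedGraph Γ) (K : ℕ) : Prop :=
  ∀ (x : Γ) (R : ℝ), 0 < R →
    ∃ s : Finset Γ, s.card ≤ K ∧ G.ball x (2 * R) ⊆ ⋃ y ∈ s, G.ball y R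

section Cutoff

variable {A A' B B' : Set Γ} {f g : Γ → ℝ}

lemma IsCutoff.mono (hf : IsCutoff A B f) (hA : A' ⊆ A) (hB : B' ⊆ B) : IsCutoff A' B' f where
  __ := hf
  eq_one x hx := hf.eq_one x (hA hx)
  eq_zero x hx := hf.eq_zero x (hB hx)

lemma IsCutoff.one_sub (hf : IsCutoff A B f) : IsCutoff B A fun y => 1 - f y where
  nonneg x := sub_nonneg.2 (hf.le_one x)
  le_one x := sub_le_self _ (hf.nonneg x)
  eq_one x hx := by rw [hf.eq_zero x hx, sub_zero]
  eq_zero x hx := by rw [hf.eq_one x hx, sub_self]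

lemma IsCutoff.min_union (hf : IsCutoff A B f) (hg : IsCutoff A B' g) :
    IsCutoff A (B ∪ B') fun y => min (f y) (g y) where
  nonneg x := le_min (hf.nonneg x) (hg.nonneg x)
  le_one x := (min_le_left _ _).trans (hf.le_one x)
  eq_one x hx := by rw [hf.eq_one x hx, hg.eq_one x hx, min_self]
  eq_zero x hx := by
    rcases hx with hx | hx
    · rw [hf.eq_zero x hx, min_eq_left (hg.nonneg x)]
    · rw [hg.eq_zero x hx, min_eq_right (hf.nonneg x)]

lemma IsCutoff.inv_mul_min (hf : IsCutoff A B f) {m : ℝ} (hm : 0 < m) (hA : ∀ a ∈ A', m ≤ f a) :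
    IsCutoff A' B fun y => m⁻¹ * min (f y) m where
  nonneg x := mul_nonneg (inv_pos.2 hm).le (le_min (hf.nonneg x) hm.le)
  le_one x := (inv_mul_le_one₀ hm).2 (min_le_right _ _)
  eq_one x hx := by rw [min_eq_right (hA x hx), inv_mul_cancel₀ hm.ne']
  eq_zero x hx := by rw [hf.eq_zero x hx, min_eq_left hm.le, mul_zero]

lemma dirichletForm_one_sub_self (G : WeightedGraph Γ) (W : Finset Γ) (f : Γ → ℝ) :
    G.dirichletForm W (fun y => 1 - f y) (fun y => 1 - f y) = G.dirichletForm W f f :=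
  G.dirichletForm_congr W fun a b _ => by ring

lemma dirichletForm_inv_mul_min_self_le (G : WeightedGraph Γ) (W : Finset Γ) (f : Γ → ℝ) (m : ℝ) :
    G.dirichletForm W (fun y => m⁻¹ * min (f y) m) (fun y => m⁻¹ * min (f y) m) ≤
      (m⁻¹) ^ 2 * G.dirichletForm W f f := by
  have hsmul : (fun y => m⁻¹ * min (f y) m) = m⁻¹ • fun y => min (f y) m := rfl
  rw [hsmul, map_smul, map_smul, LinearMap.smul_apply, smul_smul, smul_eq_mul, ← sq]
  exact mul_le_mul_of_nonneg_left (G.dirichletForm_min_const_self_le W f m) (sq_nonneg _)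

lemma dirichletForm_min_self_le_add (G : WeightedGraph Γ) (W : Finset Γ) (f g : Γ → ℝ) :
    G.dirichletForm W (fun y => min (f y) (g y)) (fun y => min (f y) (g y)) ≤
      G.dirichletForm W f f + G.dirichletForm W g g := by
  simp only [dirichletForm_apply, ← mul_add, ← Finset.sum_add_distrib]
  gcongr with a _ b _
  · exact G.weight_nonneg a b
  have hmax := abs_min_sub_min_le_max (f a) (g a) (f b) (g b)
  simp only [← sq]
  rcases le_max_iff.1 hmax with h | h
  · exact (sq_le_sq.2 h).trans (le_add_of_nonneg_right (sq_nonneg _))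
  · exact (sq_le_sq.2 h).trans (le_add_of_nonneg_left (sq_nonneg _))

lemma exists_isCutoff_superharmonicOn_diff [Nontrivial Γ] (hf : G.LocallyFinite) {W : Finset Γ}
    {U : Set Γ} (hU : G.closedNhd U ⊆ W) (hAB : Disjoint A B) :
    ∃ h, IsCutoff A B h ∧ G.SuperharmonicOn h (U \ B) ∧ G.HarmonicOn h (U \ (A ∪ B)) ∧
      ∀ f, IsCutoff A B f → G.dirichletForm W h h ≤ G.dirichletForm W f f := by
  obtain ⟨h, hcut, hmin⟩ := G.exists_isCutoff_forall_dirichletForm_le W hAB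
  have hharm : G.HarmonicOn h (U \ (A ∪ B)) := fun x hx =>
    G.markovOp_eq_of_forall_dirichletForm_le hcut.eq_one hcut.eq_zero hmin
      ((closedNhd_mono (Set.singleton_subset_iff.2 hx.1)).trans hU)
      (fun hA => hx.2 (.inl hA)) fun hB => hx.2 (.inr hB)
  refine ⟨h, hcut, fun x hx => ?_, hharm, fun f hf => hmin f hf.eq_one hf.eq_zero⟩
  by_cases hA : x ∈ A
  · calc G.markovOp h x ≤ G.markovOp (fun _ => 1) x := hf.markovOp_mono fun y _ => hcut.le_one y
      _ = h x := by rw [G.markovOp_const 1 x, hcut.eq_one x hA]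
  · exact (hharm x ⟨hx.1, fun h' => h'.elim hA hx.2⟩).le

lemma exists_isCutoff_biUnion {ι : Type*} {W : Finset Γ} {U : ι → Set Γ} {b : ℝ} (T : Finset ι)
    (h : ∀ i ∈ T, ∃ f, IsCutoff A (U i) f ∧ G.dirichletForm W f f ≤ b) :
    ∃ f, IsCutoff A (⋃ i ∈ T, U i) f ∧ G.dirichletForm W f f ≤ T.card * b := by
  classical
  induction T using Finset.induction_on with
  | empty => exact ⟨fun _ => 1, ⟨by simp, by simp, by simp, by simp⟩, by simp [dirichletForm_apply]⟩
  | insert i T hi ih =>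
    obtain ⟨f, hf, hfD⟩ := ih fun j hj => h j (Finset.mem_insert_of_mem hj)
    obtain ⟨g, hg, hgD⟩ := h i (Finset.mem_insert_self i T)
    refine ⟨_, (hg.min_union hf).mono subset_rfl (Finset.set_biUnion_insert i T U).le, ?_⟩
    rw [Finset.card_insert_of_notMem hi]
    push_cast
    linarith [G.dirichletForm_min_self_le_add W g f]

lemma exists_isCutoff_biUnion_biUnion {ι κ : Type*} {W : Finset Γ} {U : ι → Set Γ}
    {V : κ → Set Γ} {b : ℝ} (S : Finset ι) (T : Finset κ)
    (h : ∀ i ∈ S, ∀ j ∈ T, ∃ f, IsCutoff (U i) (V j) f ∧ G.dirichletForm W f f ≤ b) :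
    ∃ f, IsCutoff (⋃ i ∈ S, U i) (⋃ j ∈ T, V j) f ∧
      G.dirichletForm W f f ≤ S.card * (T.card * b) := by
  obtain ⟨f, hf, hfD⟩ := exists_isCutoff_biUnion (A := ⋃ j ∈ T, V j) (U := U) S fun i hi => by
    obtain ⟨g, hg, hgD⟩ := exists_isCutoff_biUnion T (h i hi)
    exact ⟨_, hg.one_sub, (G.dirichletForm_one_sub_self W g).trans_le hgD⟩
  exact ⟨_, hf.one_sub, (G.dirichletForm_one_sub_self W f).trans_le hfD⟩

end Cutoff

section Separation

variable [Infinite Γ]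

lemma exists_le_of_harmonicOn_geodesic (hp : G.ControlledWeights) (hH : G.EllipticHarnack)
    (N : ℕ) : ∃ m : ℝ, 0 < m ∧ ∀ (ξ : Γ) (s : ℝ), 0 < s → ∀ h : Γ → ℝ, (∀ a, 0 ≤ h a) →
      (∀ a ∈ G.ball ξ s, 1 ≤ h a) → G.SuperharmonicOn h (G.ball ξ (4 * s)) →
      ∀ q, (G.graph.dist ξ q : ℝ) ≤ N * s →
        (∀ v, G.graph.dist ξ v + G.graph.dist v q = G.graph.dist ξ q →
          2 * s ≤ G.graph.dist ξ v → G.HarmonicOn h (G.ball v s)) → m ≤ h q := by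
  obtain ⟨p, hpp⟩ := hp.exists_controlledWeightsWith
  obtain ⟨c, hc0, -, hdouble⟩ := exists_mul_le_of_superharmonicOn hp hH
  obtain ⟨C, hC1, hchain⟩ := exists_le_mul_of_walk hp hH N
  have hp0 := hpp.1
  have hC0 : 0 < C := one_pos.trans_le hC1
  refine ⟨p * c / C, by positivity, fun ξ s hs h h0 h1 hsuper q hqN hharm => ?_⟩
  have hnear : ∀ a ∈ G.ball ξ (2 * s), c ≤ h a := by
    simpa using hdouble ξ s hs h 1 zero_le_one (fun a _ => h0 a) hsuper h1
  rcases lt_or_ge (G.graph.dist ξ q : ℝ) (2 * s) with hq | hq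
  · refine le_trans ?_ (hnear q hq)
    rw [div_le_iff₀ hC0]
    nlinarith [hpp.le_one]
  obtain ⟨n, hn, hn'⟩ := exists_nat_lt_le_add_one (show 0 < 2 * s by positivity)
  -- `z` is the first vertex outside `B(ξ, 2s)` on a geodesic from `ξ` to `q`; `z'` precedes it.
  obtain ⟨z, hξz, hzq⟩ := exists_dist_eq_of_le_dist G
    (show n + 1 ≤ G.graph.dist ξ q by exact_mod_cast hn.trans_le hq)
  obtain ⟨z', hξz', hz'z⟩ := exists_dist_eq_of_le_dist G (show n ≤ G.graph.dist ξ z by omega)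
  have hadj : G.graph.Adj z z' := (SimpleGraph.dist_eq_one_iff_adj.1 (by omega)).symm
  have hξz2 : 2 * s ≤ G.graph.dist ξ z := by rw [hξz]; exact_mod_cast hn'
  have hz : p * c ≤ h z := by
    have hstep := hpp.mul_le_of_superharmonic (fun b _ => h0 b)
      (hharm z (by omega) hξz2 z (G.mem_ball_self z hs)).le hadj
    refine le_trans (mul_le_mul_of_nonneg_left (hnear z' ?_) hp0.le) hstep
    rwa [mem_ball, hξz']
  obtain ⟨w, hw⟩ := (G.connected z q).exists_walk_length_eq_dist
  have hlen : (w.length : ℝ) ≤ N * s := by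
    refine le_trans ?_ hqN
    exact_mod_cast (show w.length ≤ G.graph.dist ξ q by omega)
  rw [div_le_iff₀' hC0]
  refine hz.trans (hchain s hs h h0 z q w hlen fun v hv => ?_)
  have hzv := dist_add_dist_of_mem_support hw hv
  have hξv := G.connected.dist_triangle (u := ξ) (v := z) (w := v)
  have hvq := G.connected.dist_triangle (u := ξ) (v := v) (w := q)
  refine hharm v (by omega) (hξz2.trans ?_)
  exact_mod_cast (show G.graph.dist ξ z ≤ G.graph.dist ξ v by omega)

-- The equilibrium potential between `B(ξ, s)` and `B(z, s)` is bounded below on `B(η, s)`, since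
-- geodesics from `ξ` to `η` stay away from `z`; truncating it separates `η` from `z`.
lemma exists_isCutoff_ball_dirichletForm_le (hp : G.ControlledWeights) (hH : G.EllipticHarnack)
    (N : ℕ) : ∃ C : ℝ, 0 < C ∧ ∀ (z η ξ : Γ) (s : ℝ), 0 < s → ∀ W : Finset Γ,
      G.closedNhd (G.ball ξ ((N + 4) * s)) ⊆ W →
      (G.graph.dist ξ η : ℝ) + 14 * s < G.graph.dist ξ z + G.graph.dist z η →
      (G.graph.dist ξ η : ℝ) + s ≤ N * s → ∀ f₀, IsCutoff (G.ball ξ s) (G.ball z s) f₀ →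
      ∃ f, IsCutoff (G.ball η s) (G.ball z s) f ∧
        G.dirichletForm W f f ≤ C * G.dirichletForm W f₀ f₀ := by
  obtain ⟨m, hm0, hm⟩ := exists_le_of_harmonicOn_geodesic hp hH N
  refine ⟨m⁻¹ ^ 2, by positivity, fun z η ξ s hs W hW hsep hN f₀ hf₀ => ?_⟩
  have hξz : 7 * s < G.graph.dist ξ z := by
    have := G.dist_triangle z ξ η
    rw [SimpleGraph.dist_comm (u := z) (v := ξ)] at this
    linarith
  obtain ⟨h, hcut, hsuper, hharm, hmin⟩ := exists_isCutoff_superharmonicOn_diff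
    hp.locallyFinite hW (disjoint_ball_ball (show s + s ≤ G.graph.dist ξ z by linarith))
  refine ⟨_, hcut.inv_mul_min hm0 fun q hq => ?_, (G.dirichletForm_inv_mul_min_self_le W h m).trans
    (mul_le_mul_of_nonneg_left (hmin f₀ hf₀) (sq_nonneg _))⟩
  rw [mem_ball] at hq
  have hξq := G.dist_triangle ξ η q
  refine hm ξ s hs h hcut.nonneg (fun a ha => (hcut.eq_one a ha).ge) (hsuper.mono ?_) q
    (by linarith) fun v hv hξv => hharm.mono ?_
  · refine Set.subset_sdiff.2 ⟨G.ball_subset_ball ξ ?_, disjoint_ball_ball (by linarith)⟩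
    rw [add_mul]
    exact le_add_of_nonneg_left (by positivity)
  · have hvq : (G.graph.dist ξ v : ℝ) + G.graph.dist v q = G.graph.dist ξ q := by exact_mod_cast hv
    have hvz : 6 * s ≤ G.graph.dist v z := by
      have e₁ := G.dist_triangle ξ v z
      have e₂ := G.dist_triangle z v η
      have e₃ := G.dist_triangle v q η
      rw [SimpleGraph.dist_comm (u := z) (v := v)] at e₂
      rw [SimpleGraph.dist_comm (u := q) (v := η)] at e₃
      linarith
    have hξv' : 2 * s ≤ G.graph.dist v ξ := by rwa [SimpleGraph.dist_comm]
    refine Set.subset_sdiff.2 ⟨ball_subset_ball_of_dist_add_le ?_, Set.disjoint_union_right.2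
      ⟨disjoint_ball_ball (by linarith), disjoint_ball_ball (by linarith)⟩⟩
    linarith [(G.graph.dist v q).cast_nonneg (α := ℝ)]

end Separation

section AnnularSeparation

variable [Infinite Γ]

-- Moving first `x` to `u` and then `ξ` to `v` along geodesics separates `u` from `v`.
lemma exists_isCutoff_ball_dirichletForm_le_of_isCutoff (hp : G.ControlledWeights)
    (hH : G.EllipticHarnack) (N : ℕ) : ∃ C : ℝ, 0 < C ∧ ∀ (x ξ u v : Γ) (s : ℝ), 0 < s →
      ∀ W : Finset Γ, G.closedNhd (G.ball x ((N + 4) * s)) ⊆ W →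
      G.closedNhd (G.ball ξ ((N + 4) * s)) ⊆ W →
      (G.graph.dist x u : ℝ) + 14 * s < G.graph.dist ξ x + G.graph.dist ξ u →
      (G.graph.dist ξ v : ℝ) + 14 * s < G.graph.dist ξ u + G.graph.dist u v →
      (G.graph.dist x u : ℝ) + s ≤ N * s → (G.graph.dist ξ v : ℝ) + s ≤ N * s →
      ∀ f₀, IsCutoff (G.ball x s) (G.ball ξ s) f₀ →
      ∃ f, IsCutoff (G.ball v s) (G.ball u s) f ∧
        G.dirichletForm W f f ≤ C * G.dirichletForm W f₀ f₀ := by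
  obtain ⟨C, hC0, hC⟩ := exists_isCutoff_ball_dirichletForm_le hp hH N
  refine ⟨C * C, by positivity, fun x ξ u v s hs W hWx hWξ hxu hξv hNu hNv f₀ hf₀ => ?_⟩
  obtain ⟨f, hfc, hfD⟩ := hC ξ u x s hs W hWx
    (by rwa [SimpleGraph.dist_comm (u := x) (v := ξ)]) hNu f₀ hf₀
  obtain ⟨g, hgc, hgD⟩ := hC u v ξ s hs W hWξ hξv hNv _ hfc.one_sub
  refine ⟨g, hgc, ?_⟩
  calc G.dirichletForm W g g ≤ C * G.dirichletForm W f f := by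
        rwa [dirichletForm_one_sub_self] at hgD
    _ ≤ C * (C * G.dirichletForm W f₀ f₀) := by gcongr
    _ = C * C * G.dirichletForm W f₀ f₀ := (mul_assoc _ _ _).symm

lemma exists_isCutoff_ball_dirichletForm_le_mul_cap (hp : G.ControlledWeights)
    (hH : G.EllipticHarnack) : ∃ C : ℝ, 0 < C ∧ ∀ (x : Γ) (R : ℝ), 4 ≤ R → ∀ W : Finset Γ,
      G.closedNhd (G.ball x (100 * R)) ⊆ W → ∀ z z' : Γ,
      (G.graph.dist x z : ℝ) ≤ 2 * R → (G.graph.dist x z' : ℝ) ≤ 2 * R →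
      R / 2 ≤ G.graph.dist z z' → ∃ f, IsCutoff (G.ball z (R / 64)) (G.ball z' (R / 64)) f ∧
        G.dirichletForm W f f ≤ C * G.cap x R (4 * R) := by
  have hf := hp.locallyFinite
  obtain ⟨C, hC0, hC⟩ := exists_isCutoff_ball_dirichletForm_le_of_isCutoff hp hH 800
  refine ⟨C, hC0, fun x R hR W hW z z' hz hz' hzz' => ?_⟩
  obtain ⟨ξ, hξ⟩ := hf.exists_dist_eq x ⌈8 * R⌉₊
  have hξ1 : 8 * R ≤ G.graph.dist x ξ := by rw [hξ]; exact Nat.le_ceil _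
  have hξ2 : (G.graph.dist x ξ : ℝ) < 8 * R + 1 := by
    rw [hξ]; exact Nat.ceil_lt_add_one (by linarith)
  obtain ⟨φ, hφ⟩ := hf.exists_isCapacitor x (show R ≤ 4 * R by linarith)
  have hball : ∀ y, (G.graph.dist x y : ℝ) ≤ 10 * R →
      G.closedNhd (G.ball y (((800 : ℕ) + 4) * (R / 64))) ⊆ W := fun y hy =>
    (closedNhd_mono (ball_subset_ball_of_dist_add_le (by push_cast; linarith))).trans hW
  have hφξ : IsCutoff (G.ball x (R / 64)) (G.ball ξ (R / 64)) φ :=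
    hφ.toIsCutoff.mono (G.ball_subset_ball x (by linarith))
      (disjoint_ball_ball (by linarith)).symm.subset_compl_right
  have hsep : ∀ u v : Γ, (G.graph.dist x u : ℝ) ≤ 2 * R → (G.graph.dist x v : ℝ) ≤ 2 * R →
      (G.graph.dist ξ v : ℝ) + 14 * (R / 64) < G.graph.dist ξ u + G.graph.dist u v →
      ∃ f, IsCutoff (G.ball v (R / 64)) (G.ball u (R / 64)) f ∧
        G.dirichletForm W f f ≤ C * G.cap x R (4 * R) := by
    intro u v hu hv huv
    have huξ := G.dist_triangle x u ξ
    have hvξ := G.dist_triangle ξ x v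
    rw [SimpleGraph.dist_comm (u := u)] at huξ
    rw [SimpleGraph.dist_comm (u := ξ) (v := x)] at hvξ
    rw [← hφ.dirichletForm_eq ((closedNhd_mono (G.ball_subset_ball x (by linarith))).trans hW)]
    exact hC x ξ u v (R / 64) (by linarith) W (hball x (by simp; linarith))
      (hball ξ (by linarith)) (by rw [SimpleGraph.dist_comm (u := ξ) (v := x)]; linarith) huv
      (by push_cast; linarith) (by push_cast; linarith) φ hφξ
  rcases lt_or_ge ((G.graph.dist ξ z : ℝ) + 14 * (R / 64))
    (G.graph.dist ξ z' + G.graph.dist z' z) with h | h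
  · exact hsep z' z hz' hz h
  · obtain ⟨f, hfc, hfD⟩ := hsep z z' hz hz' (by
      rw [SimpleGraph.dist_comm (u := z') (v := z)] at h
      linarith)
    exact ⟨_, hfc.one_sub, (G.dirichletForm_one_sub_self W f).trans_le hfD⟩

end AnnularSeparation

section Covering

lemma BoundedCoveringWith.exists_ball_two_pow_mul_subset {K : ℕ} (hK : G.BoundedCoveringWith K)
    (j : ℕ) (x : Γ) {R : ℝ} (hR : 0 < R) :
    ∃ s : Finset Γ, s.card ≤ K ^ j ∧ G.ball x (2 ^ j * R) ⊆ ⋃ y ∈ s, G.ball y R := by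
  classical
  induction j generalizing x with
  | zero => exact ⟨{x}, by simp, by simp⟩
  | succ j ih =>
    obtain ⟨s, hs, hcov⟩ := hK x (2 ^ j * R) (by positivity)
    choose t ht htc using ih
    refine ⟨s.biUnion t, ?_, ?_⟩
    · rw [pow_succ']
      exact (Finset.card_biUnion_le_card_mul s t _ fun y _ => ht y).trans
        (Nat.mul_le_mul_right _ hs)
    · rw [pow_succ', mul_assoc, Finset.set_biUnion_biUnion]
      exact hcov.trans (Set.iUnion₂_mono fun y _ => htc y)

lemma BoundedCoveringWith.exists_subset_iUnion_ball {K : ℕ} (hK : G.BoundedCoveringWith K)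
    (j : ℕ) (x : Γ) {R : ℝ} (hR : 0 < R) {S : Set Γ} (hS : S ⊆ G.ball x (2 ^ j * R)) :
    ∃ t : Finset Γ, t.card ≤ K ^ j ∧ ↑t ⊆ S ∧ S ⊆ ⋃ y ∈ t, G.ball y (2 * R) := by
  classical
  obtain ⟨s, hs, hcov⟩ := hK.exists_ball_two_pow_mul_subset j x hR
  choose! w hw using fun (y : Γ) (hy : (S ∩ G.ball y R).Nonempty) => hy
  refine ⟨(s.filter fun y => (S ∩ G.ball y R).Nonempty).image w,
    (Finset.card_image_le.trans (Finset.card_filter_le _ _)).trans hs, ?_, fun a ha => ?_⟩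
  · intro y hy
    obtain ⟨v, hv, rfl⟩ := Finset.mem_image.1 hy
    exact (hw v (Finset.mem_filter.1 hv).2).1
  · obtain ⟨y, hy, hay⟩ := Set.mem_iUnion₂.1 (hcov (hS ha))
    have hne : (S ∩ G.ball y R).Nonempty := ⟨a, ha, hay⟩
    refine Set.mem_iUnion₂.2 ⟨w y, Finset.mem_image_of_mem w (Finset.mem_filter.2 ⟨hy, hne⟩), ?_⟩
    have hwy := (hw y hne).2
    rw [mem_ball] at hwy hay ⊢
    have := G.dist_triangle (w y) y a
    rw [SimpleGraph.dist_comm (u := w y) (v := y)] at this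
    linarith

-- Extending `f` by `1` inside the sphere of radius `a` and by `0` outside the sphere of radius `b`
-- does not increase the energy.
lemma LocallyFinite.cap_le_dirichletForm_of_eq_on_sphere [Nontrivial Γ] (hf : G.LocallyFinite)
    {x : Γ} {r R : ℝ} {a b : ℕ} (hab : a < b) (hra : r ≤ a) (hbR : b ≤ R) {W : Finset Γ}
    (hW : G.closedNhd (G.ball x R) ⊆ W) {f : Γ → ℝ} (h1 : ∀ y, G.graph.dist x y = a → f y = 1)
    (h0 : ∀ y, G.graph.dist x y = b → f y = 0) : G.cap x r R ≤ G.dirichletForm W f f := by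
  set F : Γ → ℝ := fun y =>
    if G.graph.dist x y ≤ a then 1 else if b ≤ G.graph.dist x y then 0 else f y
  have hF1 : ∀ y, G.graph.dist x y ≤ a → F y = 1 := fun y hy => if_pos hy
  have hF0 : ∀ y, b ≤ G.graph.dist x y → F y = 0 := fun y hy =>
    (if_neg (by omega)).trans (if_pos hy)
  have hFf : ∀ y, a ≤ G.graph.dist x y → G.graph.dist x y ≤ b → F y = f y := by
    intro y hy hy'
    rcases hy.eq_or_lt with hy | hy
    · rw [hF1 y hy.ge, h1 y hy.symm]
    rcases hy'.eq_or_lt with hy' | hy'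
    · rw [hF0 y hy'.ge, h0 y hy']
    · exact (if_neg (by omega)).trans (if_neg (by omega))
  refine (hf.cap_le_dirichletForm hW (f := F) (fun y hy => hF1 y ?_) fun y hy => hF0 y ?_).trans
    (G.dirichletForm_self_le_of_abs_sub_le W fun u v huv => ?_)
  · exact_mod_cast (hra.trans' (mem_ball.1 hy).le)
  · exact_mod_cast hbR.trans (not_lt.1 hy)
  · have huv' := G.dist_le_dist_add_one x huv
    have hvu' := G.dist_le_dist_add_one x huv.symm
    by_cases hlow : G.graph.dist x u ≤ a ∧ G.graph.dist x v ≤ a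
    · simp [hF1 u hlow.1, hF1 v hlow.2]
    by_cases hhigh : b ≤ G.graph.dist x u ∧ b ≤ G.graph.dist x v
    · simp [hF0 u hhigh.1, hF0 v hhigh.2]
    rw [hFf u (by omega) (by omega), hFf v (by omega) (by omega)]

variable [Infinite Γ]

lemma exists_cap_two_mul_le_mul_cap_four_mul (hp : G.ControlledWeights) (hH : G.EllipticHarnack)
    (hBC : G.BoundedCovering) :
    ∃ C : ℝ, 0 ≤ C ∧ ∀ (x : Γ) (R : ℝ), 4 ≤ R → G.cap x R (2 * R) ≤ C * G.cap x R (4 * R) := by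
  have hf := hp.locallyFinite
  obtain ⟨K, hK : G.BoundedCoveringWith K⟩ := hBC
  obtain ⟨C, hC0, hC⟩ := exists_isCutoff_ball_dirichletForm_le_mul_cap hp hH
  refine ⟨(K : ℝ) ^ 9 * ((K : ℝ) ^ 9 * C), by positivity, fun x R hR => ?_⟩
  have hR0 : 0 < R := by linarith
  have hcap := hf.cap_pos x hR0 (show R ≤ 4 * R by linarith)
  obtain ⟨W, hW⟩ := hf.exists_closedNhd_subset (hf.ball_finite x (100 * R))
  have ha := Nat.le_ceil R
  have ha' := Nat.ceil_lt_add_one hR0.le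
  have hb := Nat.floor_le (show 0 ≤ 2 * R by linarith)
  have hb' := Nat.lt_floor_add_one (2 * R)
  set a := ⌈R⌉₊
  set b := ⌊2 * R⌋₊
  have hab : a < b := by exact_mod_cast (show (a : ℝ) < b by linarith)
  have hnet : ∀ n : ℕ, (n : ℝ) ≤ 2 * R → ∃ t : Finset Γ, t.card ≤ K ^ 9 ∧
      (∀ y ∈ t, G.graph.dist x y = n) ∧
        ∀ y, G.graph.dist x y = n → y ∈ ⋃ z ∈ t, G.ball z (R / 64) := by
    intro n hn
    have h := hK.exists_subset_iUnion_ball 9 x (show 0 < R / 128 by positivity)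
      (S := {y | G.graph.dist x y = n}) fun y (hy : _ = n) => by rw [mem_ball, hy]; linarith
    rwa [show 2 * (R / 128) = R / 64 by ring] at h
  obtain ⟨t, ht, hta, htcov⟩ := hnet a (by linarith)
  obtain ⟨t', ht', htb, htcov'⟩ := hnet b hb
  obtain ⟨f, hfc, hfD⟩ := exists_isCutoff_biUnion_biUnion (G := G) (W := W)
    (U := fun z => G.ball z (R / 64)) (V := fun z => G.ball z (R / 64)) t t' fun z hz z' hz' => by
      have hzz' := G.dist_triangle x z z'
      have hza : (G.graph.dist x z : ℝ) = a := by exact_mod_cast hta z hz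
      have hzb : (G.graph.dist x z' : ℝ) = b := by exact_mod_cast htb z' hz'
      exact hC x R hR W hW z z' (by linarith) (by linarith) (by linarith)
  calc G.cap x R (2 * R) ≤ G.dirichletForm W f f :=
        hf.cap_le_dirichletForm_of_eq_on_sphere hab ha hb
          ((closedNhd_mono (G.ball_subset_ball x (by linarith))).trans hW)
          (fun y hy => hfc.eq_one y (htcov y hy)) fun y hy => hfc.eq_zero y (htcov' y hy)
    _ ≤ t.card * (t'.card * (C * G.cap x R (4 * R))) := hfD
    _ ≤ (K : ℝ) ^ 9 * ((K : ℝ) ^ 9 * (C * G.cap x R (4 * R))) := by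
        gcongr <;> exact_mod_cast ‹_›
    _ = (K : ℝ) ^ 9 * ((K : ℝ) ^ 9 * C) * G.cap x R (4 * R) := by ring

theorem BoundedCovering.exists_innerResistanceBound (hBC : G.BoundedCovering)
    (hp : G.ControlledWeights) (hH : G.EllipticHarnack) :
    ∃ C₁ : ℝ, 1 < C₁ ∧ G.InnerResistanceBound C₁ := by
  have hf := hp.locallyFinite
  obtain ⟨p, hpp⟩ := hp.exists_controlledWeightsWith
  obtain ⟨C, hC0, hC⟩ := exists_cap_two_mul_le_mul_cap_four_mul hp hH hBC
  have hp0 := hpp.1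
  set D := (p ^ 4)⁻¹ / (p ^ 16 / (2 * (16 : ℕ) ^ 2))
  have hD0 : 0 < D := by positivity
  refine ⟨1 + C + D, by linarith, (hf.innerResistanceBound_iff (by linarith)).2 fun x R hR => ?_⟩
  have hcap := hf.cap_pos x hR (show R ≤ 4 * R by linarith)
  have hle : ∀ c, c ≤ 1 + C + D → G.cap x R (2 * R) ≤ c * G.cap x R (4 * R) →
      G.cap x R (2 * R) ≤ (1 + C + D) * G.cap x R (4 * R) := fun c hc h =>
    h.trans (mul_le_mul_of_nonneg_right hc hcap.le)
  rcases le_or_gt 4 R with hR4 | hR4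
  · exact hle C (by linarith) (hC x R hR4)
  · refine hle D (by linarith) ?_
    calc G.cap x R (2 * R) ≤ (p ^ 4)⁻¹ * G.mu x :=
          hpp.cap_le_mul_mu x hR (by linarith) (by exact_mod_cast hR4.le)
      _ = D * (p ^ 16 / (2 * (16 : ℕ) ^ 2) * G.mu x) := by
          rw [← mul_assoc, div_mul_cancel₀ _ (by positivity)]
      _ ≤ D * G.cap x R (4 * R) := mul_le_mul_of_nonneg_left (hpp.mul_mu_le_cap x hR
          (by linarith) (by push_cast; linarith)) hD0.le

end Covering

end WeightedGraph

theorem mainTheorem7 {Γ : Type*} [Countable Γ] [Infinite Γ]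
    [MeasurableSpace Γ] [DiscreteMeasurableSpace Γ] (G : WeightedGraph Γ)
    (hp₀ : G.ControlledWeights) (hH : G.EllipticHarnack) :
    (∃ C₂ : ℝ, 1 < C₂ ∧ G.OuterResistanceBound C₂ ∧
      ∃ C : ℝ, 0 < C ∧ ∀ (x : Γ) (R : ℝ), 1 ≤ R →
        G.vol x R ≤ ENNReal.ofReal (C * G.mu x * R ^ Real.logb 2 (C₂ - 1)) * G.exitE x R) ∧
    (∀ C₂ : ℝ, 1 < C₂ → G.OuterResistanceBound C₂ →
      ∃ C : ℝ, 0 < C ∧ ∀ (x : Γ) (R : ℝ), 1 ≤ R →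
        G.vol x R ≤ ENNReal.ofReal (C * G.mu x * R ^ Real.logb 2 (C₂ - 1)) * G.exitE x (2 * R)) ∧
    (∃ c : ℝ, 0 < c ∧ ∀ (x : Γ) (R : ℝ), 0 < R →
      ENNReal.ofReal (c * R ^ 2) ≤ G.exitE x R ∧ G.exitE x R < ∞) ∧
    (G.BoundedCovering →
      (∃ C₁ : ℝ, 1 < C₁ ∧ G.InnerResistanceBound C₁) ∧
      ∀ C₁ : ℝ, 1 < C₁ → G.InnerResistanceBound C₁ →
        ∃ c : ℝ, 0 < c ∧ ∀ (x : Γ) (R : ℝ), 1 ≤ R →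
          ENNReal.ofReal (c * G.mu x * R ^ (2 - Real.logb 2 (C₁ - 1))) ≤ G.vol x (2 * R)) :=
  ⟨WeightedGraph.exists_outerResistanceBound_and_vol_le_mul_exitE hp₀ hH,
    fun _ hC₂ hout => hout.exists_vol_le_mul_exitE_two_mul hp₀ hH hC₂,
    WeightedGraph.exists_ofReal_mul_sq_le_exitE_and_exitE_lt_top hp₀ hH,
    fun hBC => ⟨hBC.exists_innerResistanceBound hp₀ hH,
      fun _ hC₁ hin => hin.exists_le_vol_two_mul hp₀ hH hC₁⟩⟩
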